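/- Let $d\ge 1$, let $\alpha_1,\dots,\alpha_d>0$ with $\alpha_1+\cdots+\alpha_d=1$, and let $\sigma=(\sigma(i,j;k,l))_{i,j,k,l=1}^d$ be complex numbers with $\sigma(i,j;k,l)=0$ unless $\alpha_i=\alpha_l$ and $\alpha_j=\alpha_k$. Put $$M_\alpha(\mathbb C)=\{D\in M_d(\mathbb C)\mid D_{ij}=0\text{ unless }\alpha_i=\alpha_j\},$$ $$[\eta_\alpha(D)]_{ij}=\sum_{k,l=1}^d\sigma(i,k;l,j)\,\alpha_k D_{kl},\qquad \mathrm{tr}_\alpha(D)=\sum_{i=1}^d\alpha_iD_{ii}\qquad(D\in M_\alpha(\mathbb C)),$$ so that $\eta_\alpha$ maps $M_\alpha(\mathbb C)$ to itself. Consider a sequence of tuples $(N_1,\dots,N_d)\in\mathbb N^d$ such that $n:=N_1+\cdots+N_d\to\infty$ and $N_i/n\to\alpha_i$ for all $i$. For each tuple let $X=X_{N_1,\dots,N_d}$ be the random $n\times n$ block matrix $X=\sum_{i,j=1}^dE_{ij}\otimes A^{(i,j)}$ (that is, with $(i,j)$ block $A^{(i,j)}$), where the $A^{(i,j)}=(a^{(i,j)}_{rp})_{1\le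 r\le N_i,\,1\le p\le N_j}$ are random $N_i\times N_j$ matrices such that all entries of $X$ together form a complex Gaussian family (their real and imaginary parts are jointly Gaussian) with $$a^{(i,j)}_{rp}=\overline{a^{(j,i)}_{pr}},\qquad E[a^{(i,j)}_{rp}]=0,\qquad E[a^{(i,j)}_{rp}a^{(k,l)}_{qs}]=\frac1n\,\delta_{rs}\delta_{pq}\,\sigma(i,j;k,l)$$ for all $i,j,k,l$ and all admissible $r,p,q,s$; in particular $X$ is selfadjoint. Then there is an analytic function $\mathcal G:\mathbb C^+\to M_\alpha(\mathbb C)$ on the open upper half-plane $\mathbb C^+$ which satisfies $$\lim_{|z|\to\infty,\ \Im z>0}z\,\mathcal G(z)=I_d\qquad\text{and}\qquad z\,\mathcal G(z)=I_d+\eta_\alpha(\mathcal G(z))\,\mathcal G(z)\quad\text{for all }z\in\mathbb C^+,$$ and it is the only analytic function $\mathbb C^+\to M_\alpha(\mathbb C)$ with these two properties. Moreover $X_{N_1,\dots,N_d}$ has a limiting eigenvalue distribution: there is a probability measure $\mu$ on $\mathbb R$ such that the expected empirical eigenvalue distributions of $X_{N_1,\dots,N_d}$ converge weakly to $\mu$,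 i.e. $E\big[\frac1n\sum_{x=1}^nf(\lambda_x)\big]\to\int f\,d\mu$ for every bounded continuous $f:\mathbb R\to\mathbb R$, where $\lambda_1,\dots,\lambda_n$ are the eigenvalues of $X_{N_1,\dots,N_d}$; and its Cauchy transform is $$\int_{\mathbb R}\frac{1}{z-t}\,d\mu(t)=\mathrm{tr}_\alpha(\mathcal G(z))\qquad\text{for all }z\in\mathbb C^+.$$ -/

import Mathlib

open MeasureTheory ProbabilityTheory Filter Topology
open scoped ENNReal BoundedContinuousFunction

noncomputable section

namespace RectBlock

/-- The open upper half-plane `ℂ⁺`, as a subset of `ℂ`. -/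
def upperHalf : Set ℂ := {z | 0 < z.im}

/-- The Cauchy transform `G_μ(z) = ∫ 1 / (z - t) dμ(t)` of a measure on the real line. -/
def cauchyTransform (μ : Measure ℝ) (z : ℂ) : ℂ := ∫ t : ℝ, (z - (t : ℂ))⁻¹ ∂μ

section Operators

variable {d : ℕ}

/-- `M_α(ℂ)`: the `d × d` matrices `D` with `D i j = 0` unless `α i = α j`. -/
def weightedMatrices (α : Fin d → ℝ) : Submodule ℂ (Matrix (Fin d) (Fin d) ℂ) where
  carrier := {D | ∀ i j, α i ≠ α j → D i j = 0}
  zero_mem' := fun _ _ _ => rfl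
  add_mem' := fun {D E} hD hE i j hij => by simp [hD i j hij, hE i j hij]
  smul_mem' := fun c D hD i j hij => by simp [hD i j hij]

/-- The weighted covariance mapping
`[η_α(D)]_{ij} = ∑_{k,l} σ(i,k;l,j) α_k D_{kl}`. The formula makes sense for every `d × d` matrix;
the lemma below says that it restricts to a map from `M_α(ℂ)` to itself. -/
def etaWeighted (α : Fin d → ℝ) (σ : Fin d → Fin d → Fin d → Fin d → ℂ)
    (D : Matrix (Fin d) (Fin d) ℂ) : Matrix (Fin d) (Fin d) ℂ :=
  Matrix.of fun i j => ∑ k, ∑ l, σ i k l j * (α k : ℂ) * D k l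

theorem etaWeighted_mem (α : Fin d → ℝ) (σ : Fin d → Fin d → Fin d → Fin d → ℂ)
    (hσ : ∀ i j k l, σ i j k l ≠ 0 → α i = α l ∧ α j = α k) (D : Matrix (Fin d) (Fin d) ℂ) :
    etaWeighted α σ D ∈ weightedMatrices α := by
  intro i j hij
  change ∑ k, ∑ l, σ i k l j * (α k : ℂ) * D k l = 0
  refine Finset.sum_eq_zero fun k _ => Finset.sum_eq_zero fun l _ => ?_
  have h : σ i k l j = 0 := by
    by_contra h
    exact hij (hσ i k l j h).1
  simp [h]

/-- The weighted trace `tr_α(D) = ∑_i α_i D_{ii}`. -/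
def trWeighted (α : Fin d → ℝ) (D : Matrix (Fin d) (Fin d) ℂ) : ℂ :=
  ∑ i, (α i : ℂ) * D i i

/-- `𝒢` is (on the upper half-plane) an `M_α(ℂ)`-valued analytic function such that
`z 𝒢(z) → I_d` as `|z| → ∞`, `Im z > 0`, and `z 𝒢(z) = I_d + η_α(𝒢(z)) 𝒢(z)` for all `z ∈ ℂ⁺`.
Only the values of `𝒢` on the upper half-plane matter. -/
structure IsSolution (α : Fin d → ℝ) (σ : Fin d → Fin d → Fin d → Fin d → ℂ)
    (𝒢 : ℂ → Matrix (Fin d) (Fin d) ℂ) : Prop where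
  mem : ∀ z ∈ upperHalf, 𝒢 z ∈ weightedMatrices α
  analytic : ∀ i j, AnalyticOnNhd ℂ (fun z => 𝒢 z i j) upperHalf
  tendsto : Tendsto (fun z => z • 𝒢 z) (Bornology.cobounded ℂ ⊓ 𝓟 upperHalf) (𝓝 1)
  equation : ∀ z ∈ upperHalf, z • 𝒢 z = 1 + etaWeighted α σ (𝒢 z) * 𝒢 z

end Operators

section Model

variable {d : ℕ} {N : Fin d → ℕ}

/-- Rows and columns of a square matrix that is cut into `d` parts of sizes `N_1, …, N_d`. -/
abbrev BlockIndex (N : Fin d → ℕ) : Type := (i : Fin d) × Fin (N i)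

/-- The block matrix `∑_{i,j} E_{ij} ⊗ A^{(i,j)}`, where `A^{(i,j)}` is `N_i × N_j`. -/
def blockMatrix (A : (i j : Fin d) → Matrix (Fin (N i)) (Fin (N j)) ℂ) :
    Matrix (BlockIndex N) (BlockIndex N) ℂ :=
  Matrix.of fun p q => A p.1 q.1 p.2 q.2

/-- The entries of the random blocks `A^{(i,j)}` form a Gaussian family (their real and imaginary
parts are jointly Gaussian) with
`a^{(i,j)}_{rp} = conj a^{(j,i)}_{pr}`, mean zero, and
`E[a^{(i,j)}_{rp} a^{(k,l)}_{qs}] = (1/n) δ_{rs} δ_{pq} σ(i,j;k,l)`, where `n = N_1 + ⋯ + N_d`. -/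
structure IsGaussianBlockModel (σ : Fin d → Fin d → Fin d → Fin d → ℂ)
    {Ω : Type*} [MeasurableSpace Ω] (P : Measure Ω)
    (A : (i j : Fin d) → Ω → Matrix (Fin (N i)) (Fin (N j)) ℂ) : Prop where
  gaussian : HasGaussianLaw
    (fun ω (e : BlockIndex N × BlockIndex N) => A e.1.1 e.2.1 ω e.1.2 e.2.2) P
  conj_symm : ∀ i j ω r p, A i j ω r p = star (A j i ω p r)
  mean_zero : ∀ i j r p, ∫ ω, A i j ω r p ∂P = 0
  covariance : ∀ (i j k l : Fin d) (r : Fin (N i)) (p : Fin (N j)) (q : Fin (N k)) (s : Fin (N l)),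
    ∫ ω, A i j ω r p * A k l ω q s ∂P =
      1 / ((∑ i', N i' : ℕ) : ℂ) *
        (if (r : ℕ) = (s : ℕ) ∧ (p : ℕ) = (q : ℕ) then σ i j k l else 0)

theorem IsGaussianBlockModel.isHermitian {σ : Fin d → Fin d → Fin d → Fin d → ℂ}
    {Ω : Type*} [MeasurableSpace Ω] {P : Measure Ω}
    {A : (i j : Fin d) → Ω → Matrix (Fin (N i)) (Fin (N j)) ℂ}
    (h : IsGaussianBlockModel σ P A) (ω : Ω) :
    (blockMatrix fun i j => A i j ω).IsHermitian := by
  ext p q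
  exact (h.conj_symm p.1 q.1 ω p.2 q.2).symm

/-- The empirical eigenvalue distribution `(1/n) ∑_x δ_{λ_x}` of a Hermitian `n × n` matrix, the
eigenvalues being counted with multiplicity. -/
def empiricalEigenvalueDistribution {ι : Type*} [Fintype ι] [DecidableEq ι] {X : Matrix ι ι ℂ}
    (hX : X.IsHermitian) : Measure ℝ :=
  (Fintype.card ι : ℝ≥0∞)⁻¹ • ∑ x, Measure.dirac (hX.eigenvalues x)

/-- `μ` is the limiting eigenvalue distribution of the random Hermitian matrices `X m` as `m → ∞`:
the expected values `E[μ_{X m}]` of the empirical eigenvalue distributions converge weakly to `μ`,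
that is, `E[∫ f dμ_{X m}] → ∫ f dμ` for every bounded continuous `f`. -/
def IsLimitingEigenvalueDistribution {ι : ℕ → Type*} [∀ m, Fintype (ι m)] [∀ m, DecidableEq (ι m)]
    {Ω : ℕ → Type*} [∀ m, MeasurableSpace (Ω m)] (P : ∀ m, Measure (Ω m))
    {X : ∀ m, Ω m → Matrix (ι m) (ι m) ℂ} (hX : ∀ m ω, (X m ω).IsHermitian)
    (μ : Measure ℝ) : Prop :=
  ∀ f : ℝ →ᵇ ℝ,
    Tendsto (fun m => ∫ ω, (∫ t, f t ∂(empiricalEigenvalueDistribution (hX m ω))) ∂(P m))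
      atTop (𝓝 (∫ t, f t ∂μ))

end Model

end RectBlock

end

open RectBlock

/-!
The proof studies the expected block Green function
`h_{kl}(z) = E[(1 / (n α_k)) ∑_r ((z - X)⁻¹)_{(k,r),(l,r)}]`, restricted to `α_k = α_l`
(`expectedGreen`), rather than the moments of `X`.

Gaussian integration by parts (`integral_entry_mul`) turns `E[X (z - X)⁻¹]` into an expression in
products of two block traces (`IsGaussianBlockModel.schwingerDyson`). Up to errors controlled by
`1/n + ∑_i |N_i/n - α_i|` (`discrepancy`), this says that the random block Green function solves
`z H = 1 + η_α(H) H` on average. Applying the same formula with `H` itself as a test function bounds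
the variance of `H` when `Im z` is large, because the equation is contractive there. Hence `h`
solves the equation up to `O(discrepancy)` on a half-plane `Im z ≥ Y`, with constants uniform in `z`
(`exists_norm_equation_expectedGreen_le`).

The functions `h` are holomorphic on `ℂ⁺` and bounded by a multiple of `1 / Im z`. On `Im z ≥ Y` the
contractive equation makes them a Cauchy sequence, the three lines theorem propagates this to all of
`ℂ⁺`, and the identity theorem propagates the equation (`exists_tendsto_of_approx`). The limit `𝒢`
satisfies `z 𝒢(z) → 1` (`tendsto_smul_of_equation`), and it is unique since two solutions coincide
for large `|z|` (`eqOn_of_equation`).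

Finally `tr_α h` is the Cauchy transform of the expected empirical eigenvalue distribution, so these
Cauchy transforms converge to `tr_α 𝒢`, and the Stieltjes continuity theorem
(`exists_tendsto_of_tendsto_cauchyTransform`) yields weak convergence to a probability measure with
Cauchy transform `tr_α 𝒢`.
-/

noncomputable section

namespace RectBlock

/-! ### Gaussian integration by parts -/

section Stein

open scoped NNReal

theorem integral_mul_gaussianReal {v : ℝ≥0} (hv : v ≠ 0) {f f' : ℝ → ℂ}
    (hf : ∀ t, HasDerivAt f (f' t) t) {C C' : ℝ} (hC : ∀ t, ‖f t‖ ≤ C) (hC' : ∀ t, ‖f' t‖ ≤ C') :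
    ∫ t, (t : ℂ) * f t ∂gaussianReal 0 v = (v : ℂ) * ∫ t, f' t ∂gaussianReal 0 v := by
  have hv' : (v : ℝ) ≠ 0 := by exact_mod_cast hv
  set g : ℝ → ℝ := gaussianPDFReal 0 v with hg
  have hfm : Measurable f :=
    (continuous_iff_continuousAt.2 fun t => (hf t).continuousAt).measurable
  have hf'm : Measurable f' := by
    have : f' = deriv f := funext fun t => (hf t).deriv.symm
    rw [this]; exact measurable_deriv f
  have hgd : ∀ t, HasDerivAt (fun t => (g t : ℂ)) ((-(t / v) * g t : ℝ) : ℂ) t := by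
    intro t
    refine HasDerivAt.ofReal_comp ?_
    have h1 : HasDerivAt (fun x : ℝ => -(x - 0) ^ 2 / (2 * (v : ℝ))) (-(t / v)) t := by
      have := (((hasDerivAt_id t).sub_const 0).pow 2).neg.div_const (2 * (v : ℝ))
      refine this.congr_deriv ?_
      simp; field_simp
    have h2 := h1.exp.const_mul (√(2 * Real.pi * v))⁻¹
    refine (h2.congr_deriv ?_)
    rw [hg, gaussianPDFReal]; ring
  have hgi : Integrable g := integrable_gaussianPDFReal 0 v
  have hid : Integrable (fun t : ℝ => t) (gaussianReal 0 v) :=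
    memLp_one_iff_integrable.1 (memLp_id_gaussianReal (μ := 0) (v := v) 1)
  have hgi' : Integrable (fun t => t * g t) := by
    rw [gaussianReal_of_var_ne_zero 0 hv, integrable_withDensity_iff
      (measurable_gaussianPDF 0 v) (ae_of_all _ fun _ => gaussianPDF_lt_top)] at hid
    simpa [toReal_gaussianPDF] using hid
  have bdd_mul : ∀ {k : ℝ → ℂ} {u : ℝ → ℝ} {D : ℝ}, Measurable k → (∀ t, ‖k t‖ ≤ D) →
      Integrable u → Integrable (fun t => k t * (u t : ℂ)) := by
    intro k u D hk hD hu
    exact hu.ofReal.bdd_mul hk.aestronglyMeasurable (ae_of_all _ hD)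
  have key := integral_mul_deriv_eq_deriv_mul_of_integrable (u := f) (v := fun t => (g t : ℂ))
    (fun t _ => hf t) (fun t _ => hgd t) ?_ (bdd_mul hf'm hC' hgi) (bdd_mul hfm hC hgi)
  · rw [integral_gaussianReal_eq_integral_smul hv, integral_gaussianReal_eq_integral_smul hv]
    have h1 : ∫ t, g t • ((t : ℂ) * f t) = -(v : ℂ) * ∫ t, f t * ((-(t / v) * g t : ℝ) : ℂ) := by
      rw [← integral_const_mul]
      refine integral_congr_ae (ae_of_all _ fun t => ?_)
      have : (v : ℂ) ≠ 0 := by exact_mod_cast hv'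
      simp only [Complex.real_smul]
      push_cast
      field_simp
    rw [h1, key]
    simp only [Complex.real_smul, neg_mul_neg]
    congr 2
    ext t
    ring
  · have := bdd_mul (u := fun t => -(t / v) * g t) hfm hC ?_
    · exact this
    · have := hgi'.const_mul (-(v : ℝ)⁻¹)
      refine this.congr (ae_of_all _ fun t => ?_)
      simp only
      field_simp

variable {Ω E : Type*} [MeasurableSpace Ω] {P : Measure Ω} [NormedAddCommGroup E]
  [NormedSpace ℝ E] [MeasurableSpace E] [BorelSpace E] [CompleteSpace E]
  [SecondCountableTopology E]

/-- Gaussian integration by parts for a centred Gaussian vector `Y` and a continuous functional `L`: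
`E[L(Y) F(Y)]` is the expectation of the derivative of `F` at `Y` in the direction
`κ = E[L(Y) Y]`. The vector `Y - (L(Y) / E[L(Y)²]) κ` is uncorrelated with, hence independent of,
`L(Y)`, so that Fubini reduces the claim to the one-dimensional case. -/
theorem integral_mul_of_hasGaussianLaw {Y : Ω → E} (hY : HasGaussianLaw Y P)
    (hY0 : ∫ ω, Y ω ∂P = 0) (L : E →L[ℝ] ℝ) {κ : E} (hκ : ∫ ω, L (Y ω) • Y ω ∂P = κ)
    {F F' : E → ℂ} (hF : Continuous F) (hF' : Continuous F') {C C' : ℝ}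
    (hC : ∀ y, ‖F y‖ ≤ C) (hC' : ∀ y, ‖F' y‖ ≤ C')
    (hd : ∀ y, HasDerivAt (fun t : ℝ => F (y + t • κ)) (F' y) 0) :
    ∫ ω, (L (Y ω) : ℂ) * F (Y ω) ∂P = ∫ ω, F' (Y ω) ∂P := by
  have := hY.isProbabilityMeasure
  have hYm := hY.aemeasurable
  set ξ : Ω → ℝ := fun ω => L (Y ω) with hξ
  have hξG : HasGaussianLaw ξ P := hY.map_fun L
  have hξ0 : ∫ ω, ξ ω ∂P = 0 := by
    rw [hξ, L.integral_comp_comm hY.integrable, hY0, map_zero]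
  have hYξ : Integrable (fun ω => ξ ω • Y ω) P :=
    memLp_one_iff_integrable.1 (hY.memLp_two.smul (r := 1) hξG.memLp_two)
  have hξξ : Integrable (fun ω => ξ ω * ξ ω) P :=
    MemLp.integrable_mul hξG.memLp_two hξG.memLp_two
  set s : ℝ := L κ with hs
  have hs2 : s = ∫ ω, ξ ω * ξ ω ∂P := by
    rw [hs, ← hκ, ← L.integral_comp_comm hYξ]
    simp [hξ]
  have hvar : Var[ξ; P] = s := by
    rw [variance_of_integral_eq_zero hξG.aemeasurable hξ0, hs2]
    simp [pow_two]
  have hs0 : 0 ≤ s := hvar ▸ variance_nonneg _ _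
  rcases hs0.eq_or_lt with hs0 | hspos
  · -- `L(Y)` vanishes almost surely, and so does `κ`.
    have hz : ξ =ᵐ[P] 0 := by
      have h := (integral_eq_zero_iff_of_nonneg (fun ω => mul_self_nonneg (ξ ω))
        hξξ).1 (hs2.symm.trans hs0.symm)
      filter_upwards [h] with ω hω
      simpa using hω
    have hκ0 : κ = 0 := by
      rw [← hκ]
      refine integral_eq_zero_of_ae ?_
      filter_upwards [hz] with ω hω
      change ξ ω • Y ω = 0
      simp [hω]
    have hF'0 : ∀ y, F' y = 0 := fun y => by
      have h1 := hd y
      simp only [hκ0, smul_zero, add_zero] at h1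
      exact h1.unique (hasDerivAt_const _ _)
    simp only [hF'0, integral_zero]
    refine integral_eq_zero_of_ae ?_
    filter_upwards [hz] with ω hω
    change (ξ ω : ℂ) * _ = 0
    simp [hω]
  set c : E := s⁻¹ • κ with hc
  set Z : Ω → E := fun ω => Y ω - ξ ω • c with hZ
  have hpair : HasGaussianLaw (fun ω => (ξ ω, Z ω)) P :=
    hY.map_fun (L.prod (ContinuousLinearMap.id ℝ E - L.smulRight c))
  have hZG : HasGaussianLaw Z P := hpair.snd
  have hind : IndepFun ξ Z P := by
    refine hpair.indepFun_of_covariance_strongDual fun L₁ L₂ => ?_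
    have hL₁ : HasGaussianLaw (L₁ ∘ ξ) P := hξG.map L₁
    have hL₂ : HasGaussianLaw (L₂ ∘ Z) P := hZG.map L₂
    rw [covariance_eq_sub hL₁.memLp_two hL₂.memLp_two]
    have e1 : ∫ ω, (L₁ ∘ ξ) ω ∂P = 0 := by
      simp only [Function.comp_apply]
      rw [L₁.integral_comp_comm hξG.integrable, hξ0, map_zero]
    rw [e1, zero_mul, sub_zero]
    have e2 : ∀ ω, (L₁ ∘ ξ * L₂ ∘ Z) ω
        = L₁ 1 * (L₂ (ξ ω • Y ω) - (ξ ω * ξ ω) * L₂ c) := by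
      intro ω
      have : L₁ (ξ ω) = ξ ω * L₁ 1 := by
        conv_lhs => rw [← mul_one (ξ ω), ← smul_eq_mul, map_smul]
        rfl
      simp only [Pi.mul_apply, Function.comp_apply, this, hZ, map_sub, map_smul, smul_eq_mul]
      ring
    simp only [e2]
    rw [integral_const_mul, integral_sub (L₂.integrable_comp hYξ) (hξξ.mul_const _),
      L₂.integral_comp_comm hYξ, hκ, integral_mul_const]
    have : ∫ ω, ξ ω * ξ ω ∂P = s := hs2.symm
    change L₁ 1 * (L₂ κ - (∫ ω, ξ ω * ξ ω ∂P) * L₂ c) = 0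
    rw [this, hc, map_smul, smul_eq_mul, ← mul_assoc, mul_inv_cancel₀ hspos.ne', one_mul, sub_self,
      mul_zero]
  have hmap := hind.map_prod_eq_prod_map_map hξG.aemeasurable hZG.aemeasurable
  have hlaw : P.map ξ = gaussianReal 0 s.toNNReal := by
    rw [hξG.map_eq_gaussianReal, hξ0, hvar]
  have hv : s.toNNReal ≠ 0 := by simpa using hspos
  have hvs : ((s.toNNReal : ℝ≥0) : ℂ) = s := by
    exact_mod_cast Real.coe_toNNReal s hspos.le
  have hYd : ∀ ω, Y ω = Z ω + ξ ω • c := fun ω => by simp [hZ]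
  have hpm : AEMeasurable (fun ω => (ξ ω, Z ω)) P := hpair.aemeasurable
  -- Fubini: both sides are integrals over the product of the laws of `ξ` and `Z`.
  have fub : ∀ G : ℝ × E → ℂ, Continuous G →
      Integrable G ((gaussianReal 0 s.toNNReal).prod (P.map Z)) →
      ∫ ω, G (ξ ω, Z ω) ∂P = ∫ y, ∫ t, G (t, y) ∂(gaussianReal 0 s.toNNReal) ∂(P.map Z) := by
    intro G hG hGi
    have hpZ : IsProbabilityMeasure (P.map Z) := Measure.isProbabilityMeasure_map hZG.aemeasurable
    rw [← integral_map (φ := fun ω => (ξ ω, Z ω)) hpm hG.aestronglyMeasurable, hmap, hlaw,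
      integral_prod_symm _ hGi]
  have hpZ : IsProbabilityMeasure (P.map Z) := Measure.isProbabilityMeasure_map hZG.aemeasurable
  have hcont : Continuous fun q : ℝ × E => q.2 + q.1 • c := by fun_prop
  have hG1 : Continuous fun q : ℝ × E => (q.1 : ℂ) * F (q.2 + q.1 • c) :=
    (Complex.continuous_ofReal.comp continuous_fst).mul (hF.comp hcont)
  have hG2 : Continuous fun q : ℝ × E => F' (q.2 + q.1 • c) := hF'.comp hcont
  have hid : Integrable (fun t : ℝ => t) (gaussianReal 0 s.toNNReal) :=
    memLp_one_iff_integrable.1 (memLp_id_gaussianReal (μ := 0) (v := s.toNNReal) 1)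
  have l1 := fub _ hG1 (by
    have h1 : Integrable (fun q : ℝ × E => (q.1 : ℂ))
        ((gaussianReal 0 s.toNNReal).prod (P.map Z)) := (hid.comp_fst (P.map Z)).ofReal
    exact h1.mul_bdd (hF.comp hcont).aestronglyMeasurable
      (ae_of_all _ fun q => hC _))
  have l2 := fub _ hG2
      (Integrable.of_bound hG2.aestronglyMeasurable C' (ae_of_all _ fun q => hC' _))
  simp only at l1 l2
  have r1 : ∫ ω, (ξ ω : ℂ) * F (Y ω) ∂P = ∫ ω, (ξ ω : ℂ) * F (Z ω + ξ ω • c) ∂P := by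
    simp only [← hYd]
  have r2 : ∫ ω, F' (Y ω) ∂P = ∫ ω, F' (Z ω + ξ ω • c) ∂P := by
    simp only [← hYd]
  change ∫ ω, (ξ ω : ℂ) * F (Y ω) ∂P = _
  rw [r1, r2, l1, l2]
  congr 1
  ext y
  have hder : ∀ t : ℝ, HasDerivAt (fun t : ℝ => F (y + t • c)) ((s : ℂ)⁻¹ * F' (y + t • c)) t := by
    intro t
    have h1 := hd (y + t • c)
    have h2 : HasDerivAt (fun t' : ℝ => s⁻¹ * (t' - t)) s⁻¹ t := by
      simpa using ((hasDerivAt_id t).sub_const t).const_mul s⁻¹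
    have h3 : HasDerivAt (fun τ : ℝ => F (y + t • c + τ • κ)) (F' (y + t • c))
        ((fun t' : ℝ => s⁻¹ * (t' - t)) t) := by simpa using h1
    have h4 := h3.scomp t h2
    refine (h4.congr_deriv (by simp)).congr_of_eventuallyEq (Eventually.of_forall fun t' => ?_)
    simp only [Function.comp_apply, hc]
    congr 1
    rw [smul_smul, smul_smul, add_assoc, ← add_smul]
    congr 2
    ring
  have hC'' : ∀ t : ℝ, ‖(s : ℂ)⁻¹ * F' (y + t • c)‖ ≤ ‖(s : ℂ)⁻¹‖ * C' := fun t => by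
    rw [norm_mul]
    exact mul_le_mul_of_nonneg_left (hC' _) (norm_nonneg _)
  rw [integral_mul_gaussianReal hv hder (fun t => hC _) hC'', integral_const_mul, hvs, ← mul_assoc,
    mul_inv_cancel₀ (by exact_mod_cast hspos.ne'), one_mul]

end Stein

/-! ### Resolvents of Hermitian matrices -/

section Resolvent

open scoped Matrix.Norms.L2Operator
open scoped ComplexConjugate

variable {ι : Type*} [Fintype ι] [DecidableEq ι]

/-- The resolvent `(z - X)⁻¹`; a junk value when `z` is an eigenvalue of `X`. -/
def matrixResolvent (z : ℂ) (X : Matrix ι ι ℂ) : Matrix ι ι ℂ := (z • (1 : Matrix ι ι ℂ) - X)⁻¹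

theorem isUnit_smul_one_sub {X : Matrix ι ι ℂ} (hX : X.IsHermitian) {z : ℂ} (hz : z.im ≠ 0) :
    IsUnit (z • (1 : Matrix ι ι ℂ) - X) := by
  rw [Matrix.isUnit_iff_isUnit_det, isUnit_iff_ne_zero]
  have h1 : (z • (1 : Matrix ι ι ℂ) - X).det = X.charpoly.eval z := by
    rw [Matrix.eval_charpoly, Matrix.scalar_apply, Matrix.smul_one_eq_diagonal]
  rw [h1, hX.charpoly_eq, Polynomial.eval_prod, Finset.prod_ne_zero_iff]
  intro i _ h
  simp only [Polynomial.eval_sub, Polynomial.eval_X, Polynomial.eval_C, sub_eq_zero] at h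
  exact hz (by rw [h]; simp)

theorem matrixResolvent_eq_inverse (z : ℂ) (X : Matrix ι ι ℂ) :
    matrixResolvent z X = Ring.inverse (z • (1 : Matrix ι ι ℂ) - X) :=
  Matrix.nonsing_inv_eq_ringInverse _

theorem mul_matrixResolvent {X : Matrix ι ι ℂ} (hX : X.IsHermitian) {z : ℂ} (hz : z.im ≠ 0) :
    (z • (1 : Matrix ι ι ℂ) - X) * matrixResolvent z X = 1 :=
  Matrix.mul_nonsing_inv _ ((Matrix.isUnit_iff_isUnit_det _).1 (isUnit_smul_one_sub hX hz))

theorem matrixResolvent_mul {X : Matrix ι ι ℂ} (hX : X.IsHermitian) {z : ℂ} (hz : z.im ≠ 0) :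
    matrixResolvent z X * (z • (1 : Matrix ι ι ℂ) - X) = 1 :=
  Matrix.nonsing_inv_mul _ ((Matrix.isUnit_iff_isUnit_det _).1 (isUnit_smul_one_sub hX hz))

theorem smul_matrixResolvent {X : Matrix ι ι ℂ} (hX : X.IsHermitian) {z : ℂ} (hz : z.im ≠ 0) :
    z • matrixResolvent z X = 1 + X * matrixResolvent z X := by
  have h := mul_matrixResolvent hX hz
  rw [sub_mul, smul_mul_assoc, one_mul, sub_eq_iff_eq_add] at h
  exact h

theorem conjTranspose_matrixResolvent {X : Matrix ι ι ℂ} (hX : X.IsHermitian) (z : ℂ) :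
    (matrixResolvent z X).conjTranspose = matrixResolvent (conj z) X := by
  rw [matrixResolvent, matrixResolvent, Matrix.conjTranspose_nonsing_inv, Matrix.conjTranspose_sub,
    Matrix.conjTranspose_smul, Matrix.conjTranspose_one, hX.eq]
  rfl

theorem norm_matrixResolvent_le {X : Matrix ι ι ℂ} (hX : X.IsHermitian) {z : ℂ} (hz : z.im ≠ 0) :
    ‖matrixResolvent z X‖ ≤ |z.im|⁻¹ := by
  set R := matrixResolvent z X with hR
  have hz' : (conj z).im ≠ 0 := by simpa using hz
  set S := matrixResolvent (conj z) X with hS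
  have hRS : R.conjTranspose = S := conjTranspose_matrixResolvent hX z
  have key : (conj z - z) • (R * S) = R - S := by
    have e : (conj z - z) • (1 : Matrix ι ι ℂ)
        = (conj z • (1 : Matrix ι ι ℂ) - X) - (z • (1 : Matrix ι ι ℂ) - X) := by
      rw [sub_smul]; abel
    calc (conj z - z) • (R * S) = R * ((conj z - z) • (1 : Matrix ι ι ℂ)) * S := by
          simp
      _ = R - S := by
          rw [e, mul_sub, sub_mul, matrixResolvent_mul hX hz, mul_assoc,
            mul_matrixResolvent hX hz', mul_one, one_mul]
  have hnS : ‖S‖ = ‖R‖ := by rw [← hRS, Matrix.l2_opNorm_conjTranspose]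
  have hRR : ‖R * S‖ = ‖R‖ * ‖R‖ := by
    rw [← hRS]; exact CStarRing.norm_self_mul_star
  have hnz : ‖conj z - z‖ = 2 * |z.im| := by
    have : conj z - z = ((-2 * z.im : ℝ) : ℂ) * Complex.I := by
      apply Complex.ext <;> simp; ring
    rw [this, norm_mul, Complex.norm_I, mul_one, Complex.norm_real, Real.norm_eq_abs, abs_mul]
    norm_num
  have h1 : 2 * |z.im| * (‖R‖ * ‖R‖) ≤ 2 * ‖R‖ := by
    rw [← hnz, ← hRR, ← norm_smul, key, two_mul]
    exact (norm_sub_le _ _).trans_eq (by rw [hnS])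
  have hpos : 0 < |z.im| := abs_pos.2 hz
  rcases (norm_nonneg R).eq_or_lt with h0 | h0
  · rw [← h0]; positivity
  · rw [le_inv_comm₀ h0 hpos, inv_eq_one_div, le_div_iff₀ h0]
    nlinarith

theorem norm_entry_le {ι' : Type*} [Fintype ι'] [DecidableEq ι'] (M : Matrix ι' ι ℂ) (p : ι')
    (q : ι) : ‖M p q‖ ≤ ‖M‖ := by
  have h := Matrix.l2_opNorm_mulVec M (EuclideanSpace.single q (1 : ℂ))
  rw [PiLp.norm_single, norm_one, mul_one] at h
  refine le_trans ?_ h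
  refine le_trans (le_of_eq ?_) (PiLp.norm_apply_le _ p)
  simp

theorem norm_trace_le (M : Matrix ι ι ℂ) : ‖M.trace‖ ≤ Fintype.card ι * ‖M‖ := by
  rw [Matrix.trace]
  refine (norm_sum_le _ _).trans ((Finset.sum_le_sum fun i _ => norm_entry_le M i i).trans ?_)
  simp

theorem hasDerivAt_matrixResolvent_add_smul {X K : Matrix ι ι ℂ} (hX : X.IsHermitian) {z : ℂ}
    (hz : z.im ≠ 0) :
    HasDerivAt (fun t : ℝ => matrixResolvent z (X + t • K))
      (matrixResolvent z X * K * matrixResolvent z X) 0 := by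
  obtain ⟨u, hu⟩ := isUnit_smul_one_sub hX hz
  have hR : matrixResolvent z X = (↑u⁻¹ : Matrix ι ι ℂ) := by
    rw [matrixResolvent_eq_inverse, ← hu, Ring.inverse_unit]
  have h1 : HasFDerivAt Ring.inverse (-ContinuousLinearMap.mulLeftRight ℝ (Matrix ι ι ℂ)
      ↑u⁻¹ ↑u⁻¹) (u : Matrix ι ι ℂ) := hasFDerivAt_ringInverse (𝕜 := ℝ) u
  have h2 : HasDerivAt (fun t : ℝ => z • (1 : Matrix ι ι ℂ) - (X + t • K)) (-K) 0 := by
    have := (((hasDerivAt_id (0 : ℝ)).smul_const K).const_add X).const_sub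
      (z • (1 : Matrix ι ι ℂ))
    simpa using this
  have h3 : HasFDerivAt Ring.inverse (-ContinuousLinearMap.mulLeftRight ℝ (Matrix ι ι ℂ)
      ↑u⁻¹ ↑u⁻¹) ((fun t : ℝ => z • (1 : Matrix ι ι ℂ) - (X + t • K)) 0) := by
    simpa [← hu] using h1
  have h4 := h3.comp_hasDerivAt 0 h2
  simp only [matrixResolvent_eq_inverse] at hR ⊢
  refine h4.congr_deriv ?_
  rw [hR]
  simp

theorem hasDerivAt_matrixResolvent {X : Matrix ι ι ℂ} (hX : X.IsHermitian) {z : ℂ}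
    (hz : z.im ≠ 0) :
    HasDerivAt (fun w => matrixResolvent w X) (-(matrixResolvent z X * matrixResolvent z X)) z := by
  obtain ⟨u, hu⟩ := isUnit_smul_one_sub hX hz
  have hR : matrixResolvent z X = (↑u⁻¹ : Matrix ι ι ℂ) := by
    rw [matrixResolvent_eq_inverse, ← hu, Ring.inverse_unit]
  have h1 : HasFDerivAt Ring.inverse (-ContinuousLinearMap.mulLeftRight ℂ (Matrix ι ι ℂ)
      ↑u⁻¹ ↑u⁻¹) (u : Matrix ι ι ℂ) := hasFDerivAt_ringInverse (𝕜 := ℂ) u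
  have h2 : HasDerivAt (fun w : ℂ => w • (1 : Matrix ι ι ℂ) - X) 1 z := by
    have := ((hasDerivAt_id z).smul_const (1 : Matrix ι ι ℂ)).sub_const X
    simpa using this
  rw [hu] at h1
  have h4 := h1.comp_hasDerivAt z h2
  simp only [matrixResolvent_eq_inverse] at hR ⊢
  refine h4.congr_deriv ?_
  rw [hR]
  simp

theorem continuousOn_matrixResolvent {z : ℂ} (hz : z.im ≠ 0) :
    ContinuousOn (fun X : Matrix ι ι ℂ => matrixResolvent z X) {X | X.IsHermitian} := by
  intro X hX
  obtain ⟨u, hu⟩ := isUnit_smul_one_sub hX hz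
  have h1 := NormedRing.inverse_continuousAt u
  rw [hu] at h1
  have h2 : ContinuousAt (fun X : Matrix ι ι ℂ => z • (1 : Matrix ι ι ℂ) - X) X := by fun_prop
  have h3 := ContinuousAt.comp (f := fun X : Matrix ι ι ℂ => z • (1 : Matrix ι ι ℂ) - X) h1 h2
  simp only [matrixResolvent_eq_inverse]
  exact h3.continuousWithinAt

end Resolvent

/-! ### Integration by parts for Gaussian Hermitian matrices -/

section HermitianStein

open scoped Matrix.Norms.L2Operator
open scoped ComplexConjugate

variable {ι : Type*} [Fintype ι] [DecidableEq ι]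

/-- `Φ` is a bounded continuous function on Hermitian matrices whose directional derivatives along
Hermitian matrices are given by `Φ'`, and are bounded and continuous in the base point. The
derivative is packaged as a `ℂ`-linear map, which makes sense of it in the complex directions
`E[X_{pq} X]` that occur in the integration by parts formula. -/
structure HasBoundedDeriv (Φ : Matrix ι ι ℂ → ℂ) (Φ' : Matrix ι ι ℂ → Matrix ι ι ℂ →ₗ[ℂ] ℂ) :
    Prop where
  continuousOn : ContinuousOn Φ {X | X.IsHermitian}
  continuousOn_deriv : ∀ K, ContinuousOn (fun X => Φ' X K) {X | X.IsHermitian}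
  bounded : ∃ C, ∀ X, X.IsHermitian → ‖Φ X‖ ≤ C
  bounded_deriv : ∀ K, ∃ C, ∀ X, X.IsHermitian → ‖Φ' X K‖ ≤ C
  hasDerivAt : ∀ X K, X.IsHermitian → K.IsHermitian →
    HasDerivAt (fun t : ℝ => Φ (X + t • K)) (Φ' X K) 0

omit [Fintype ι] [DecidableEq ι] in
theorem hasBoundedDeriv_const (c : ℂ) :
    HasBoundedDeriv (fun _ : Matrix ι ι ℂ => c) (fun _ => 0) where
  continuousOn := continuousOn_const
  continuousOn_deriv _ := continuousOn_const
  bounded := ⟨‖c‖, fun _ _ => le_rfl⟩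
  bounded_deriv _ := ⟨0, fun _ _ => by simp⟩
  hasDerivAt _ _ _ _ := hasDerivAt_const _ _

omit [Fintype ι] [DecidableEq ι] in
theorem HasBoundedDeriv.mul {Φ Ψ : Matrix ι ι ℂ → ℂ} {Φ' Ψ' : Matrix ι ι ℂ → Matrix ι ι ℂ →ₗ[ℂ] ℂ}
    (hΦ : HasBoundedDeriv Φ Φ') (hΨ : HasBoundedDeriv Ψ Ψ') :
    HasBoundedDeriv (fun X => Φ X * Ψ X) (fun X => Ψ X • Φ' X + Φ X • Ψ' X) where
  continuousOn := hΦ.continuousOn.mul hΨ.continuousOn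
  continuousOn_deriv K := (hΨ.continuousOn.mul (hΦ.continuousOn_deriv K)).add
    (hΦ.continuousOn.mul (hΨ.continuousOn_deriv K))
  bounded := by
    obtain ⟨C, hC⟩ := hΦ.bounded
    obtain ⟨D, hD⟩ := hΨ.bounded
    refine ⟨C * D, fun X hX => ?_⟩
    rw [norm_mul]
    exact mul_le_mul (hC X hX) (hD X hX) (norm_nonneg _) ((norm_nonneg _).trans (hC X hX))
  bounded_deriv K := by
    obtain ⟨C, hC⟩ := hΦ.bounded
    obtain ⟨D, hD⟩ := hΨ.bounded
    obtain ⟨C', hC'⟩ := hΦ.bounded_deriv K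
    obtain ⟨D', hD'⟩ := hΨ.bounded_deriv K
    refine ⟨D * C' + C * D', fun X hX => ?_⟩
    simp only [LinearMap.add_apply, LinearMap.smul_apply, smul_eq_mul]
    refine (norm_add_le _ _).trans (add_le_add ?_ ?_) <;> rw [norm_mul]
    · exact mul_le_mul (hD X hX) (hC' X hX) (norm_nonneg _) ((norm_nonneg _).trans (hD X hX))
    · exact mul_le_mul (hC X hX) (hD' X hX) (norm_nonneg _) ((norm_nonneg _).trans (hC X hX))
  hasDerivAt X K hX hK := by
    refine ((hΦ.hasDerivAt X K hX hK).mul (hΨ.hasDerivAt X K hX hK)).congr_deriv ?_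
    simp only [zero_smul, add_zero, LinearMap.add_apply, LinearMap.smul_apply, smul_eq_mul]
    ring

theorem hasBoundedDeriv_resolvent {z : ℂ} (hz : z.im ≠ 0) (ℓ : Matrix ι ι ℂ →ₗ[ℂ] ℂ) :
    HasBoundedDeriv (fun X => ℓ (matrixResolvent z X))
      (fun X => ℓ ∘ₗ LinearMap.mulLeftRight ℂ (matrixResolvent z X, matrixResolvent z X)) := by
  set ℓ' : Matrix ι ι ℂ →L[ℂ] ℂ := LinearMap.toContinuousLinearMap ℓ with hℓ'
  have hℓ : ∀ M, ℓ M = ℓ' M := fun M => rfl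
  refine ⟨?_, fun K => ?_, ⟨‖ℓ'‖ * |z.im|⁻¹, fun X hX => ?_⟩,
    fun K => ⟨‖ℓ'‖ * (|z.im|⁻¹ * ‖K‖ * |z.im|⁻¹),
    fun X hX => ?_⟩, fun X K hX hK => ?_⟩
  · simp only [hℓ]
    exact ℓ'.continuous.comp_continuousOn (continuousOn_matrixResolvent hz)
  · simp only [LinearMap.comp_apply, LinearMap.mulLeftRight_apply, hℓ]
    have h := continuousOn_matrixResolvent (ι := ι) hz
    exact ℓ'.continuous.comp_continuousOn ((h.mul continuousOn_const).mul h)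
  · simp only [hℓ]
    exact (ℓ'.le_opNorm _).trans
      (mul_le_mul_of_nonneg_left (norm_matrixResolvent_le hX hz) (norm_nonneg _))
  · simp only [LinearMap.comp_apply, LinearMap.mulLeftRight_apply, hℓ]
    refine (ℓ'.le_opNorm _).trans (mul_le_mul_of_nonneg_left ?_ (norm_nonneg _))
    have h := norm_matrixResolvent_le hX hz
    refine (norm_mul_le _ _).trans (mul_le_mul ((norm_mul_le _ _).trans ?_) h (norm_nonneg _)
      (by positivity))
    exact mul_le_mul_of_nonneg_right h (norm_nonneg _)
  · simp only [LinearMap.comp_apply, LinearMap.mulLeftRight_apply, hℓ]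
    have h := hasDerivAt_matrixResolvent_add_smul (K := K) hX hz
    exact (ℓ'.restrictScalars ℝ).hasFDerivAt.comp_hasDerivAt (0 : ℝ) h

variable {Ω : Type*} [MeasurableSpace Ω] {P : Measure Ω}

/-- The Hermitian part `(Y + Yᴴ) / 2` of the matrix with entries `y`. -/
def hermitianPart (y : ι × ι → ℂ) : Matrix ι ι ℂ :=
  Matrix.of fun p q => (y (p, q) + conj (y (q, p))) / 2

omit [Fintype ι] [DecidableEq ι] in
theorem isHermitian_hermitianPart (y : ι × ι → ℂ) : (hermitianPart y).IsHermitian := by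
  ext p q
  simp [hermitianPart, add_comm]

omit [Fintype ι] [DecidableEq ι] in
theorem hermitianPart_eq {X : Matrix ι ι ℂ} (hX : X.IsHermitian) :
    hermitianPart (fun e => X e.1 e.2) = X := by
  ext p q
  have h : conj (X q p) = X p q := hX.apply p q
  simp [hermitianPart, h]

omit [DecidableEq ι] [Fintype ι] in
theorem hermitianPart_add_smul (y k : ι × ι → ℂ) (t : ℝ) :
    hermitianPart (y + t • k) = hermitianPart y + t • hermitianPart k := by
  ext p q
  simp [hermitianPart]
  ring

omit [DecidableEq ι] [Fintype ι] in
theorem continuous_hermitianPart : Continuous (hermitianPart : (ι × ι → ℂ) → Matrix ι ι ℂ) := by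
  refine continuous_matrix fun p q => ?_
  simp only [hermitianPart, Matrix.of_apply]
  fun_prop

omit [DecidableEq ι] in
theorem aestronglyMeasurable_comp_of_continuousOn {F : Type*} [TopologicalSpace F]
    [TopologicalSpace.PseudoMetrizableSpace F] [SecondCountableTopology F]
    {X : Ω → Matrix ι ι ℂ} (hX : ∀ ω, (X ω).IsHermitian)
    (hG : AEMeasurable (fun ω (e : ι × ι) => X ω e.1 e.2) P) {Φ : Matrix ι ι ℂ → F}
    (hΦ : ContinuousOn Φ {X | X.IsHermitian}) : AEStronglyMeasurable (fun ω => Φ (X ω)) P := by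
  have h1 : Continuous fun y : ι × ι → ℂ => Φ (hermitianPart y) :=
    hΦ.comp_continuous continuous_hermitianPart isHermitian_hermitianPart
  have h2 := h1.stronglyMeasurable.aestronglyMeasurable.comp_aemeasurable
    (f := fun ω (e : ι × ι) => X ω e.1 e.2) hG
  refine h2.congr (ae_of_all _ fun ω => ?_)
  simp [hermitianPart_eq (hX ω)]

omit [DecidableEq ι] in
/-- Integration by parts for a centred Gaussian Hermitian matrix: `E[X_{pu} Φ(X)]` is the
expectation of the derivative of `Φ` at `X` in the direction of the matrix `E[X_{pu} X]`. -/
theorem integral_entry_mul {X : Ω → Matrix ι ι ℂ} (hX : ∀ ω, (X ω).IsHermitian)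
    (hG : HasGaussianLaw (fun ω (e : ι × ι) => X ω e.1 e.2) P)
    (h0 : ∀ p q, ∫ ω, X ω p q ∂P = 0) {Φ : Matrix ι ι ℂ → ℂ}
    {Φ' : Matrix ι ι ℂ → Matrix ι ι ℂ →ₗ[ℂ] ℂ} (hΦ : HasBoundedDeriv Φ Φ') (p u : ι) :
    ∫ ω, X ω p u * Φ (X ω) ∂P
      = ∫ ω, Φ' (X ω) (Matrix.of fun v w => ∫ ω', X ω' p u * X ω' v w ∂P) ∂P := by
  have := hG.isProbabilityMeasure
  set Y : Ω → ι × ι → ℂ := fun ω e => X ω e.1 e.2 with hY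
  have hYX : ∀ ω, hermitianPart (Y ω) = X ω := fun ω => hermitianPart_eq (hX ω)
  have hYi : ∀ e, Integrable (fun ω => Y ω e) P := fun e => hG.integrable.eval e
  have hY0 : ∫ ω, Y ω ∂P = 0 := by
    ext e
    rw [eval_integral hYi]
    exact h0 _ _
  have hmem : ∀ e, MemLp (fun ω => Y ω e) 2 P := fun e => (hG.eval e).memLp_two
  -- The formula for a real-linear functional of the entry `X_{pu}`.
  have real_case : ∀ ℓ : ℂ →L[ℝ] ℝ, ∃ K : Matrix ι ι ℂ,
      (∀ v w, K v w = ∫ ω, (ℓ (X ω p u) : ℂ) * X ω v w ∂P) ∧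
      ∫ ω, (ℓ (X ω p u) : ℂ) * Φ (X ω) ∂P = ∫ ω, Φ' (X ω) K ∂P := by
    intro ℓ
    set L : (ι × ι → ℂ) →L[ℝ] ℝ := ℓ.comp (ContinuousLinearMap.proj (p, u)) with hL
    have hLm : MemLp (fun ω => L (Y ω)) 2 P := (hG.map_fun L).memLp_two
    set κ : ι × ι → ℂ := ∫ ω, L (Y ω) • Y ω ∂P with hκ
    have hκe : ∀ e, κ e = ∫ ω, (ℓ (X ω p u) : ℂ) * Y ω e ∂P := by
      intro e
      rw [hκ, eval_integral]
      · refine integral_congr_ae (ae_of_all _ fun ω => ?_)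
        simp [hL, hY]
      · intro e
        exact memLp_one_iff_integrable.1 ((hmem e).smul (r := 1) hLm)
    have hKh : (Matrix.of fun v w => κ (v, w)).IsHermitian := by
      ext v w
      simp only [Matrix.conjTranspose_apply, Matrix.of_apply, hκe]
      rw [RCLike.star_def, ← integral_conj]
      refine integral_congr_ae (ae_of_all _ fun ω => ?_)
      have : conj (X ω w v) = X ω v w := (hX ω).apply v w
      simp [hY, this]
    have hKh' : hermitianPart κ = Matrix.of fun v w => κ (v, w) :=
      hermitianPart_eq (X := Matrix.of fun v w => κ (v, w)) hKh
    refine ⟨Matrix.of fun v w => κ (v, w), fun v w => hκe _, ?_⟩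
    obtain ⟨C, hC⟩ := hΦ.bounded
    obtain ⟨C', hC'⟩ := hΦ.bounded_deriv (Matrix.of fun v w => κ (v, w))
    have key := integral_mul_of_hasGaussianLaw hG hY0 L hκ.symm
      (F := fun y => Φ (hermitianPart y))
      (F' := fun y => Φ' (hermitianPart y) (Matrix.of fun v w => κ (v, w)))
      (hΦ.continuousOn.comp_continuous continuous_hermitianPart isHermitian_hermitianPart)
      ((hΦ.continuousOn_deriv _).comp_continuous continuous_hermitianPart
        isHermitian_hermitianPart)
      (fun y => hC _ (isHermitian_hermitianPart y)) (fun y => hC' _ (isHermitian_hermitianPart y))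
      (fun y => by
        simp only [hermitianPart_add_smul, hKh']
        exact hΦ.hasDerivAt _ _ (isHermitian_hermitianPart y) hKh)
    simp only [hYX] at key
    exact key
  obtain ⟨K₁, hK₁, h₁⟩ := real_case Complex.reCLM
  obtain ⟨K₂, hK₂, h₂⟩ := real_case Complex.imCLM
  obtain ⟨C, hC⟩ := hΦ.bounded
  have hΦm : AEStronglyMeasurable (fun ω => Φ (X ω)) P :=
    aestronglyMeasurable_comp_of_continuousOn hX hG.aemeasurable hΦ.continuousOn
  have hre : Integrable (fun ω => ((X ω p u).re : ℂ)) P := (hYi (p, u)).re.ofReal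
  have him : Integrable (fun ω => ((X ω p u).im : ℂ)) P := (hYi (p, u)).im.ofReal
  have hK : (Matrix.of fun v w => ∫ ω', X ω' p u * X ω' v w ∂P) = K₁ + Complex.I • K₂ := by
    ext v w
    have hre2 : MemLp (fun ω => ((X ω p u).re : ℂ)) 2 P := (hmem (p, u)).re.ofReal
    have him2 : MemLp (fun ω => ((X ω p u).im : ℂ)) 2 P := (hmem (p, u)).im.ofReal
    simp only [Matrix.of_apply, Matrix.add_apply, Matrix.smul_apply, hK₁, hK₂, smul_eq_mul]
    rw [← integral_const_mul, ← integral_add]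
    · refine integral_congr_ae (ae_of_all _ fun ω => ?_)
      beta_reduce
      conv_lhs => rw [← Complex.re_add_im (X ω p u)]
      simp only [Complex.reCLM_apply, Complex.imCLM_apply]
      ring
    · exact MemLp.integrable_mul hre2 (hmem (v, w))
    · exact (MemLp.integrable_mul him2 (hmem (v, w))).const_mul _
  have hI : ∀ K, Integrable (fun ω => Φ' (X ω) K) P := fun K => by
    obtain ⟨C', hC'⟩ := hΦ.bounded_deriv K
    exact Integrable.of_bound (aestronglyMeasurable_comp_of_continuousOn hX hG.aemeasurable
      (hΦ.continuousOn_deriv K)) C' (ae_of_all _ fun ω => hC' _ (hX ω))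
  rw [hK]
  simp only [map_add, map_smul, smul_eq_mul]
  rw [integral_add (hI _) ((hI _).const_mul _), integral_const_mul, ← h₁, ← h₂,
    ← integral_const_mul, ← integral_add]
  · refine integral_congr_ae (ae_of_all _ fun ω => ?_)
    beta_reduce
    conv_lhs => rw [← Complex.re_add_im (X ω p u)]
    simp only [Complex.reCLM_apply, Complex.imCLM_apply]
    ring
  · exact hre.mul_bdd hΦm (ae_of_all _ fun ω => hC _ (hX ω))
  · exact (him.mul_bdd hΦm (ae_of_all _ fun ω => hC _ (hX ω))).const_mul _

end HermitianStein

/-! ### The Schwinger–Dyson equation of the block model -/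

section SchwingerDyson

open scoped Matrix.Norms.L2Operator
open scoped ComplexConjugate

variable {d : ℕ} {N : Fin d → ℕ}

/-- The partial isometry `E_{ij} ⊗ I`, where `I` is the rectangular `N_i × N_j` identity matrix. -/
def blockUnit (N : Fin d → ℕ) (i j : Fin d) : Matrix (BlockIndex N) (BlockIndex N) ℂ :=
  Matrix.of fun p q => if p.1 = i ∧ q.1 = j ∧ (p.2 : ℕ) = (q.2 : ℕ) then 1 else 0

theorem conjTranspose_blockUnit (i j : Fin d) :
    (blockUnit N i j).conjTranspose = blockUnit N j i := by
  ext p q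
  simp only [blockUnit, Matrix.conjTranspose_apply, Matrix.of_apply]
  have : (q.1 = i ∧ p.1 = j ∧ (q.2 : ℕ) = (p.2 : ℕ)) ↔
    (p.1 = j ∧ q.1 = i ∧ (p.2 : ℕ) = (q.2 : ℕ)) := by tauto
  simp only [this]
  split_ifs <;> simp

theorem blockUnit_mul_blockUnit_of_ne {b b' : Fin d} (h : b ≠ b') (a c : Fin d) :
    blockUnit N a b * blockUnit N b' c = 0 := by
  ext p q
  rw [Matrix.mul_apply]
  refine Finset.sum_eq_zero fun u _ => ?_
  simp only [blockUnit, Matrix.of_apply]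
  split_ifs with h1 h2 <;> simp
  exact absurd (h1.2.1.symm.trans h2.1) h

theorem blockUnit_mul_blockUnit (a b c : Fin d) :
    blockUnit N a b * blockUnit N b c =
      Matrix.diagonal (fun p : BlockIndex N => if (p.2 : ℕ) < N b then (1 : ℂ) else 0) *
        blockUnit N a c := by
  ext p q
  rw [Matrix.mul_apply, Matrix.diagonal_mul]
  simp only [blockUnit, Matrix.of_apply]
  by_cases hp : (p.2 : ℕ) < N b
  · rw [Finset.sum_eq_single (⟨b, ⟨p.2, hp⟩⟩ : BlockIndex N)]
    · simp only [hp, if_true, one_mul, true_and]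
      by_cases h1 : p.1 = a <;> by_cases h2 : q.1 = c <;> by_cases h3 : (p.2 : ℕ) = q.2 <;>
        simp [h1, h2, h3]
    · rintro ⟨u1, u2⟩ - hne
      by_cases hu : u1 = b
      · subst hu
        have : (p.2 : ℕ) ≠ u2 := fun h => hne (by congr 1; ext; exact h.symm)
        simp [this]
      · simp [hu]
    · simp
  · simp only [hp, if_false, zero_mul]
    refine Finset.sum_eq_zero ?_
    rintro ⟨u1, u2⟩ -
    by_cases hu : u1 = b
    · subst hu
      have : (p.2 : ℕ) ≠ u2 := fun h => hp (h ▸ u2.2)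
      simp [this]
    · simp [hu]

theorem norm_diagonal_ite_le (s : BlockIndex N → Prop) [DecidablePred s] :
    ‖Matrix.diagonal (fun p : BlockIndex N => if s p then (1 : ℂ) else 0)‖ ≤ 1 := by
  rw [Matrix.l2_opNorm_diagonal, pi_norm_le_iff_of_nonneg zero_le_one]
  intro p
  split_ifs <;> simp

theorem norm_blockUnit_le (i j : Fin d) : ‖blockUnit N i j‖ ≤ 1 := by
  have hdiag : blockUnit N i i =
      Matrix.diagonal (fun p : BlockIndex N => if p.1 = i then (1 : ℂ) else 0) := by
    ext ⟨p1, p2⟩ ⟨q1, q2⟩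
    simp only [blockUnit, Matrix.of_apply, Matrix.diagonal_apply]
    by_cases h1 : p1 = q1
    · subst h1
      by_cases h2 : p2 = q2
      · subst h2; simp
      · have : (p2 : ℕ) ≠ q2 := fun h => h2 (Fin.ext h)
        simp [h2, this]
    · have h2 : ¬ (p1 = i ∧ q1 = i ∧ (p2 : ℕ) = q2) := fun h => h1 (h.1.trans h.2.1.symm)
      have h3 : (⟨p1, p2⟩ : BlockIndex N) ≠ ⟨q1, q2⟩ := fun h => h1 (congrArg Sigma.fst h)
      rw [if_neg h2, if_neg h3]
  have h : ‖blockUnit N i j‖ * ‖blockUnit N i j‖ ≤ 1 := by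
    have h1 : ‖blockUnit N i j * (blockUnit N i j).conjTranspose‖
        = ‖blockUnit N i j‖ * ‖blockUnit N i j‖ := CStarRing.norm_self_mul_star
    rw [← h1, conjTranspose_blockUnit, blockUnit_mul_blockUnit, hdiag]
    refine (norm_mul_le _ _).trans ?_
    exact mul_le_one₀ (norm_diagonal_ite_le _) (norm_nonneg _) (norm_diagonal_ite_le _)
  nlinarith [norm_nonneg (blockUnit N i j)]

theorem card_blockIndex : Fintype.card (BlockIndex N) = ∑ i, N i := by simp

theorem trace_blockUnit (i j : Fin d) :
    (blockUnit N i j).trace = if i = j then (N i : ℂ) else 0 := by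
  rw [Matrix.trace, Fintype.sum_sigma]
  simp only [Matrix.diag_apply, blockUnit, Matrix.of_apply, and_true]
  split_ifs with h
  · subst h
    rw [Finset.sum_eq_single i]
    · simp
    · intro b _ hb
      simp [hb]
    · simp
  · refine Finset.sum_eq_zero fun k _ => Finset.sum_eq_zero fun x _ => if_neg fun hk => h ?_
    exact hk.1.symm.trans hk.2

/-- The products `E_{ji} E_{ij'} ⊗ I` and `E_{jj'} ⊗ I` only differ in `N_j - N_i` rows. -/
theorem norm_trace_blockUnit_mul_sub_le (i j j' : Fin d)
    (M : Matrix (BlockIndex N) (BlockIndex N) ℂ) :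
    ‖(blockUnit N j i * blockUnit N i j' * M).trace - (blockUnit N j j' * M).trace‖
      ≤ ((N j - N i : ℕ) : ℝ) * ‖M‖ := by
  rw [blockUnit_mul_blockUnit, Matrix.trace, Matrix.trace, ← Finset.sum_sub_distrib]
  have hterm : ∀ p : BlockIndex N,
      ‖(Matrix.diagonal (fun p : BlockIndex N => if (p.2 : ℕ) < N i then (1 : ℂ) else 0) *
        blockUnit N j j' * M).diag p - (blockUnit N j j' * M).diag p‖
      ≤ if p.1 = j ∧ N i ≤ (p.2 : ℕ) then ‖M‖ else 0 := by
    intro p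
    rw [Matrix.mul_assoc, Matrix.diag_apply, Matrix.diag_apply, Matrix.diagonal_mul]
    by_cases h : (p.2 : ℕ) < N i
    · have : ¬ (p.1 = j ∧ N i ≤ (p.2 : ℕ)) := fun h' => absurd h'.2 (not_le.2 h)
      simp [h, this]
    · by_cases hj : p.1 = j
      · rw [if_neg h, if_pos ⟨hj, not_lt.1 h⟩, zero_mul, zero_sub, norm_neg]
        refine (norm_entry_le _ p p).trans ((norm_mul_le _ _).trans ?_)
        exact mul_le_of_le_one_left (norm_nonneg _) (norm_blockUnit_le _ _)
      · have h0 : (blockUnit N j j' * M) p p = 0 := by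
          rw [Matrix.mul_apply]
          refine Finset.sum_eq_zero fun u _ => ?_
          simp [blockUnit, hj]
        simp [h0, hj]
  refine (norm_sum_le _ _).trans ((Finset.sum_le_sum fun p _ => hterm p).trans ?_)
  rw [Fintype.sum_sigma, Finset.sum_eq_single j]
  · simp only [true_and]
    rw [← Finset.sum_filter, Finset.sum_const, nsmul_eq_mul]
    refine mul_le_mul_of_nonneg_right ?_ (norm_nonneg _)
    have : (Finset.univ.filter fun x : Fin (N j) => N i ≤ (x : ℕ)).card ≤ N j - N i := by
      rw [← Finset.card_map Fin.valEmbedding]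
      refine (Finset.card_le_card (t := Finset.Ico (N i) (N j)) ?_).trans (by simp)
      intro x hx
      simp only [Finset.mem_map, Finset.mem_filter, Finset.mem_univ, true_and,
        Fin.valEmbedding_apply] at hx
      obtain ⟨y, hy, rfl⟩ := hx
      exact Finset.mem_Ico.2 ⟨hy, y.2⟩
    exact_mod_cast this
  · intro b _ hb
    simp [hb]
  · simp

variable {Ω : Type*} [MeasurableSpace Ω] {P : Measure Ω}
  {σ : Fin d → Fin d → Fin d → Fin d → ℂ}
  {A : (i j : Fin d) → Ω → Matrix (Fin (N i)) (Fin (N j)) ℂ}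

/-- The number `n = N_1 + ⋯ + N_d` as a complex number. -/
def totalSize (N : Fin d → ℕ) : ℂ := ((∑ i, N i : ℕ) : ℂ)

/-- The covariance matrix `E[X_{pu} X]` of the block model. -/
def covMatrix (σ : Fin d → Fin d → Fin d → Fin d → ℂ) (p u : BlockIndex N) :
    Matrix (BlockIndex N) (BlockIndex N) ℂ :=
  (totalSize N)⁻¹ • ∑ i, ∑ k, ∑ l, ∑ j, σ i k l j •
    Matrix.vecMulVec (fun v => blockUnit N l k v u) (fun w => blockUnit N i j p w)

theorem IsGaussianBlockModel.covariance_eq (hA : IsGaussianBlockModel σ P A)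
    (p u : BlockIndex N) :
    (Matrix.of fun v w => ∫ ω, blockMatrix (fun i j => A i j ω) p u *
      blockMatrix (fun i j => A i j ω) v w ∂P) = covMatrix σ p u := by
  ext v w
  simp only [Matrix.of_apply, blockMatrix, covMatrix, Matrix.smul_apply, Matrix.sum_apply,
    Matrix.vecMulVec_apply, smul_eq_mul, totalSize]
  rw [hA.covariance, one_div]
  congr 1
  rw [Finset.sum_eq_single p.1, Finset.sum_eq_single u.1, Finset.sum_eq_single v.1,
    Finset.sum_eq_single w.1]
  · by_cases h1 : (p.2 : ℕ) = w.2 <;> by_cases h2 : (u.2 : ℕ) = v.2 <;>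
      simp [blockUnit, h1, h2, eq_comm]
  · intro b _ hb; simp [blockUnit, hb.symm]
  · simp
  · intro b _ hb
    refine Finset.sum_eq_zero fun _ _ => ?_
    simp [blockUnit, hb.symm]
  · simp
  · intro b _ hb
    refine Finset.sum_eq_zero fun _ _ => Finset.sum_eq_zero fun _ _ => ?_
    simp [blockUnit, hb.symm]
  · simp
  · intro b _ hb
    refine Finset.sum_eq_zero fun _ _ => Finset.sum_eq_zero fun _ _ =>
      Finset.sum_eq_zero fun _ _ => ?_
    simp [blockUnit, hb.symm]
  · simp

end SchwingerDyson

section SchwingerDyson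

open scoped Matrix.Norms.L2Operator
open scoped ComplexConjugate

variable {d : ℕ} {N : Fin d → ℕ}

theorem mul_covMatrix_mul_apply (σ : Fin d → Fin d → Fin d → Fin d → ℂ)
    (L R : Matrix (BlockIndex N) (BlockIndex N) ℂ) (p u x y : BlockIndex N) :
    (L * covMatrix σ p u * R) x y = (totalSize N)⁻¹ * ∑ i, ∑ k, ∑ l, ∑ j, σ i k l j *
      ((L * blockUnit N l k) x u * (blockUnit N i j * R) p y) := by
  simp only [covMatrix, Matrix.mul_smul, Matrix.smul_mul, Matrix.mul_sum, Matrix.sum_mul,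
    Matrix.smul_apply, Matrix.sum_apply, smul_eq_mul, Matrix.mul_vecMulVec, Matrix.vecMulVec_mul,
    Matrix.vecMulVec_apply]
  rfl

theorem sum_mul_mul_covMatrix_mul (σ : Fin d → Fin d → Fin d → Fin d → ℂ)
    (B R : Matrix (BlockIndex N) (BlockIndex N) ℂ) :
    ∑ q, ∑ p, ∑ u, B q p * (R * covMatrix σ p u * R) u q =
      (totalSize N)⁻¹ * ∑ i, ∑ k, ∑ l, ∑ j, σ i k l j *
        ((blockUnit N l k * R).trace * (B * blockUnit N i j * R).trace) := by
  have e1 : ∀ i j, (B * blockUnit N i j * R).trace =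
      ∑ q, ∑ p, B q p * (blockUnit N i j * R) p q := by
    intro i j
    rw [Matrix.mul_assoc, Matrix.trace]
    simp only [Matrix.diag_apply, Matrix.mul_apply (M := B)]
  have e2 : ∀ l k, (blockUnit N l k * R).trace = ∑ u, (R * blockUnit N l k) u u := by
    intro l k
    rw [Matrix.trace_mul_comm]; rfl
  simp only [mul_covMatrix_mul_apply, e1, e2]
  simp only [Finset.mul_sum, Finset.sum_mul]
  have comm4 : ∀ (f : Fin d → Fin d → Fin d → Fin d → BlockIndex N → ℂ),
      ∑ x, ∑ i, ∑ k, ∑ l, ∑ j, f i k l j x = ∑ i, ∑ k, ∑ l, ∑ j, ∑ x, f i k l j x := by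
    intro f
    rw [Finset.sum_comm]; refine Finset.sum_congr rfl fun i _ => ?_
    rw [Finset.sum_comm]; refine Finset.sum_congr rfl fun k _ => ?_
    rw [Finset.sum_comm]; refine Finset.sum_congr rfl fun l _ => ?_
    rw [Finset.sum_comm]
  simp only [comm4]
  refine Finset.sum_congr rfl fun i _ => Finset.sum_congr rfl fun k _ =>
    Finset.sum_congr rfl fun l _ => Finset.sum_congr rfl fun j _ =>
    Finset.sum_congr rfl fun q _ => Finset.sum_congr rfl fun p _ =>
    Finset.sum_congr rfl fun u _ => ?_
  ring

theorem sum_mul_mul_trace_covMatrix (σ : Fin d → Fin d → Fin d → Fin d → ℂ)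
    (B R C L : Matrix (BlockIndex N) (BlockIndex N) ℂ) :
    ∑ q, ∑ p, ∑ u, B q p * (R u q * (C * (L * covMatrix σ p u * L)).trace) =
      (totalSize N)⁻¹ * ∑ i, ∑ k, ∑ l, ∑ j, σ i k l j *
        (B * (blockUnit N i j * (L * C * L) * blockUnit N l k) * R).trace := by
  have e0 : ∀ p u, (C * (L * covMatrix σ p u * L)).trace =
      (totalSize N)⁻¹ * ∑ i, ∑ k, ∑ l, ∑ j, σ i k l j *
        (blockUnit N i j * (L * C * L) * blockUnit N l k) p u := by
    intro p u
    rw [Matrix.trace]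
    simp only [Matrix.diag_apply]
    have : C * (L * covMatrix σ p u * L) = (C * L) * covMatrix σ p u * L := by
      simp only [Matrix.mul_assoc]
    simp only [this, mul_covMatrix_mul_apply]
    rw [← Finset.mul_sum]
    congr 1
    rw [Finset.sum_comm]; refine Finset.sum_congr rfl fun i _ => ?_
    rw [Finset.sum_comm]; refine Finset.sum_congr rfl fun k _ => ?_
    rw [Finset.sum_comm]; refine Finset.sum_congr rfl fun l _ => ?_
    rw [Finset.sum_comm]; refine Finset.sum_congr rfl fun j _ => ?_
    rw [← Finset.mul_sum]
    congr 1
    have : blockUnit N i j * (L * C * L) * blockUnit N l k =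
        (blockUnit N i j * L) * (C * L * blockUnit N l k) := by
      simp only [Matrix.mul_assoc]
    rw [this, Matrix.mul_apply]
    exact Finset.sum_congr rfl fun x _ => mul_comm _ _
  have e1 : ∀ M : Matrix (BlockIndex N) (BlockIndex N) ℂ,
      (B * M * R).trace = ∑ q, ∑ p, ∑ u, B q p * (R u q * M p u) := by
    intro M
    rw [Matrix.mul_assoc, Matrix.trace]
    simp only [Matrix.diag_apply, Matrix.mul_apply, Finset.mul_sum]
    refine Finset.sum_congr rfl fun q _ => Finset.sum_congr rfl fun p _ =>
      Finset.sum_congr rfl fun u _ => ?_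
    ring
  simp only [e0, e1]
  simp only [Finset.mul_sum]
  have comm4 : ∀ (f : Fin d → Fin d → Fin d → Fin d → BlockIndex N → ℂ),
      ∑ x, ∑ i, ∑ k, ∑ l, ∑ j, f i k l j x = ∑ i, ∑ k, ∑ l, ∑ j, ∑ x, f i k l j x := by
    intro f
    rw [Finset.sum_comm]; refine Finset.sum_congr rfl fun i _ => ?_
    rw [Finset.sum_comm]; refine Finset.sum_congr rfl fun k _ => ?_
    rw [Finset.sum_comm]; refine Finset.sum_congr rfl fun l _ => ?_
    rw [Finset.sum_comm]
  simp only [comm4]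
  refine Finset.sum_congr rfl fun i _ => Finset.sum_congr rfl fun k _ =>
    Finset.sum_congr rfl fun l _ => Finset.sum_congr rfl fun j _ =>
    Finset.sum_congr rfl fun q _ => Finset.sum_congr rfl fun p _ =>
    Finset.sum_congr rfl fun u _ => ?_
  ring

variable {Ω : Type*} [MeasurableSpace Ω] {P : Measure Ω}
  {σ : Fin d → Fin d → Fin d → Fin d → ℂ}
  {A : (i j : Fin d) → Ω → Matrix (Fin (N i)) (Fin (N j)) ℂ}

theorem integrable_comp_of_continuousOn {ι : Type*} [Fintype ι] [DecidableEq ι]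
    {X : Ω → Matrix ι ι ℂ} (hX : ∀ ω, (X ω).IsHermitian)
    (hG : HasGaussianLaw (fun ω (e : ι × ι) => X ω e.1 e.2) P) {Φ : Matrix ι ι ℂ → ℂ}
    (hΦ : ContinuousOn Φ {X | X.IsHermitian}) (hb : ∃ C, ∀ X, X.IsHermitian → ‖Φ X‖ ≤ C) :
    Integrable (fun ω => Φ (X ω)) P := by
  have := hG.isProbabilityMeasure
  obtain ⟨C, hC⟩ := hb
  exact Integrable.of_bound (aestronglyMeasurable_comp_of_continuousOn hX hG.aemeasurable hΦ) C
    (ae_of_all _ fun ω => hC _ (hX ω))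

/-- The Schwinger–Dyson equation: integration by parts applied to `X R = z R - 1`, tested against a
deterministic matrix `B` and a function `Ψ` of `X`. -/
theorem IsGaussianBlockModel.schwingerDyson (hA : IsGaussianBlockModel σ P A) {z : ℂ}
    (hz : z.im ≠ 0) (B : Matrix (BlockIndex N) (BlockIndex N) ℂ)
    {Ψ : Matrix (BlockIndex N) (BlockIndex N) ℂ → ℂ}
    {Ψ' : Matrix (BlockIndex N) (BlockIndex N) ℂ → Matrix (BlockIndex N) (BlockIndex N) ℂ →ₗ[ℂ] ℂ}
    (hΨ : HasBoundedDeriv Ψ Ψ') :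
    ∫ ω, ((B * (z • matrixResolvent z (blockMatrix fun i j => A i j ω) - 1)).trace
        - (totalSize N)⁻¹ * ∑ i, ∑ k, ∑ l, ∑ j, σ i k l j *
          ((blockUnit N l k * matrixResolvent z (blockMatrix fun i j => A i j ω)).trace *
            (B * blockUnit N i j *
              matrixResolvent z (blockMatrix fun i j => A i j ω)).trace))
        * Ψ (blockMatrix fun i j => A i j ω) ∂P =
      ∫ ω, ∑ q, ∑ p, ∑ u, B q p *
        (matrixResolvent z (blockMatrix fun i j => A i j ω) u q *
          Ψ' (blockMatrix fun i j => A i j ω) (covMatrix σ p u)) ∂P := by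
  set X : Ω → Matrix (BlockIndex N) (BlockIndex N) ℂ := fun ω => blockMatrix fun i j => A i j ω
    with hXdef
  have hX : ∀ ω, (X ω).IsHermitian := hA.isHermitian
  have hG : HasGaussianLaw (fun ω (e : BlockIndex N × BlockIndex N) => X ω e.1 e.2) P := hA.gaussian
  have h0 : ∀ p q, ∫ ω, X ω p q ∂P = 0 := fun p q => hA.mean_zero p.1 q.1 p.2 q.2
  have := hG.isProbabilityMeasure
  change ∫ ω, ((B * (z • matrixResolvent z (X ω) - 1)).trace
        - (totalSize N)⁻¹ * ∑ i, ∑ k, ∑ l, ∑ j, σ i k l j *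
          ((blockUnit N l k * matrixResolvent z (X ω)).trace *
            (B * blockUnit N i j * matrixResolvent z (X ω)).trace)) * Ψ (X ω) ∂P =
      ∫ ω, ∑ q, ∑ p, ∑ u, B q p *
        (matrixResolvent z (X ω) u q * Ψ' (X ω) (covMatrix σ p u)) ∂P
  -- The entry `R_{uq}` as a test function.
  have hR : ∀ u q, HasBoundedDeriv (fun Y : Matrix (BlockIndex N) (BlockIndex N) ℂ =>
      matrixResolvent z Y u q) _ := fun u q =>
    hasBoundedDeriv_resolvent hz (Matrix.entryLinearMap ℂ ℂ u q)
  have step : ∀ p u q, ∫ ω, X ω p u * (matrixResolvent z (X ω) u q * Ψ (X ω)) ∂P =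
      ∫ ω, (Ψ (X ω) * (matrixResolvent z (X ω) * covMatrix σ p u * matrixResolvent z (X ω) :
        Matrix (BlockIndex N) (BlockIndex N) ℂ) u q
        + matrixResolvent z (X ω) u q * Ψ' (X ω) (covMatrix σ p u)) ∂P := by
    intro p u q
    have h := integral_entry_mul hX hG h0 ((hR u q).mul hΨ) p u
    have hc := hA.covariance_eq p u
    change (Matrix.of fun v w => ∫ ω, X ω p u * X ω v w ∂P) = _ at hc
    rw [hc] at h
    rw [h]
    refine integral_congr_ae (ae_of_all _ fun ω => ?_)
    simp [LinearMap.mulLeftRight_apply, Matrix.entryLinearMap_apply]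
  have hΨi : ∀ p u q, Integrable
      (fun ω => X ω p u * (matrixResolvent z (X ω) u q * Ψ (X ω))) P := by
    intro p u q
    obtain ⟨C, hC⟩ := ((hR u q).mul hΨ).bounded
    exact (hG.integrable.eval (p, u)).mul_bdd (aestronglyMeasurable_comp_of_continuousOn hX
      hG.aemeasurable ((hR u q).mul hΨ).continuousOn) (ae_of_all _ fun ω => hC _ (hX ω))
  have hi1 : ∀ p u q, Integrable (fun ω => Ψ (X ω) *
      (matrixResolvent z (X ω) * covMatrix σ p u * matrixResolvent z (X ω) :
        Matrix (BlockIndex N) (BlockIndex N) ℂ) u q) P := by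
    intro p u q
    obtain ⟨C, hC⟩ := hΨ.bounded
    obtain ⟨C', hC'⟩ := (hR u q).bounded_deriv (covMatrix σ p u)
    exact (integrable_comp_of_continuousOn hX hG ((hR u q).continuousOn_deriv (covMatrix σ p u))
      ⟨C', hC'⟩).bdd_mul (aestronglyMeasurable_comp_of_continuousOn hX
      hG.aemeasurable hΨ.continuousOn) (ae_of_all _ fun ω => hC _ (hX ω))
  have hi2 : ∀ p u q, Integrable (fun ω => matrixResolvent z (X ω) u q *
      Ψ' (X ω) (covMatrix σ p u)) P := by
    intro p u q
    obtain ⟨C, hC⟩ := (hR u q).bounded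
    obtain ⟨C', hC'⟩ := hΨ.bounded_deriv (covMatrix σ p u)
    exact (integrable_comp_of_continuousOn hX hG (hΨ.continuousOn_deriv (covMatrix σ p u))
      ⟨C', hC'⟩).bdd_mul (aestronglyMeasurable_comp_of_continuousOn hX
      hG.aemeasurable (hR u q).continuousOn) (ae_of_all _ fun ω => hC _ (hX ω))
  have lhs : ∀ ω, (B * (z • matrixResolvent z (X ω) - 1)).trace * Ψ (X ω) =
      ∑ q, ∑ p, ∑ u, B q p * (X ω p u * (matrixResolvent z (X ω) u q * Ψ (X ω))) := by
    intro ω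
    rw [smul_matrixResolvent (hX ω) hz, add_sub_cancel_left, Matrix.trace]
    simp only [Matrix.diag_apply, Matrix.mul_apply, Finset.mul_sum, Finset.sum_mul]
    refine Finset.sum_congr rfl fun q _ => Finset.sum_congr rfl fun p _ =>
      Finset.sum_congr rfl fun u _ => ?_
    ring
  have mid : ∀ ω, (totalSize N)⁻¹ * (∑ i, ∑ k, ∑ l, ∑ j, σ i k l j *
      ((blockUnit N l k * matrixResolvent z (X ω)).trace *
        (B * blockUnit N i j * matrixResolvent z (X ω)).trace)) * Ψ (X ω) =
      ∑ q, ∑ p, ∑ u, B q p * (Ψ (X ω) *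
        (matrixResolvent z (X ω) * covMatrix σ p u * matrixResolvent z (X ω) :
        Matrix (BlockIndex N) (BlockIndex N) ℂ) u q) := by
    intro ω
    rw [← sum_mul_mul_covMatrix_mul]
    simp only [Finset.sum_mul]
    refine Finset.sum_congr rfl fun q _ => Finset.sum_congr rfl fun p _ =>
      Finset.sum_congr rfl fun u _ => ?_
    ring
  have hs : ∀ f : BlockIndex N → BlockIndex N → BlockIndex N → Ω → ℂ,
      (∀ p u q, Integrable (f p u q) P) →
      Integrable (fun ω => ∑ q, ∑ p, ∑ u, B q p * f p u q ω) P ∧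
      ∫ ω, ∑ q, ∑ p, ∑ u, B q p * f p u q ω ∂P = ∑ q, ∑ p, ∑ u, B q p * ∫ ω, f p u q ω ∂P := by
    intro f hf
    have i3 : ∀ p q, Integrable (fun ω => ∑ u, B q p * f p u q ω) P := fun p q =>
      integrable_finsetSum _ fun u _ => (hf p u q).const_mul _
    have i2 : ∀ q, Integrable (fun ω => ∑ p, ∑ u, B q p * f p u q ω) P := fun q =>
      integrable_finsetSum _ fun p _ => i3 p q
    refine ⟨integrable_finsetSum _ fun q _ => i2 q, ?_⟩
    rw [integral_finsetSum _ fun q _ => i2 q]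
    refine Finset.sum_congr rfl fun q _ => ?_
    rw [integral_finsetSum _ fun p _ => i3 p q]
    refine Finset.sum_congr rfl fun p _ => ?_
    rw [integral_finsetSum _ fun u _ => (hf p u q).const_mul _]
    exact Finset.sum_congr rfl fun u _ => integral_const_mul _ _
  have s1 := hs _ hΨi
  have s2 := hs _ hi1
  have s3 := hs _ hi2
  simp only [sub_mul, lhs, mid]
  rw [integral_sub s1.1 s2.1, s1.2, s2.2, s3.2]
  simp only [← Finset.sum_sub_distrib, ← mul_sub, step]
  refine Finset.sum_congr rfl fun q _ => Finset.sum_congr rfl fun p _ =>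
      Finset.sum_congr rfl fun u _ => ?_
  rw [integral_add (hi1 p u q) (hi2 p u q), add_sub_cancel_left]

end SchwingerDyson

/-! ### Concentration of the block traces and the approximate equation -/

section BlockGreen

open scoped Matrix.Norms.L2Operator
open scoped ComplexConjugate

variable {d : ℕ} {N : Fin d → ℕ}

/-- `η_α` as a continuous linear map on all `d × d` matrices. -/
def etaCLM (α : Fin d → ℝ) (σ : Fin d → Fin d → Fin d → Fin d → ℂ) :
    Matrix (Fin d) (Fin d) ℂ →L[ℂ] Matrix (Fin d) (Fin d) ℂ :=
  LinearMap.toContinuousLinearMap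
    { toFun := etaWeighted α σ
      map_add' := fun D E => by
        ext i j
        simp [etaWeighted, mul_add, Finset.sum_add_distrib]
      map_smul' := fun c D => by
        ext i j
        simp only [etaWeighted, Matrix.of_apply, Matrix.smul_apply, smul_eq_mul, Finset.mul_sum,
          RingHom.id_apply]
        exact Finset.sum_congr rfl fun k _ => Finset.sum_congr rfl fun l _ => by ring }

/-- The normalised trace `T_{kl} = (1/n) ∑_r M_{(k,r),(l,r)}` of a block of `M`. -/
def blockTrace (M : Matrix (BlockIndex N) (BlockIndex N) ℂ) (k l : Fin d) : ℂ :=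
  (totalSize N)⁻¹ * (blockUnit N l k * M).trace

/-- The matrix of the block traces `T_{kl} / α_k`, restricted to `M_α(ℂ)`. -/
def blockGreen (α : Fin d → ℝ) (M : Matrix (BlockIndex N) (BlockIndex N) ℂ) :
    Matrix (Fin d) (Fin d) ℂ :=
  Matrix.of fun k l => if α k = α l then (α k : ℂ)⁻¹ * blockTrace M k l else 0

theorem blockGreen_mem (α : Fin d → ℝ) (M : Matrix (BlockIndex N) (BlockIndex N) ℂ) :
    blockGreen α M ∈ weightedMatrices α := by
  intro i j hij
  simp [blockGreen, hij]

theorem norm_totalSize_inv_mul_trace_le (M : Matrix (BlockIndex N) (BlockIndex N) ℂ) :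
    ‖(totalSize N)⁻¹ * M.trace‖ ≤ ‖M‖ := by
  rw [norm_mul, norm_inv]
  have h1 := norm_trace_le M
  have h2 : ‖totalSize N‖ = Fintype.card (BlockIndex N) := by
    rw [card_blockIndex, totalSize, Complex.norm_natCast]
  rw [h2]
  rcases (Nat.cast_nonneg (α := ℝ) (Fintype.card (BlockIndex N))).eq_or_lt with h | h
  · rw [← h]; simp
  · rw [inv_mul_le_iff₀ h]; exact h1

theorem norm_blockTrace_le (M : Matrix (BlockIndex N) (BlockIndex N) ℂ) (k l : Fin d) :
    ‖blockTrace M k l‖ ≤ ‖M‖ := by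
  refine (norm_totalSize_inv_mul_trace_le _).trans ((norm_mul_le _ _).trans ?_)
  exact mul_le_of_le_one_left (norm_nonneg _) (norm_blockUnit_le _ _)

theorem norm_blockGreen_apply_le {α : Fin d → ℝ} (hα : ∀ i, 0 < α i)
    (M : Matrix (BlockIndex N) (BlockIndex N) ℂ) (k l : Fin d) :
    ‖blockGreen α M k l‖ ≤ (∑ i, (α i)⁻¹) * ‖M‖ := by
  have h0 : (α k)⁻¹ ≤ ∑ i, (α i)⁻¹ :=
    Finset.single_le_sum (f := fun i => (α i)⁻¹) (fun i _ => (inv_pos.2 (hα i)).le)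
      (Finset.mem_univ k)
  have h1 : 0 ≤ (α k)⁻¹ := (inv_pos.2 (hα k)).le
  simp only [blockGreen, Matrix.of_apply]
  split_ifs
  · rw [norm_mul, norm_inv, Complex.norm_real, Real.norm_of_nonneg (hα k).le]
    exact mul_le_mul h0 (norm_blockTrace_le M k l) (norm_nonneg _) (h1.trans h0)
  · rw [norm_zero]
    exact mul_nonneg (h1.trans h0) (norm_nonneg _)

theorem conj_blockTrace_matrixResolvent {X : Matrix (BlockIndex N) (BlockIndex N) ℂ}
    (hX : X.IsHermitian) (z : ℂ) (k l : Fin d) :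
    conj (blockTrace (matrixResolvent z X) k l) = blockTrace (matrixResolvent (conj z) X) l k := by
  rw [blockTrace, blockTrace, map_mul, map_inv₀]
  congr 1
  · simp [totalSize]
  · have h := Matrix.trace_conjTranspose (blockUnit N l k * matrixResolvent z X)
    rw [Matrix.conjTranspose_mul, conjTranspose_blockUnit, conjTranspose_matrixResolvent hX,
      Matrix.trace_mul_comm] at h
    exact h.symm

theorem conj_blockGreen_matrixResolvent (α : Fin d → ℝ)
    {X : Matrix (BlockIndex N) (BlockIndex N) ℂ} (hX : X.IsHermitian) (z : ℂ) (k l : Fin d) :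
    conj (blockGreen α (matrixResolvent z X) k l)
      = blockGreen α (matrixResolvent (conj z) X) l k := by
  simp only [blockGreen, Matrix.of_apply]
  by_cases h : α k = α l
  · rw [if_pos h, if_pos h.symm, map_mul, conj_blockTrace_matrixResolvent hX, map_inv₀,
      Complex.conj_ofReal, h]
  · rw [if_neg h, if_neg (Ne.symm h), map_zero]

/-- The deviation of the block proportions `N_i / n` from `α_i`, plus `1 / n`: all error terms are
bounded by a multiple of it. -/
def discrepancy (α : Fin d → ℝ) (N : Fin d → ℕ) : ℝ :=
  1 / ((∑ i, N i : ℕ) : ℝ) + ∑ i, |(N i : ℝ) / ((∑ i', N i' : ℕ) : ℝ) - α i|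

theorem discrepancy_nonneg (α : Fin d → ℝ) (N : Fin d → ℕ) : 0 ≤ discrepancy α N :=
  add_nonneg (by positivity) (Finset.sum_nonneg fun _ _ => abs_nonneg _)

theorem abs_proportion_sub_le (α : Fin d → ℝ) (N : Fin d → ℕ) (i : Fin d) :
    |(N i : ℝ) / ((∑ i', N i' : ℕ) : ℝ) - α i| ≤ discrepancy α N := by
  have h := Finset.single_le_sum (f := fun i => |(N i : ℝ) / ((∑ i', N i' : ℕ) : ℝ) - α i|)
    (fun i _ => abs_nonneg _) (Finset.mem_univ i)
  have h2 : (0 : ℝ) ≤ 1 / ((∑ i', N i' : ℕ) : ℝ) := by positivity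
  rw [discrepancy]; linarith

theorem proportion_sub_le {α : Fin d → ℝ} (N : Fin d → ℕ) {i j : Fin d} (hij : α i = α j) :
    ((N j - N i : ℕ) : ℝ) / ((∑ i', N i' : ℕ) : ℝ) ≤ 2 * discrepancy α N := by
  have h1 := abs_le.1 (abs_proportion_sub_le α N i)
  have h2 := abs_le.1 (abs_proportion_sub_le α N j)
  rcases le_total (N j) (N i) with h | h
  · rw [Nat.sub_eq_zero_of_le h]
    have := discrepancy_nonneg α N
    simp; linarith
  · rw [Nat.cast_sub h, sub_div]
    linarith

/-- The defect, before taking expectations, in the Schwinger–Dyson equation for the block traces;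
it is mean zero up to `O(1/n²)`. -/
def blockDefect (σ : Fin d → Fin d → Fin d → Fin d → ℂ) (z : ℂ)
    (R : Matrix (BlockIndex N) (BlockIndex N) ℂ) (i j : Fin d) : ℂ :=
  (((totalSize N)⁻¹ • blockUnit N j i) * (z • R - 1)).trace
    - (totalSize N)⁻¹ * ∑ i', ∑ k, ∑ l, ∑ j', σ i' k l j' *
      ((blockUnit N l k * R).trace *
        (((totalSize N)⁻¹ • blockUnit N j i) * blockUnit N i' j' * R).trace)

theorem norm_equation_sub_blockDefect_le {α : Fin d → ℝ}
    (hα : ∀ i, 0 < α i) {σ : Fin d → Fin d → Fin d → Fin d → ℂ}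
    (hσ : ∀ i j k l, σ i j k l ≠ 0 → α i = α l ∧ α j = α k) {S : ℝ}
    (hS : ∀ i j k l, ‖σ i j k l‖ ≤ S) (z : ℂ)
    (R : Matrix (BlockIndex N) (BlockIndex N) ℂ) {i j : Fin d} (hij : α i = α j) :
    ‖(α i : ℂ) * (z • blockGreen α R - 1 - etaWeighted α σ (blockGreen α R) * blockGreen α R) i j
      - blockDefect σ z R i j‖ ≤ (1 + 2 * d ^ 3 * S * ‖R‖ ^ 2) * discrepancy α N := by
  set T := blockTrace R with hT
  set n := totalSize N with hn
  have hα0 : ∀ k, (α k : ℂ) ≠ 0 := fun k => by exact_mod_cast (hα k).ne'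
  have hGT : ∀ k l, α k = α l → (α k : ℂ) * blockGreen α R k l = T k l := fun k l h => by
    simp only [blockGreen, Matrix.of_apply, if_pos h]
    rw [← mul_assoc, mul_inv_cancel₀ (hα0 k), one_mul]
  -- The quadratic term, in terms of the block traces.
  have hquad : (α i : ℂ) * (etaWeighted α σ (blockGreen α R) * blockGreen α R) i j =
      ∑ k, ∑ l, ∑ j', σ i k l j' * (T k l * T j' j) := by
    rw [Matrix.mul_apply, Finset.mul_sum]
    simp only [etaWeighted, Matrix.of_apply, Finset.sum_mul, Finset.mul_sum]
    rw [Finset.sum_comm]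
    refine Finset.sum_congr rfl fun k _ => ?_
    rw [Finset.sum_comm]
    refine Finset.sum_congr rfl fun l _ => Finset.sum_congr rfl fun j' _ => ?_
    by_cases h0 : σ i k l j' = 0
    · simp [h0]
    · obtain ⟨h1, h2⟩ := hσ _ _ _ _ h0
      rw [← hGT k l h2, ← hGT j' j (h1.symm.trans hij), h1]
      ring
  have hlin : (((totalSize N)⁻¹ • blockUnit N j i) * (z • R - 1)).trace
      = z * T i j - (if i = j then n⁻¹ * (N i : ℂ) else 0) := by
    rw [mul_sub, mul_one, Matrix.trace_sub, Matrix.smul_mul, Matrix.trace_smul, Matrix.trace_smul,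
      Matrix.mul_smul, Matrix.trace_smul, trace_blockUnit, hT, blockTrace]
    simp only [smul_eq_mul]
    by_cases h : i = j
    · subst h; simp; ring
    · simp [h, Ne.symm h]; ring
  have hdef : n⁻¹ * (∑ i', ∑ k, ∑ l, ∑ j', σ i' k l j' * ((blockUnit N l k * R).trace *
        (((totalSize N)⁻¹ • blockUnit N j i) * blockUnit N i' j' * R).trace)) =
      ∑ k, ∑ l, ∑ j', σ i k l j' * (T k l *
        (n⁻¹ * (blockUnit N j i * blockUnit N i j' * R).trace)) := by
    rw [Finset.sum_eq_single i]
    · simp only [Finset.mul_sum]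
      refine Finset.sum_congr rfl fun k _ => Finset.sum_congr rfl fun l _ =>
        Finset.sum_congr rfl fun j' _ => ?_
      simp only [Matrix.smul_mul, Matrix.trace_smul, hT, blockTrace, smul_eq_mul]
      ring
    · intro b _ hb
      refine Finset.sum_eq_zero fun k _ => Finset.sum_eq_zero fun l _ =>
        Finset.sum_eq_zero fun j' _ => ?_
      rw [Matrix.smul_mul, blockUnit_mul_blockUnit_of_ne hb.symm]
      simp
    · simp
  have hmain : (α i : ℂ) *
      (z • blockGreen α R - 1 - etaWeighted α σ (blockGreen α R) * blockGreen α R) i j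
      - blockDefect σ z R i j = (if i = j then n⁻¹ * (N i : ℂ) - α i else 0) +
        ∑ k, ∑ l, ∑ j', σ i k l j' * (T k l *
          (n⁻¹ * ((blockUnit N j i * blockUnit N i j' * R).trace
            - (blockUnit N j j' * R).trace))) := by
    have e1 : ∑ k, ∑ l, ∑ j', σ i k l j' * (T k l *
          (n⁻¹ * ((blockUnit N j i * blockUnit N i j' * R).trace
            - (blockUnit N j j' * R).trace))) =
        ∑ k, ∑ l, ∑ j', σ i k l j' * (T k l *
          (n⁻¹ * (blockUnit N j i * blockUnit N i j' * R).trace))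
          - ∑ k, ∑ l, ∑ j', σ i k l j' * (T k l * T j' j) := by
      simp only [← Finset.sum_sub_distrib]
      refine Finset.sum_congr rfl fun k _ => Finset.sum_congr rfl fun l _ =>
        Finset.sum_congr rfl fun j' _ => ?_
      simp only [hT, blockTrace, ← hn]
      ring
    rw [blockDefect, hlin, ← hn, hdef, e1, ← hquad, Matrix.sub_apply, Matrix.sub_apply,
      Matrix.smul_apply, Matrix.one_apply, smul_eq_mul, ← hGT i j hij]
    split_ifs <;> ring
  rw [hmain]
  have hδ := discrepancy_nonneg α N
  have hnn : ‖n‖ = ((∑ i', N i' : ℕ) : ℝ) := by rw [hn, totalSize, Complex.norm_natCast]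
  have b1 : ‖(if i = j then n⁻¹ * (N i : ℂ) - α i else 0 : ℂ)‖ ≤ discrepancy α N := by
    split_ifs
    · refine le_trans (le_of_eq ?_) (abs_proportion_sub_le α N i)
      rw [← Real.norm_eq_abs, ← Complex.norm_real]
      congr 1
      simp only [hn, totalSize]
      push_cast
      ring
    · simpa using hδ
  have b2 : ∀ k l j', ‖σ i k l j' * (T k l *
          (n⁻¹ * ((blockUnit N j i * blockUnit N i j' * R).trace
            - (blockUnit N j j' * R).trace)))‖ ≤ S * (‖R‖ * (2 * discrepancy α N * ‖R‖)) := by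
    intro k l j'
    have hS0 : 0 ≤ S := (norm_nonneg _).trans (hS i i i i)
    rw [norm_mul, norm_mul, norm_mul, norm_inv, hnn]
    refine mul_le_mul (hS _ _ _ _) (mul_le_mul (norm_blockTrace_le R k l) ?_ (by positivity)
      (norm_nonneg _)) (by positivity) hS0
    refine (mul_le_mul_of_nonneg_left (norm_trace_blockUnit_mul_sub_le i j j' R)
      (by positivity)).trans ?_
    rw [← mul_assoc]
    refine mul_le_mul_of_nonneg_right ?_ (norm_nonneg _)
    rw [mul_comm, ← div_eq_mul_inv]
    exact proportion_sub_le N hij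
  refine (norm_add_le _ _).trans ((add_le_add b1 ((norm_sum_le _ _).trans
    (Finset.sum_le_sum fun k _ => (norm_sum_le _ _).trans (Finset.sum_le_sum fun l _ =>
      (norm_sum_le _ _).trans (Finset.sum_le_sum fun j' _ => b2 k l j'))))).trans ?_)
  simp only [Finset.sum_const, Finset.card_univ, Fintype.card_fin, nsmul_eq_mul]
  apply le_of_eq
  ring

end BlockGreen

section Concentration

open scoped Matrix.Norms.L2Operator
open scoped ComplexConjugate

variable {d : ℕ} {N : Fin d → ℕ}
variable {Ω : Type*} [MeasurableSpace Ω] {P : Measure Ω}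
  {σ : Fin d → Fin d → Fin d → Fin d → ℂ}
  {A : (i j : Fin d) → Ω → Matrix (Fin (N i)) (Fin (N j)) ℂ}

theorem IsGaussianBlockModel.integral_blockDefect (hA : IsGaussianBlockModel σ P A) {z : ℂ}
    (hz : z.im ≠ 0) (i j : Fin d) :
    ∫ ω, blockDefect σ z (matrixResolvent z (blockMatrix fun i j => A i j ω)) i j ∂P = 0 := by
  have h := hA.schwingerDyson hz ((totalSize N)⁻¹ • blockUnit N j i) (hasBoundedDeriv_const 1)
  simp only [mul_one, LinearMap.zero_apply, mul_zero, Finset.sum_const_zero, integral_zero] at h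
  exact h

/-- The functional `M ↦ T_{ab}(M) / α_a` on `n × n` matrices. -/
def blockGreenFunctional (N : Fin d → ℕ) (α : Fin d → ℝ) (a b : Fin d) :
    Matrix (BlockIndex N) (BlockIndex N) ℂ →ₗ[ℂ] ℂ :=
  Matrix.traceLinearMap _ ℂ ℂ ∘ₗ LinearMap.mulLeft ℂ
    ((if α a = α b then (α a : ℂ)⁻¹ * (totalSize N)⁻¹ else 0) • blockUnit N b a)

theorem blockGreenFunctional_apply (α : Fin d → ℝ) (a b : Fin d)
    (M : Matrix (BlockIndex N) (BlockIndex N) ℂ) :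
    blockGreenFunctional N α a b M = blockGreen α M a b := by
  simp only [blockGreenFunctional, LinearMap.comp_apply, LinearMap.mulLeft_apply,
    Matrix.traceLinearMap_apply, Matrix.smul_mul, Matrix.trace_smul, blockGreen, Matrix.of_apply,
    blockTrace, smul_eq_mul]
  split_ifs <;> simp [mul_assoc]

/-- Tested against an entry of the block traces, the Schwinger–Dyson defect is of order `1/n²`: the
derivative term in the integration by parts is the normalised trace of a product of bounded
matrices, with two further factors `1/n`. -/
theorem IsGaussianBlockModel.norm_integral_blockDefect_mul_le (hA : IsGaussianBlockModel σ P A)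
    {α : Fin d → ℝ} (hα : ∀ i, 0 < α i) {S : ℝ} (hS : ∀ i j k l, ‖σ i j k l‖ ≤ S) {z : ℂ}
    (hz : z.im ≠ 0) (i j a b : Fin d) :
    ‖∫ ω, blockDefect σ z (matrixResolvent z (blockMatrix fun i j => A i j ω)) i j
      * blockGreen α (matrixResolvent (conj z) (blockMatrix fun i j => A i j ω)) a b ∂P‖
      ≤ d ^ 4 * S * (∑ i, (α i)⁻¹) * |z.im|⁻¹ ^ 3 * discrepancy α N := by
  have := hA.gaussian.isProbabilityMeasure
  have hz' : (conj z).im ≠ 0 := by simpa using hz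
  have hS0 : 0 ≤ S := (norm_nonneg _).trans (hS i i i i)
  set C : Matrix (BlockIndex N) (BlockIndex N) ℂ :=
    (if α a = α b then (α a : ℂ)⁻¹ * (totalSize N)⁻¹ else 0) • blockUnit N b a with hC
  have h := hA.schwingerDyson hz ((totalSize N)⁻¹ • blockUnit N j i)
    (hasBoundedDeriv_resolvent hz' (blockGreenFunctional N α a b))
  simp only [blockGreenFunctional_apply] at h
  change ∫ ω, blockDefect σ z (matrixResolvent z (blockMatrix fun i j => A i j ω)) i j
      * blockGreen α (matrixResolvent (conj z) (blockMatrix fun i j => A i j ω)) a b ∂P = _ at h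
  rw [h]
  simp only [LinearMap.comp_apply, LinearMap.mulLeftRight_apply, blockGreenFunctional,
    LinearMap.mulLeft_apply, Matrix.traceLinearMap_apply, ← hC, sum_mul_mul_trace_covMatrix]
  set n := totalSize N with hn
  have hnn : ‖n‖ = ((∑ i', N i' : ℕ) : ℝ) := by rw [hn, totalSize, Complex.norm_natCast]
  have hδ : ‖n‖⁻¹ * ‖n‖⁻¹ ≤ discrepancy α N := by
    have h1 : ‖n‖⁻¹ ≤ discrepancy α N := by
      rw [hnn, discrepancy, one_div]
      exact le_add_of_nonneg_right (Finset.sum_nonneg fun _ _ => abs_nonneg _)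
    have h2 : ‖n‖⁻¹ ≤ 1 := by rw [hnn]; exact Nat.cast_inv_le_one _
    exact (mul_le_of_le_one_left (by positivity) h2).trans h1
  set ρ := |z.im|⁻¹ with hρ
  have hρ0 : 0 ≤ ρ := by positivity
  have hαs : (α a)⁻¹ ≤ ∑ i, (α i)⁻¹ :=
    Finset.single_le_sum (f := fun i => (α i)⁻¹) (fun i _ => (inv_pos.2 (hα i)).le)
      (Finset.mem_univ a)
  have hCn : ‖C‖ ≤ (∑ i, (α i)⁻¹) * ‖n‖⁻¹ := by
    have h0 : 0 ≤ (∑ i, (α i)⁻¹) := (inv_pos.2 (hα a)).le.trans hαs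
    rw [hC, norm_smul]
    refine (mul_le_of_le_one_right (norm_nonneg _) (norm_blockUnit_le _ _)).trans ?_
    split_ifs
    · rw [norm_mul, norm_inv, norm_inv, Complex.norm_real, Real.norm_of_nonneg (hα a).le]
      exact mul_le_mul_of_nonneg_right hαs (by positivity)
    · simp only [norm_zero]; positivity
  have hpt : ∀ ω, ‖n⁻¹ * ∑ i', ∑ k, ∑ l, ∑ j', σ i' k l j' *
      ((n⁻¹ • blockUnit N j i) * (blockUnit N i' j' *
        (matrixResolvent (conj z) (blockMatrix fun i j => A i j ω) * C *
          matrixResolvent (conj z) (blockMatrix fun i j => A i j ω)) * blockUnit N l k) *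
        matrixResolvent z (blockMatrix fun i j => A i j ω)).trace‖ ≤
      d ^ 4 * S * (∑ i, (α i)⁻¹) * ρ ^ 3 * discrepancy α N := by
    intro ω
    set R := matrixResolvent z (blockMatrix fun i j => A i j ω)
    set R' := matrixResolvent (conj z) (blockMatrix fun i j => A i j ω)
    have hR : ‖R‖ ≤ ρ := norm_matrixResolvent_le (hA.isHermitian ω) hz
    have hR' : ‖R'‖ ≤ ρ := by
      have := norm_matrixResolvent_le (hA.isHermitian ω) hz'
      simpa [hρ] using this
    have hterm : ∀ i' k l j', ‖σ i' k l j' * (n⁻¹ * ((n⁻¹ • blockUnit N j i) * (blockUnit N i' j' *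
        (R' * C * R') * blockUnit N l k) * R).trace)‖ ≤
        S * (‖n‖⁻¹ * (ρ * ((∑ i, (α i)⁻¹) * ‖n‖⁻¹) * ρ) * ρ) := by
      intro i' k l j'
      rw [norm_mul]
      refine mul_le_mul (hS _ _ _ _) ((norm_totalSize_inv_mul_trace_le _).trans ?_)
        (norm_nonneg _) hS0
      have t1 : ‖n⁻¹ • blockUnit N j i‖ ≤ ‖n‖⁻¹ := by
        rw [norm_smul, norm_inv]
        exact mul_le_of_le_one_right (by positivity) (norm_blockUnit_le _ _)
      have t2 : ‖R' * C * R'‖ ≤ ρ * ((∑ i, (α i)⁻¹) * ‖n‖⁻¹) * ρ :=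
        (norm_mul_le _ _).trans (mul_le_mul ((norm_mul_le _ _).trans
          (mul_le_mul hR' hCn (norm_nonneg _) hρ0)) hR' (norm_nonneg _)
          (mul_nonneg hρ0 ((norm_nonneg _).trans hCn)))
      have t3 : ‖blockUnit N i' j' * (R' * C * R') * blockUnit N l k‖ ≤ ‖R' * C * R'‖ := by
        refine (norm_mul_le _ _).trans ?_
        refine (mul_le_of_le_one_right (norm_nonneg _) (norm_blockUnit_le _ _)).trans ?_
        exact (norm_mul_le _ _).trans
          (mul_le_of_le_one_left (norm_nonneg _) (norm_blockUnit_le _ _))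
      refine (norm_mul_le _ _).trans (mul_le_mul ((norm_mul_le _ _).trans
        (mul_le_mul t1 (t3.trans t2) (norm_nonneg _) (by positivity))) hR (norm_nonneg _) ?_)
      exact mul_nonneg (by positivity) ((norm_nonneg _).trans t2)
    have e : n⁻¹ * ∑ i', ∑ k, ∑ l, ∑ j', σ i' k l j' *
        ((n⁻¹ • blockUnit N j i) * (blockUnit N i' j' *
        (R' * C * R') * blockUnit N l k) * R).trace =
        ∑ i', ∑ k, ∑ l, ∑ j', σ i' k l j' * (n⁻¹ * ((n⁻¹ • blockUnit N j i) * (blockUnit N i' j' *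
        (R' * C * R') * blockUnit N l k) * R).trace) := by
      simp only [Finset.mul_sum]
      refine Finset.sum_congr rfl fun i' _ => Finset.sum_congr rfl fun k _ =>
        Finset.sum_congr rfl fun l _ => Finset.sum_congr rfl fun j' _ => ?_
      ring
    rw [e]
    refine ((norm_sum_le _ _).trans (Finset.sum_le_sum fun i' _ => (norm_sum_le _ _).trans
      (Finset.sum_le_sum fun k _ => (norm_sum_le _ _).trans (Finset.sum_le_sum fun l _ =>
      (norm_sum_le _ _).trans (Finset.sum_le_sum fun j' _ => hterm i' k l j'))))).trans ?_
    simp only [Finset.sum_const, Finset.card_univ, Fintype.card_fin, nsmul_eq_mul]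
    have h0 : 0 ≤ (∑ i, (α i)⁻¹) := (inv_pos.2 (hα a)).le.trans hαs
    calc _ = d ^ 4 * S * (∑ i, (α i)⁻¹) * ρ ^ 3 * (‖n‖⁻¹ * ‖n‖⁻¹) := by ring
      _ ≤ _ := mul_le_mul_of_nonneg_left hδ (by positivity)
  refine (norm_integral_le_of_norm_le_const (ae_of_all _ hpt)).trans ?_
  simp

/-- A bounded random matrix `H` that satisfies the equation `z H = 1 + η(H) H` approximately in
expectation, even when tested against its own fluctuation, has small variance as soon as `|z|` is
large, and so its expectation satisfies the equation approximately. -/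
theorem norm_equation_integral_le [IsProbabilityMeasure P] {H : Ω → Matrix (Fin d) (Fin d) ℂ}
    (hHm : AEStronglyMeasurable H P) {b : ℝ} (hb : ∀ ω, ‖H ω‖ ≤ b)
    (η : Matrix (Fin d) (Fin d) ℂ →L[ℂ] Matrix (Fin d) (Fin d) ℂ) {C : ℝ} (hC0 : 0 ≤ C)
    (hC : ∀ M : Matrix (Fin d) (Fin d) ℂ, ‖M‖ ^ 2 ≤ C * ∑ i, ∑ j, ‖M i j‖ ^ 2) {z : ℂ} {ε : ℝ}
    (h1 : ∀ i j, ‖∫ ω, (z • H ω - 1 - η (H ω) * H ω) i j ∂P‖ ≤ ε)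
    (h2 : ∀ i j, ‖∫ ω, (z • H ω - 1 - η (H ω) * H ω) i j *
      conj (H ω i j - (∫ ω', H ω' ∂P) i j) ∂P‖ ≤ ε)
    (hz1 : 1 ≤ ‖z‖) (hz : d ^ 2 * (2 * ‖η‖ * b * C) ≤ ‖z‖ / 2) (i j : Fin d) :
    ‖(z • (∫ ω, H ω ∂P) - 1 - η (∫ ω, H ω ∂P) * (∫ ω, H ω ∂P)) i j‖
      ≤ ε + ‖η‖ * (C * (2 * d ^ 2 * ε)) := by
  have hHi : Integrable H P := Integrable.of_bound hHm b (ae_of_all _ hb)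
  set h := ∫ ω, H ω ∂P with hh
  have hhb : ‖h‖ ≤ b := by
    refine (norm_integral_le_of_norm_le_const (ae_of_all _ hb)).trans ?_
    simp
  have hb0 : 0 ≤ b := (norm_nonneg _).trans hhb
  have hε0 : 0 ≤ ε := (norm_nonneg _).trans (h1 i j)
  set Φ : Ω → Matrix (Fin d) (Fin d) ℂ := fun ω => H ω - h with hΦ
  have hΦi : Integrable Φ P := hHi.sub (integrable_const _)
  have hΦ0 : ∫ ω, Φ ω ∂P = 0 := by
    rw [hΦ, integral_sub hHi (integrable_const _)]
    simp [hh]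
  have hΦb : ∀ ω, ‖Φ ω‖ ≤ 2 * b := fun ω => by
    rw [two_mul]; exact (norm_sub_le _ _).trans (add_le_add (hb ω) hhb)
  -- Every continuous linear functional of the fluctuation has mean zero.
  have lin0 : ∀ ℓ : Matrix (Fin d) (Fin d) ℂ →L[ℂ] ℂ,
      Integrable (fun ω => ℓ (Φ ω)) P ∧ ∫ ω, ℓ (Φ ω) ∂P = 0 := fun ℓ =>
    ⟨ℓ.integrable_comp hΦi, by rw [ℓ.integral_comp_comm hΦi, hΦ0, map_zero]⟩
  let ent : Fin d → Fin d → Matrix (Fin d) (Fin d) ℂ →L[ℂ] ℂ := fun i j =>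
    LinearMap.toContinuousLinearMap (Matrix.entryLinearMap ℂ ℂ i j)
  have hent : ∀ i j M, ent i j M = M i j := fun _ _ _ => rfl
  have entm : ∀ i j (G : Ω → Matrix (Fin d) (Fin d) ℂ), AEStronglyMeasurable G P →
      AEStronglyMeasurable (fun ω => G ω i j) P := fun i j G hG =>
    (ent i j).continuous.comp_aestronglyMeasurable hG
  have bddint : ∀ (f : Ω → ℂ) (c : ℝ), AEStronglyMeasurable f P → (∀ ω, ‖f ω‖ ≤ c) →
      Integrable f P := fun f c hf hc => Integrable.of_bound hf c (ae_of_all _ hc)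
  have split3 : ∀ f g k : Ω → ℂ, Integrable f P → Integrable g P → Integrable k P →
      ∫ ω, (f ω + g ω - k ω) ∂P = ∫ ω, f ω ∂P + ∫ ω, g ω ∂P - ∫ ω, k ω ∂P := by
    intro f g k hf hg hk
    rw [integral_sub (f := fun ω => f ω + g ω) (hf.add hg) hk, integral_add hf hg]
  have hηΦ : AEStronglyMeasurable (fun ω => η (Φ ω)) P :=
    η.continuous.comp_aestronglyMeasurable hΦi.1
  have hηH : AEStronglyMeasurable (fun ω => η (H ω)) P :=
    η.continuous.comp_aestronglyMeasurable hHm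
  have hηle : ∀ M, ‖η M‖ ≤ ‖η‖ * ‖M‖ := η.le_opNorm
  -- The variance.
  set v : Ω → ℝ := fun ω => ∑ i, ∑ j, ‖Φ ω i j‖ ^ 2 with hv
  have hsqi : ∀ i j, Integrable (fun ω => ‖Φ ω i j‖ ^ 2) P := fun i j => by
    refine Integrable.of_bound ((entm i j _ hΦi.1).norm.pow 2) ((2 * b) ^ 2)
      (ae_of_all _ fun ω => ?_)
    rw [norm_pow, norm_norm]
    exact pow_le_pow_left₀ (norm_nonneg _) ((norm_entry_le _ _ _).trans (hΦb ω)) 2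
  have hvi : Integrable v P :=
    integrable_finsetSum _ fun i _ => integrable_finsetSum _ fun j _ => hsqi i j
  set V := ∫ ω, v ω ∂P with hV
  have hV0 : 0 ≤ V := integral_nonneg fun ω =>
    Finset.sum_nonneg fun _ _ => Finset.sum_nonneg fun _ _ => by positivity
  have hVsum : V = ∑ i, ∑ j, ∫ ω, ‖Φ ω i j‖ ^ 2 ∂P := by
    rw [hV, hv, integral_finsetSum _ fun i _ => integrable_finsetSum _ fun j _ => hsqi i j]
    exact Finset.sum_congr rfl fun i _ => integral_finsetSum _ fun j _ => hsqi i j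
  have hvar : ∀ i j, ‖z‖ * ∫ ω, ‖Φ ω i j‖ ^ 2 ∂P ≤ ε + 2 * ‖η‖ * b * C * V := by
    intro i j
    set Q : Ω → ℂ := fun ω => (η (Φ ω) * h + η (H ω) * Φ ω) i j * conj (Φ ω i j) with hQ
    have hQb : ∀ ω, ‖Q ω‖ ≤ 2 * ‖η‖ * b * C * v ω := by
      intro ω
      rw [hQ, norm_mul, RCLike.norm_conj]
      have t1 : ‖η (Φ ω) * h + η (H ω) * Φ ω‖ ≤ 2 * ‖η‖ * b * ‖Φ ω‖ := by
        refine (norm_add_le _ _).trans ?_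
        have a1 : ‖η (Φ ω) * h‖ ≤ ‖η‖ * ‖Φ ω‖ * b := (norm_mul_le _ _).trans
          (mul_le_mul (hηle _) hhb (norm_nonneg _) (by positivity))
        have a2 : ‖η (H ω) * Φ ω‖ ≤ ‖η‖ * b * ‖Φ ω‖ := (norm_mul_le _ _).trans
          (mul_le_mul_of_nonneg_right ((hηle _).trans
            (mul_le_mul_of_nonneg_left (hb ω) (norm_nonneg _))) (norm_nonneg _))
        linarith
      calc _ ≤ (2 * ‖η‖ * b * ‖Φ ω‖) * ‖Φ ω‖ :=
            mul_le_mul ((norm_entry_le _ _ _).trans t1) (norm_entry_le _ _ _) (norm_nonneg _)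
              (by positivity)
        _ = 2 * ‖η‖ * b * ‖Φ ω‖ ^ 2 := by ring
        _ ≤ 2 * ‖η‖ * b * (C * v ω) := mul_le_mul_of_nonneg_left (hC _) (by positivity)
        _ = _ := by ring
    have hconjm : AEStronglyMeasurable (fun ω => conj (Φ ω i j)) P :=
      Complex.continuous_conj.comp_aestronglyMeasurable (entm i j _ hΦi.1)
    have hQm : AEStronglyMeasurable Q P :=
      (entm i j _ ((hηΦ.mul aestronglyMeasurable_const).add (hηH.mul hΦi.1))).mul hconjm
    have hQi : Integrable Q P := (hvi.const_mul (2 * ‖η‖ * b * C)).mono' hQm (ae_of_all _ hQb)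
    have hQint : ‖∫ ω, Q ω ∂P‖ ≤ 2 * ‖η‖ * b * C * V := by
      rw [hV, ← integral_const_mul]
      exact norm_integral_le_of_norm_le (hvi.const_mul _) (ae_of_all _ hQb)
    have hconst : ∫ ω, (z • h - 1 - η h * h) i j * conj (Φ ω i j) ∂P = 0 := by
      rw [integral_const_mul, integral_conj]
      have := (lin0 (ent i j)).2
      simp only [hent] at this
      rw [this, map_zero, mul_zero]
    have hF2i : Integrable (fun ω => (z • H ω - 1 - η (H ω) * H ω) i j * conj (Φ ω i j)) P := by
      have hm : AEStronglyMeasurable (fun ω => z • H ω - 1 - η (H ω) * H ω) P :=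
        ((hHm.const_smul z).sub aestronglyMeasurable_const).sub (hηH.mul hHm)
      refine bddint _ ((‖z‖ * b + ‖(1 : Matrix (Fin d) (Fin d) ℂ)‖ + ‖η‖ * b * b) * (2 * b))
        ((entm i j _ hm).mul hconjm) fun ω => ?_
      rw [norm_mul, RCLike.norm_conj]
      refine mul_le_mul ((norm_entry_le _ _ _).trans ?_) ((norm_entry_le _ _ _).trans (hΦb ω))
        (norm_nonneg _) (by positivity)
      refine (norm_sub_le _ _).trans (add_le_add ((norm_sub_le _ _).trans (add_le_add ?_ le_rfl))
        ((norm_mul_le _ _).trans (mul_le_mul ((hηle _).trans ?_) (hb ω) (norm_nonneg _)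
          (by positivity))))
      · rw [norm_smul]; exact mul_le_mul_of_nonneg_left (hb ω) (norm_nonneg _)
      · exact mul_le_mul_of_nonneg_left (hb ω) (norm_nonneg _)
    have hci : Integrable (fun ω => (z • h - 1 - η h * h) i j * conj (Φ ω i j)) P := by
      refine Integrable.const_mul ?_ _
      exact bddint _ (2 * b) hconjm fun ω => by
        rw [RCLike.norm_conj]; exact (norm_entry_le _ _ _).trans (hΦb ω)
    have hpt : ∀ ω, z * ((‖Φ ω i j‖ ^ 2 : ℝ) : ℂ) =
        (z • H ω - 1 - η (H ω) * H ω) i j * conj (Φ ω i j) + Q ω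
          - (z • h - 1 - η h * h) i j * conj (Φ ω i j) := by
      intro ω
      have e1 : ((‖Φ ω i j‖ ^ 2 : ℝ) : ℂ) = Φ ω i j * conj (Φ ω i j) := by
        rw [RCLike.mul_conj]; norm_cast
      have e2 : z • Φ ω = (z • H ω - 1 - η (H ω) * H ω) + (η (Φ ω) * h + η (H ω) * Φ ω)
          - (z • h - 1 - η h * h) := by
        simp only [hΦ, map_sub, sub_mul, mul_sub, smul_sub]
        abel
      have e3 : z * Φ ω i j = (z • H ω - 1 - η (H ω) * H ω) i j
          + (η (Φ ω) * h + η (H ω) * Φ ω) i j - (z • h - 1 - η h * h) i j :=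
        congrFun (congrFun e2 i) j
      rw [e1, ← mul_assoc, e3, hQ]
      ring
    have hint : z * ((∫ ω, ‖Φ ω i j‖ ^ 2 ∂P : ℝ) : ℂ) =
        ∫ ω, (z • H ω - 1 - η (H ω) * H ω) i j * conj (Φ ω i j) ∂P + ∫ ω, Q ω ∂P := by
      rw [← integral_complex_ofReal, ← integral_const_mul]
      refine (integral_congr_ae (ae_of_all _ hpt)).trans
        ((split3 _ _ _ hF2i hQi hci).trans ?_)
      rw [hconst, sub_zero]
    have hnorm : ‖z * ((∫ ω, ‖Φ ω i j‖ ^ 2 ∂P : ℝ) : ℂ)‖ = ‖z‖ * ∫ ω, ‖Φ ω i j‖ ^ 2 ∂P := by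
      rw [norm_mul, Complex.norm_real, Real.norm_of_nonneg]
      exact integral_nonneg fun ω => by positivity
    rw [← hnorm, hint]
    exact (norm_add_le _ _).trans (add_le_add (h2 i j) hQint)
  have hVle : V ≤ 2 * d ^ 2 * ε := by
    have s : ‖z‖ * V ≤ d ^ 2 * (ε + 2 * ‖η‖ * b * C * V) := by
      calc ‖z‖ * V = ∑ i, ∑ j, ‖z‖ * ∫ ω, ‖Φ ω i j‖ ^ 2 ∂P := by
            rw [hVsum]; simp only [Finset.mul_sum]
        _ ≤ ∑ _i : Fin d, ∑ _j : Fin d, (ε + 2 * ‖η‖ * b * C * V) :=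
            Finset.sum_le_sum fun i _ => Finset.sum_le_sum fun j _ => hvar i j
        _ = _ := by
            simp only [Finset.sum_const, Finset.card_univ, Fintype.card_fin, nsmul_eq_mul]
            ring
    have s2 : d ^ 2 * (2 * ‖η‖ * b * C) * V ≤ ‖z‖ / 2 * V := mul_le_mul_of_nonneg_right hz hV0
    nlinarith
  -- The quadratic term in the fluctuation.
  have hq : ∀ ω, ‖(η (Φ ω) * Φ ω) i j‖ ≤ ‖η‖ * (C * v ω) := by
    intro ω
    refine (norm_entry_le _ _ _).trans ((norm_mul_le _ _).trans ?_)
    calc _ ≤ ‖η‖ * ‖Φ ω‖ * ‖Φ ω‖ := mul_le_mul_of_nonneg_right (hηle _) (norm_nonneg _)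
      _ = ‖η‖ * ‖Φ ω‖ ^ 2 := by ring
      _ ≤ _ := mul_le_mul_of_nonneg_left (hC _) (norm_nonneg _)
  have hqm : AEStronglyMeasurable (fun ω => (η (Φ ω) * Φ ω) i j) P :=
    entm i j _ (hηΦ.mul hΦi.1)
  have hqi : Integrable (fun ω => (η (Φ ω) * Φ ω) i j) P :=
    ((hvi.const_mul C).const_mul ‖η‖).mono' hqm (ae_of_all _ hq)
  have hqint : ‖∫ ω, (η (Φ ω) * Φ ω) i j ∂P‖ ≤ ‖η‖ * (C * V) := by
    rw [hV, ← integral_const_mul, ← integral_const_mul]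
    exact norm_integral_le_of_norm_le ((hvi.const_mul _).const_mul _) (ae_of_all _ hq)
  let ℓ : Matrix (Fin d) (Fin d) ℂ →L[ℂ] ℂ := (ent i j).comp
    (z • ContinuousLinearMap.id ℂ _ - (ContinuousLinearMap.mul ℂ _).flip h ∘L η
      - ContinuousLinearMap.mul ℂ _ (η h))
  have hℓ : ∀ M, ℓ M = (z • M - η M * h - η h * M) i j := fun M => rfl
  have hpt : ∀ ω, (z • H ω - 1 - η (H ω) * H ω) i j =
      (z • h - 1 - η h * h) i j + ℓ (Φ ω) - (η (Φ ω) * Φ ω) i j := by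
    intro ω
    rw [hℓ]
    have : z • H ω - 1 - η (H ω) * H ω = (z • h - 1 - η h * h)
        + (z • Φ ω - η (Φ ω) * h - η h * Φ ω) - η (Φ ω) * Φ ω := by
      simp only [hΦ, map_sub, sub_mul, mul_sub, smul_sub]
      abel
    rw [this]; rfl
  have hfin : (z • h - 1 - η h * h) i j =
      ∫ ω, (z • H ω - 1 - η (H ω) * H ω) i j ∂P + ∫ ω, (η (Φ ω) * Φ ω) i j ∂P := by
    rw [(integral_congr_ae (ae_of_all _ hpt)).trans
      (split3 _ _ _ (integrable_const _) (lin0 ℓ).1 hqi), (lin0 ℓ).2]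
    simp
  rw [hfin]
  refine (norm_add_le _ _).trans (add_le_add (h1 i j) (hqint.trans ?_))
  exact mul_le_mul_of_nonneg_left (mul_le_mul_of_nonneg_left hVle hC0) (norm_nonneg _)

end Concentration

section ExpectedGreen

open scoped Matrix.Norms.L2Operator
open scoped ComplexConjugate

theorem exists_norm_le_sum_norm_entry (d : ℕ) : ∃ C : ℝ, 0 ≤ C ∧
    ∀ M : Matrix (Fin d) (Fin d) ℂ, ‖M‖ ≤ C * ∑ i, ∑ j, ‖M i j‖ := by
  refine ⟨∑ i : Fin d, ∑ j : Fin d, ‖Matrix.single i j (1 : ℂ)‖,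
    Finset.sum_nonneg fun _ _ => Finset.sum_nonneg fun _ _ => norm_nonneg _, fun M => ?_⟩
  conv_lhs => rw [Matrix.matrix_eq_sum_single M]
  rw [Finset.mul_sum]
  refine (norm_sum_le _ _).trans (Finset.sum_le_sum fun i _ => ?_)
  rw [Finset.mul_sum]
  refine (norm_sum_le _ _).trans (Finset.sum_le_sum fun j _ => ?_)
  have : Matrix.single i j (M i j) = M i j • Matrix.single i j (1 : ℂ) := by
    rw [Matrix.smul_single, smul_eq_mul, mul_one]
  rw [this, norm_smul, mul_comm]
  refine mul_le_mul_of_nonneg_right ?_ (norm_nonneg _)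
  exact (Finset.single_le_sum (f := fun j => ‖Matrix.single i j (1 : ℂ)‖)
    (fun _ _ => norm_nonneg _) (Finset.mem_univ j)).trans
    (Finset.single_le_sum (f := fun i => ∑ j, ‖Matrix.single i j (1 : ℂ)‖)
      (fun _ _ => Finset.sum_nonneg fun _ _ => norm_nonneg _) (Finset.mem_univ i))

theorem norm_sq_le_of_norm_le_sum {d : ℕ} {C : ℝ}
    (hC : ∀ M : Matrix (Fin d) (Fin d) ℂ, ‖M‖ ≤ C * ∑ i, ∑ j, ‖M i j‖)
    (M : Matrix (Fin d) (Fin d) ℂ) : ‖M‖ ^ 2 ≤ (C ^ 2 * d ^ 2) * ∑ i, ∑ j, ‖M i j‖ ^ 2 := by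
  have h1 : (∑ i, ∑ j, ‖M i j‖) ^ 2 ≤ d ^ 2 * ∑ i, ∑ j, ‖M i j‖ ^ 2 := by
    rw [← Finset.univ.sum_product' Finset.univ (fun i j => ‖M i j‖),
      ← Finset.univ.sum_product' Finset.univ (fun i j => ‖M i j‖ ^ 2)]
    refine sq_sum_le_card_mul_sum_sq.trans (le_of_eq ?_)
    simp [pow_two]
  calc ‖M‖ ^ 2 ≤ (C * ∑ i, ∑ j, ‖M i j‖) ^ 2 := pow_le_pow_left₀ (norm_nonneg _) (hC M) 2
    _ = C ^ 2 * (∑ i, ∑ j, ‖M i j‖) ^ 2 := by ring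
    _ ≤ C ^ 2 * (d ^ 2 * ∑ i, ∑ j, ‖M i j‖ ^ 2) := mul_le_mul_of_nonneg_left h1 (sq_nonneg _)
    _ = _ := by ring

theorem norm_le_of_entry_le {d : ℕ} {C : ℝ} (hC0 : 0 ≤ C)
    (hC : ∀ M : Matrix (Fin d) (Fin d) ℂ, ‖M‖ ≤ C * ∑ i, ∑ j, ‖M i j‖)
    {M : Matrix (Fin d) (Fin d) ℂ} {b : ℝ} (hb : ∀ i j, ‖M i j‖ ≤ b) : ‖M‖ ≤ C * (d ^ 2 * b) := by
  refine (hC M).trans (mul_le_mul_of_nonneg_left ?_ hC0)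
  refine (Finset.sum_le_sum fun i _ => Finset.sum_le_sum fun j _ => hb i j).trans (le_of_eq ?_)
  simp only [Finset.sum_const, Finset.card_univ, Fintype.card_fin, nsmul_eq_mul]
  ring

variable {d : ℕ} {N : Fin d → ℕ}

/-- `blockGreen` as a continuous linear map. -/
def blockGreenCLM (N : Fin d → ℕ) (α : Fin d → ℝ) :
    Matrix (BlockIndex N) (BlockIndex N) ℂ →L[ℂ] Matrix (Fin d) (Fin d) ℂ :=
  LinearMap.toContinuousLinearMap
    { toFun := blockGreen α
      map_add' := fun D E => by
        ext i j
        rw [Matrix.add_apply]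
        simp only [← blockGreenFunctional_apply, map_add]
      map_smul' := fun c D => by
        ext i j
        rw [Matrix.smul_apply]
        simp only [← blockGreenFunctional_apply, map_smul, RingHom.id_apply] }

theorem trWeighted_blockGreen {α : Fin d → ℝ} (hα : ∀ i, 0 < α i)
    (M : Matrix (BlockIndex N) (BlockIndex N) ℂ) :
    trWeighted α (blockGreen α M) = (totalSize N)⁻¹ * M.trace := by
  have h1 : ∑ i, blockUnit N i i = 1 := by
    ext ⟨p1, p2⟩ ⟨q1, q2⟩
    rw [Matrix.sum_apply, Finset.sum_eq_single p1]
    · simp only [blockUnit, Matrix.of_apply, Matrix.one_apply, true_and]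
      by_cases h1 : p1 = q1
      · subst h1
        by_cases h2 : p2 = q2
        · subst h2; simp
        · have : (p2 : ℕ) ≠ q2 := fun h => h2 (Fin.ext h)
          simp [h2, this]
      · have h3 : (⟨p1, p2⟩ : BlockIndex N) ≠ ⟨q1, q2⟩ := fun h => h1 (congrArg Sigma.fst h)
        rw [if_neg (fun h => h1 h.1.symm), if_neg h3]
    · intro b _ hb
      simp [blockUnit, hb.symm]
    · simp
  have h2 : ∀ i, (α i : ℂ) * blockGreen α M i i = (totalSize N)⁻¹ * (blockUnit N i i * M).trace := by
    intro i
    have : (α i : ℂ) ≠ 0 := by exact_mod_cast (hα i).ne'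
    simp only [blockGreen, Matrix.of_apply, if_true, blockTrace]
    rw [← mul_assoc, mul_inv_cancel₀ this, one_mul]
  simp only [trWeighted, h2]
  rw [← Finset.mul_sum, ← Matrix.trace_sum, ← Matrix.sum_mul, h1, one_mul]

variable {Ω : Type*} [MeasurableSpace Ω] {P : Measure Ω}
  {σ : Fin d → Fin d → Fin d → Fin d → ℂ}
  {A : (i j : Fin d) → Ω → Matrix (Fin (N i)) (Fin (N j)) ℂ}

theorem IsGaussianBlockModel.integrable_comp_resolvent (hA : IsGaussianBlockModel σ P A) {z : ℂ}
    (hz : z.im ≠ 0) {F : Type*} [NormedAddCommGroup F] [SecondCountableTopology F]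
    {g : Matrix (BlockIndex N) (BlockIndex N) ℂ → F} (hg : Continuous g) :
    Integrable (fun ω => g (matrixResolvent z (blockMatrix fun i j => A i j ω))) P := by
  have := hA.gaussian.isProbabilityMeasure
  have : ProperSpace (Matrix (BlockIndex N) (BlockIndex N) ℂ) := FiniteDimensional.proper ℂ _
  obtain ⟨C, hC⟩ := ((isCompact_closedBall (0 : Matrix (BlockIndex N) (BlockIndex N) ℂ)
    |z.im|⁻¹).exists_bound_of_continuousOn hg.continuousOn)
  refine Integrable.of_bound (aestronglyMeasurable_comp_of_continuousOn
    (Φ := fun X => g (matrixResolvent z X)) hA.isHermitian hA.gaussian.aemeasurable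
    (hg.comp_continuousOn (continuousOn_matrixResolvent hz))) C (ae_of_all _ fun ω => hC _ ?_)
  rw [mem_closedBall_zero_iff]
  exact norm_matrixResolvent_le (hA.isHermitian ω) hz

/-- The expectation of the matrix of block traces of the resolvent. -/
def expectedGreen (α : Fin d → ℝ) (P : Measure Ω)
    (A : (i j : Fin d) → Ω → Matrix (Fin (N i)) (Fin (N j)) ℂ) (z : ℂ) :
    Matrix (Fin d) (Fin d) ℂ :=
  ∫ ω, blockGreen α (matrixResolvent z (blockMatrix fun i j => A i j ω)) ∂P

theorem IsGaussianBlockModel.map_expectedGreen (hA : IsGaussianBlockModel σ P A)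
    (α : Fin d → ℝ) {z : ℂ} (hz : z.im ≠ 0) (ℓ : Matrix (Fin d) (Fin d) ℂ →ₗ[ℂ] ℂ) :
    ℓ (expectedGreen α P A z)
      = ∫ ω, ℓ (blockGreen α (matrixResolvent z (blockMatrix fun i j => A i j ω))) ∂P :=
  ((LinearMap.toContinuousLinearMap ℓ).integral_comp_comm
    (hA.integrable_comp_resolvent hz (blockGreenCLM N α).continuous)).symm

theorem IsGaussianBlockModel.expectedGreen_apply (hA : IsGaussianBlockModel σ P A)
    (α : Fin d → ℝ) {z : ℂ} (hz : z.im ≠ 0) (i j : Fin d) :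
    expectedGreen α P A z i j
      = ∫ ω, blockGreen α (matrixResolvent z (blockMatrix fun i j => A i j ω)) i j ∂P :=
  hA.map_expectedGreen α hz (Matrix.entryLinearMap ℂ ℂ i j)

theorem IsGaussianBlockModel.expectedGreen_mem (hA : IsGaussianBlockModel σ P A)
    (α : Fin d → ℝ) {z : ℂ} (hz : z.im ≠ 0) : expectedGreen α P A z ∈ weightedMatrices α := by
  intro i j hij
  rw [hA.expectedGreen_apply α hz]
  simp [blockGreen_mem α _ i j hij]

theorem IsGaussianBlockModel.trWeighted_expectedGreen (hA : IsGaussianBlockModel σ P A)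
    {α : Fin d → ℝ} (hα : ∀ i, 0 < α i) {z : ℂ} (hz : z.im ≠ 0) :
    trWeighted α (expectedGreen α P A z) =
      ∫ ω, (totalSize N)⁻¹ * (matrixResolvent z (blockMatrix fun i j => A i j ω)).trace ∂P := by
  have h := hA.map_expectedGreen α hz
    (∑ i, (α i : ℂ) • Matrix.entryLinearMap ℂ ℂ i i)
  have e : ∀ M : Matrix (Fin d) (Fin d) ℂ,
      (∑ i, (α i : ℂ) • Matrix.entryLinearMap ℂ ℂ i i : Matrix (Fin d) (Fin d) ℂ →ₗ[ℂ] ℂ) M =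
        trWeighted α M := fun M => by
    simp [trWeighted, LinearMap.sum_apply]
  simpa only [e, trWeighted_blockGreen hα] using h

theorem IsGaussianBlockModel.norm_expectedGreen_apply_le (hA : IsGaussianBlockModel σ P A)
    {α : Fin d → ℝ} (hα : ∀ i, 0 < α i) {z : ℂ} (hz : z.im ≠ 0) (i j : Fin d) :
    ‖expectedGreen α P A z i j‖ ≤ (∑ i, (α i)⁻¹) * |z.im|⁻¹ := by
  have := hA.gaussian.isProbabilityMeasure
  rw [hA.expectedGreen_apply α hz]
  have h0 : 0 ≤ ∑ i, (α i)⁻¹ := Finset.sum_nonneg fun i _ => (inv_pos.2 (hα i)).le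
  refine (norm_integral_le_of_norm_le_const (ae_of_all _ fun ω =>
    (norm_blockGreen_apply_le hα _ i j).trans (mul_le_mul_of_nonneg_left
      (norm_matrixResolvent_le (hA.isHermitian ω) hz) h0))).trans ?_
  simp

theorem IsGaussianBlockModel.differentiableOn_expectedGreen (hA : IsGaussianBlockModel σ P A)
    (α : Fin d → ℝ) : DifferentiableOn ℂ (expectedGreen α P A) upperHalf := by
  have := hA.gaussian.isProbabilityMeasure
  intro z hz
  have hz0 : 0 < z.im := hz
  set L := blockGreenCLM N α with hL
  have him : ∀ w ∈ Metric.ball z (z.im / 2), z.im / 2 < w.im := by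
    intro w hw
    rw [Metric.mem_ball, dist_eq_norm] at hw
    have h1 := (abs_le.1 ((Complex.abs_im_le_norm (w - z)).trans hw.le)).1
    have h2 : |(w - z).im| < z.im / 2 := (Complex.abs_im_le_norm (w - z)).trans_lt hw
    have h3 := (abs_lt.1 h2).1
    rw [Complex.sub_im] at h3
    linarith
  have hne : ∀ w ∈ Metric.ball z (z.im / 2), w.im ≠ 0 := fun w hw => by
    have := him w hw; linarith
  have hmem : Metric.ball z (z.im / 2) ∈ 𝓝 z := Metric.ball_mem_nhds _ (by linarith)
  have key := hasDerivAt_integral_of_dominated_loc_of_deriv_le (μ := P) (𝕜 := ℂ)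
    (F := fun w ω => L (matrixResolvent w (blockMatrix fun i j => A i j ω)))
    (F' := fun w ω => L (-(matrixResolvent w (blockMatrix fun i j => A i j ω) *
      matrixResolvent w (blockMatrix fun i j => A i j ω))))
    (x₀ := z) (bound := fun _ => ‖L‖ * ((z.im / 2)⁻¹ * (z.im / 2)⁻¹)) hmem
    (by
      filter_upwards [hmem] with w hw
      exact (hA.integrable_comp_resolvent (hne w hw) L.continuous).1)
    (hA.integrable_comp_resolvent hz0.ne' L.continuous)
    (hA.integrable_comp_resolvent (g := fun R => L (-(R * R))) hz0.ne' (by fun_prop)).1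
    (ae_of_all _ fun ω w hw => by
      refine (L.le_opNorm _).trans (mul_le_mul_of_nonneg_left ?_ (norm_nonneg _))
      rw [norm_neg]
      have hR : ‖matrixResolvent w (blockMatrix fun i j => A i j ω)‖ ≤ (z.im / 2)⁻¹ := by
        refine (norm_matrixResolvent_le (hA.isHermitian ω) (hne w hw)).trans ?_
        refine inv_anti₀ (by linarith) ?_
        exact (him w hw).le.trans (le_abs_self _)
      exact (norm_mul_le _ _).trans (mul_le_mul hR hR (norm_nonneg _) (by positivity)))
    (integrable_const _)
    (ae_of_all _ fun ω w hw =>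
      L.hasFDerivAt.comp_hasDerivAt w (hasDerivAt_matrixResolvent (hA.isHermitian ω) (hne w hw)))
  exact key.2.differentiableAt.differentiableWithinAt

/-- In the half-plane `Im z ≥ Y` the expected block traces satisfy the equation
`z G = 1 + η_α(G) G` up to a multiple of the discrepancy between `N / n` and `α`. -/
theorem exists_norm_equation_expectedGreen_le {α : Fin d → ℝ} (hα : ∀ i, 0 < α i)
    (hσ : ∀ i j k l, σ i j k l ≠ 0 → α i = α l ∧ α j = α k) :
    ∃ Y : ℝ, 0 < Y ∧ ∃ C : ℝ, 0 ≤ C ∧ ∀ z : ℂ, Y ≤ z.im → ∀ (N : Fin d → ℕ) {Ω : Type*}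
      [MeasurableSpace Ω] (P : Measure Ω)
      (A : (i j : Fin d) → Ω → Matrix (Fin (N i)) (Fin (N j)) ℂ), IsGaussianBlockModel σ P A →
      ‖z • expectedGreen α P A z - 1
        - etaCLM α σ (expectedGreen α P A z) * expectedGreen α P A z‖ ≤ C * discrepancy α N := by
  obtain ⟨C₁, hC₁0, hC₁⟩ := exists_norm_le_sum_norm_entry d
  obtain ⟨S, hS0, hS⟩ : ∃ S : ℝ, 0 ≤ S ∧ ∀ i j k l, ‖σ i j k l‖ ≤ S := by
    refine ⟨∑ i, ∑ j, ∑ k, ∑ l, ‖σ i j k l‖, by positivity, fun i j k l => ?_⟩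
    refine (Finset.single_le_sum (f := fun l => ‖σ i j k l‖)
      (fun _ _ => norm_nonneg _) (Finset.mem_univ l)).trans ?_
    refine (Finset.single_le_sum (f := fun k => ∑ l, ‖σ i j k l‖)
      (fun _ _ => by positivity) (Finset.mem_univ k)).trans ?_
    refine (Finset.single_le_sum (f := fun j => ∑ k, ∑ l, ‖σ i j k l‖)
      (fun _ _ => by positivity) (Finset.mem_univ j)).trans ?_
    exact Finset.single_le_sum (f := fun i => ∑ j, ∑ k, ∑ l, ‖σ i j k l‖)
      (fun _ _ => by positivity) (Finset.mem_univ i)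
  obtain ⟨β, hβ⟩ : ∃ β : ℝ, β = ∑ i, (α i)⁻¹ := ⟨_, rfl⟩
  have hβ0 : 0 ≤ β := hβ ▸ Finset.sum_nonneg fun i _ => (inv_pos.2 (hα i)).le
  have hβi : ∀ i, (α i)⁻¹ ≤ β := fun i => hβ ▸
    Finset.single_le_sum (f := fun i => (α i)⁻¹) (fun i _ => (inv_pos.2 (hα i)).le)
      (Finset.mem_univ i)
  set η := etaCLM α σ with hη
  obtain ⟨C, hC⟩ : ∃ C : ℝ, C = C₁ ^ 2 * d ^ 2 := ⟨_, rfl⟩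
  have hC0 : 0 ≤ C := by rw [hC]; positivity
  obtain ⟨b, hb⟩ : ∃ b : ℝ, b = C₁ * (d ^ 2 * β) := ⟨_, rfl⟩
  have hb0 : 0 ≤ b := by rw [hb]; positivity
  obtain ⟨E, hE⟩ : ∃ E : ℝ, E = β * (d ^ 4 * S * β + (1 + 2 * d ^ 3 * S) * (1 + 2 * β)) := ⟨_, rfl⟩
  have hE0 : 0 ≤ E := by rw [hE]; positivity
  refine ⟨max 1 (2 * (d ^ 2 * (2 * ‖η‖ * b * C))), lt_max_of_lt_left one_pos,
    C₁ * (d ^ 2 * (E + ‖η‖ * (C * (2 * d ^ 2 * E)))), by positivity, ?_⟩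
  intro z hzY N Ω _ P A hA
  have := hA.gaussian.isProbabilityMeasure
  have hz1 : 1 ≤ z.im := (le_max_left _ _).trans hzY
  have hz0 : z.im ≠ 0 := by linarith
  have hnz : z.im ≤ ‖z‖ := (le_abs_self _).trans (Complex.abs_im_le_norm z)
  have hρ1 : |z.im|⁻¹ ≤ 1 := inv_le_one_of_one_le₀ (hz1.trans (le_abs_self _))
  set δ := discrepancy α N with hδ
  have hδ0 : 0 ≤ δ := discrepancy_nonneg α N
  set R : Ω → Matrix (BlockIndex N) (BlockIndex N) ℂ :=
    fun ω => matrixResolvent z (blockMatrix fun i j => A i j ω) with hR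
  have hRn : ∀ ω, ‖R ω‖ ≤ 1 := fun ω =>
    (norm_matrixResolvent_le (hA.isHermitian ω) hz0).trans hρ1
  set H : Ω → Matrix (Fin d) (Fin d) ℂ := fun ω => blockGreen α (R ω) with hH
  have hHe : ∀ ω i j, ‖H ω i j‖ ≤ β := fun ω i j =>
    (norm_blockGreen_apply_le hα _ i j).trans (hβ ▸ mul_le_of_le_one_right hβ0 (hRn ω))
  have hGc : Continuous fun M : Matrix (BlockIndex N) (BlockIndex N) ℂ => blockGreen α M :=
    (blockGreenCLM N α).continuous
  have hηc : Continuous fun M : Matrix (Fin d) (Fin d) ℂ => etaWeighted α σ M := η.continuous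
  have entc : ∀ i j, Continuous fun M : Matrix (Fin d) (Fin d) ℂ => M i j := fun i j =>
    continuous_id.matrix_elem i j
  have hFc : Continuous fun M : Matrix (BlockIndex N) (BlockIndex N) ℂ =>
      z • blockGreen α M - 1 - etaWeighted α σ (blockGreen α M) * blockGreen α M := by
    have := hηc.comp hGc
    exact ((hGc.const_smul z).sub continuous_const).sub (this.mul hGc)
  have hDc : ∀ i j, Continuous fun M : Matrix (BlockIndex N) (BlockIndex N) ℂ =>
      blockDefect σ z M i j := by
    intro i j
    unfold blockDefect
    fun_prop
  set h := expectedGreen α P A z with hh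
  have hh' : h = ∫ ω, H ω ∂P := rfl
  have hhe : ∀ i j, ‖h i j‖ ≤ β := fun i j =>
    (hA.norm_expectedGreen_apply_le hα hz0 i j).trans (hβ ▸ mul_le_of_le_one_right hβ0 hρ1)
  -- Testing the equation against a bounded function `Ψ` of the resolvent.
  have test : ∀ (i j : Fin d) (Ψ : Matrix (BlockIndex N) (BlockIndex N) ℂ → ℂ), Continuous Ψ →
      (∀ ω, ‖Ψ (R ω)‖ ≤ 1 + 2 * β) →
      ‖∫ ω, blockDefect σ z (R ω) i j * Ψ (R ω) ∂P‖ ≤ d ^ 4 * S * β * δ →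
      ‖∫ ω, (z • H ω - 1 - η (H ω) * H ω) i j * Ψ (R ω) ∂P‖ ≤ E * δ := by
    intro i j Ψ hΨc hΨ hdef
    by_cases hij : α i = α j
    · have hαi : (α i : ℂ) ≠ 0 := by exact_mod_cast (hα i).ne'
      set D : Ω → ℂ := fun ω => ((α i : ℂ) * (z • H ω - 1 - η (H ω) * H ω) i j
        - blockDefect σ z (R ω) i j) * Ψ (R ω) with hD
      have hDi : Integrable D P := hA.integrable_comp_resolvent hz0
        (g := fun M => ((α i : ℂ) * (z • blockGreen α M - 1
          - etaWeighted α σ (blockGreen α M) * blockGreen α M) i j - blockDefect σ z M i j) * Ψ M)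
        (((continuous_const.mul ((entc i j).comp hFc)).sub (hDc i j)).mul hΨc)
      have hBi : Integrable (fun ω => blockDefect σ z (R ω) i j * Ψ (R ω)) P :=
        hA.integrable_comp_resolvent hz0 (g := fun M => blockDefect σ z M i j * Ψ M)
        ((hDc i j).mul hΨc)
      have hDb : ∀ ω, ‖D ω‖ ≤ (1 + 2 * d ^ 3 * S) * δ * (1 + 2 * β) := by
        intro ω
        rw [hD, norm_mul]
        refine mul_le_mul ((norm_equation_sub_blockDefect_le hα hσ hS z (R ω) hij).trans ?_)
          (hΨ ω) (norm_nonneg _) (by positivity)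
        refine mul_le_mul_of_nonneg_right ?_ hδ0
        have : ‖R ω‖ ^ 2 ≤ 1 := pow_le_one₀ (norm_nonneg _) (hRn ω)
        have := mul_le_of_le_one_right (by positivity : 0 ≤ 2 * (d : ℝ) ^ 3 * S) this
        linarith
      have hDint : ‖∫ ω, D ω ∂P‖ ≤ (1 + 2 * d ^ 3 * S) * δ * (1 + 2 * β) := by
        refine (norm_integral_le_of_norm_le_const (ae_of_all _ hDb)).trans ?_
        simp
      have e : ∫ ω, (z • H ω - 1 - η (H ω) * H ω) i j * Ψ (R ω) ∂P = (α i : ℂ)⁻¹ *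
          (∫ ω, D ω ∂P + ∫ ω, blockDefect σ z (R ω) i j * Ψ (R ω) ∂P) := by
        rw [← integral_add hDi hBi, ← integral_const_mul]
        refine integral_congr_ae (ae_of_all _ fun ω => ?_)
        simp only [hD]
        field_simp
        ring
      rw [e, norm_mul, norm_inv, Complex.norm_real, Real.norm_of_nonneg (hα i).le]
      calc _ ≤ β * ((1 + 2 * d ^ 3 * S) * δ * (1 + 2 * β) + d ^ 4 * S * β * δ) :=
            mul_le_mul (hβi i) ((norm_add_le _ _).trans (add_le_add hDint hdef))
              (norm_nonneg _) hβ0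
        _ = E * δ := by rw [hE]; ring
    · have h0 : ∀ ω, (z • H ω - 1 - η (H ω) * H ω) i j = 0 := by
        intro ω
        have h1 : H ω i j = 0 := blockGreen_mem α (R ω) i j hij
        have h2 : (η (H ω) * H ω) i j = 0 := by
          rw [Matrix.mul_apply]
          refine Finset.sum_eq_zero fun k _ => ?_
          by_cases hk : α i = α k
          · have : H ω k j = 0 := blockGreen_mem α (R ω) k j (hk ▸ hij)
            rw [this, mul_zero]
          · have : η (H ω) i k = 0 := etaWeighted_mem α σ hσ (H ω) i k hk
            rw [this, zero_mul]
        have h3 : i ≠ j := fun h => hij (h ▸ rfl)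
        rw [Matrix.sub_apply, Matrix.sub_apply, Matrix.smul_apply, h1, h2, Matrix.one_apply_ne h3]
        simp
      simp only [h0, zero_mul, integral_zero, norm_zero]
      positivity
  have t1 : ∀ i j, ‖∫ ω, (z • H ω - 1 - η (H ω) * H ω) i j ∂P‖ ≤ E * δ := by
    intro i j
    have := test i j (fun _ => 1) continuous_const (fun ω => by rw [norm_one]; linarith) (by
      simp only [mul_one]
      rw [hA.integral_blockDefect hz0, norm_zero]
      positivity)
    simpa only [mul_one] using this
  have t2 : ∀ i j, ‖∫ ω, (z • H ω - 1 - η (H ω) * H ω) i j *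
      conj (H ω i j - (∫ ω', H ω' ∂P) i j) ∂P‖ ≤ E * δ := by
    intro i j
    rw [← hh']
    refine test i j (fun M => conj (blockGreen α M i j - h i j)) ?_ (fun ω => ?_) ?_
    · exact Complex.continuous_conj.comp (((entc i j).comp hGc).sub continuous_const)
    · rw [RCLike.norm_conj]
      refine (norm_sub_le _ _).trans ?_
      linarith [hHe ω i j, hhe i j]
    · have e : ∀ ω, blockDefect σ z (R ω) i j * conj (blockGreen α (R ω) i j - h i j) =
          blockDefect σ z (R ω) i j *
            blockGreen α (matrixResolvent (conj z) (blockMatrix fun i j => A i j ω)) j i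
          - blockDefect σ z (R ω) i j * conj (h i j) := by
        intro ω
        rw [map_sub, conj_blockGreen_matrixResolvent α (hA.isHermitian ω), mul_sub]
      have hi1 : Integrable (fun ω => blockDefect σ z (R ω) i j *
            blockGreen α (matrixResolvent (conj z) (blockMatrix fun i j => A i j ω)) j i) P := by
        have := hA.integrable_comp_resolvent hz0
          (g := fun M => blockDefect σ z M i j * conj (blockGreen α M i j))
          ((hDc i j).mul (Complex.continuous_conj.comp ((entc i j).comp hGc)))
        simpa only [conj_blockGreen_matrixResolvent α (hA.isHermitian _)] using this
      have hi2 : Integrable (fun ω => blockDefect σ z (R ω) i j * conj (h i j)) P :=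
        (hA.integrable_comp_resolvent hz0 (hDc i j)).mul_const _
      rw [integral_congr_ae (ae_of_all _ e), integral_sub hi1 hi2, integral_mul_const,
        hA.integral_blockDefect hz0, zero_mul, sub_zero]
      refine (hA.norm_integral_blockDefect_mul_le hα hS hz0 i j j i).trans ?_
      rw [← hβ, mul_assoc]
      refine (mul_le_mul_of_nonneg_left (mul_le_of_le_one_left hδ0
        (pow_le_one₀ (by positivity) hρ1)) (by positivity)).trans_eq ?_
      ring
  have hHm : AEStronglyMeasurable H P := (hA.integrable_comp_resolvent hz0 hGc).1
  have hfin := norm_equation_integral_le hHm (b := b)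
    (fun ω => hb ▸ norm_le_of_entry_le hC₁0 hC₁ (hHe ω)) η hC0 (hC ▸ norm_sq_le_of_norm_le_sum hC₁)
    t1 t2
    (hz1.trans hnz) (by
      have := (le_max_right _ _).trans (hzY.trans hnz)
      linarith)
  refine (norm_le_of_entry_le hC₁0 hC₁ hfin).trans (le_of_eq ?_)
  ring

end ExpectedGreen

/-! ### The equation `z G = 1 + η(G) G` on the upper half-plane -/

section Equation

theorem isOpen_upperHalf : IsOpen upperHalf := isOpen_lt continuous_const Complex.continuous_im

theorem isPreconnected_upperHalf : IsPreconnected upperHalf :=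
  (convex_halfSpace_im_gt 0).isPreconnected

variable {𝔸 : Type*} [NormedRing 𝔸] [NormedAlgebra ℂ 𝔸] (η : 𝔸 →L[ℂ] 𝔸)

/-- The three lines theorem on a horizontal strip, for a function which is bounded by `a` on the
closed strip. -/
theorem norm_le_rpow_mul_rpow_of_im {E : Type*} [NormedAddCommGroup E] [NormedSpace ℂ E]
    {f : ℂ → E} {l u a b : ℝ} (hlu : l < u) (hf : DifferentiableOn ℂ f {z | l ≤ z.im})
    (ha : ∀ z : ℂ, l ≤ z.im → z.im ≤ u → ‖f z‖ ≤ a) (hb : ∀ z : ℂ, z.im = u → ‖f z‖ ≤ b)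
    {z : ℂ} (hz : l ≤ z.im) (hz' : z.im ≤ u) :
    ‖f z‖ ≤ a ^ (1 - (z.im - l) / (u - l)) * b ^ ((z.im - l) / (u - l)) := by
  have him : ∀ w : ℂ, (Complex.I * w).im = w.re := fun w => by simp
  have hdiff : DifferentiableOn ℂ (fun w => f (Complex.I * w)) (Complex.re ⁻¹' Set.Icc l u) := by
    refine hf.comp (by fun_prop) fun w hw => ?_
    simp only [Set.mem_ofPred_eq, him]
    exact hw.1
  have hcl : closure (Complex.HadamardThreeLines.verticalStrip l u) ⊆ Complex.re ⁻¹' Set.Icc l u :=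
    closure_minimal (fun w hw => ⟨hw.1.le, hw.2.le⟩) (isClosed_Icc.preimage Complex.continuous_re)
  have key := Complex.HadamardThreeLines.norm_le_interp_of_mem_verticalClosedStrip'
    (f := fun w => f (Complex.I * w)) (z := -Complex.I * z) (a := a) (b := b) hlu
    (by
      change (-Complex.I * z).re ∈ Set.Icc l u
      simpa using ⟨hz, hz'⟩)
    (hdiff.mono hcl).diffContOnCl
    ⟨a, by
      rintro _ ⟨w, hw, rfl⟩
      exact ha _ (by rw [him]; exact hw.1) (by rw [him]; exact hw.2)⟩
    (fun w hw => by
      have hw' : w.re = l := hw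
      exact ha _ (by rw [him, hw']) (by rw [him, hw']; exact hlu.le))
    (fun w hw => hb _ (by rw [him]; exact hw))
  have e1 : Complex.I * (-Complex.I * z) = z := by
    rw [← mul_assoc, mul_neg, Complex.I_mul_I, neg_neg, one_mul]
  have e2 : (-Complex.I * z).re = z.im := by simp
  simpa only [e1, e2] using key

/-- Two approximate solutions which are small compared to `z` are close to each other. -/
theorem norm_sub_le_of_approx {z : ℂ} {g g' : 𝔸} {ε ε' b : ℝ} (hg : ‖g‖ ≤ b) (hg' : ‖g'‖ ≤ b)
    (h : ‖z • g - 1 - η g * g‖ ≤ ε) (h' : ‖z • g' - 1 - η g' * g'‖ ≤ ε')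
    (hz : 1 + 2 * ‖η‖ * b ≤ ‖z‖) : ‖g - g'‖ ≤ ε + ε' := by
  have e : z • (g - g') = (z • g - 1 - η g * g) - (z • g' - 1 - η g' * g')
      + (η (g - g') * g + η g' * (g - g')) := by
    simp only [map_sub, sub_mul, mul_sub, smul_sub]
    abel
  have hb : 0 ≤ b := (norm_nonneg _).trans hg
  have h1 : ‖η (g - g') * g‖ ≤ ‖η‖ * ‖g - g'‖ * b := (norm_mul_le _ _).trans
    (mul_le_mul (η.le_opNorm _) hg (norm_nonneg _) (by positivity))
  have h2 : ‖η g' * (g - g')‖ ≤ ‖η‖ * b * ‖g - g'‖ := (norm_mul_le _ _).trans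
    (mul_le_mul_of_nonneg_right ((η.le_opNorm _).trans
      (mul_le_mul_of_nonneg_left hg' (norm_nonneg _))) (norm_nonneg _))
  have h3 : ‖z‖ * ‖g - g'‖ ≤ (ε + ε') + (‖η‖ * ‖g - g'‖ * b + ‖η‖ * b * ‖g - g'‖) := by
    rw [← norm_smul, e]
    exact (norm_add_le _ _).trans (add_le_add ((norm_sub_le _ _).trans (add_le_add h h'))
      ((norm_add_le _ _).trans (add_le_add h1 h2)))
  have h4 := mul_le_mul_of_nonneg_right hz (norm_nonneg (g - g'))
  linarith

/-- Approximate solutions on a half-plane `Im z ≥ Y` which are holomorphic and bounded by `B / Im z`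
on the whole upper half-plane converge there to a holomorphic solution. High up they are Cauchy
because the equation is contractive; the three lines theorem propagates this downwards. -/
theorem exists_tendsto_of_approx [CompleteSpace 𝔸] {h : ℕ → ℂ → 𝔸} {B Y : ℝ} {e : ℕ → ℝ}
    (hd : ∀ m, DifferentiableOn ℂ (h m) upperHalf)
    (hb : ∀ m z, z ∈ upperHalf → ‖h m z‖ ≤ B / z.im) (he : Tendsto e atTop (𝓝 0))
    (heq : ∀ m z, Y ≤ z.im → ‖z • h m z - 1 - η (h m z) * h m z‖ ≤ e m) :
    ∃ G : ℂ → 𝔸, DifferentiableOn ℂ G upperHalf ∧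
      (∀ z ∈ upperHalf, Tendsto (fun m => h m z) atTop (𝓝 (G z))) ∧
      ∀ z ∈ upperHalf, z • G z = 1 + η (G z) * G z := by
  have hB : 0 ≤ B := by
    have := (norm_nonneg _).trans (hb 0 Complex.I (by simp [upperHalf]))
    simpa using this
  set u : ℝ := max 1 (max Y (1 + 2 * ‖η‖ * B)) with hu
  have hu1 : 1 ≤ u := le_max_left _ _
  have huY : Y ≤ u := (le_max_left _ _).trans (le_max_right _ _)
  have huB : 1 + 2 * ‖η‖ * B ≤ u := (le_max_right _ _).trans (le_max_right _ _)
  have hup : ∀ m n (z : ℂ), u ≤ z.im → ‖h m z - h n z‖ ≤ e m + e n := by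
    intro m n z hz
    have hz0 : 1 ≤ z.im := hu1.trans hz
    have hzU : z ∈ upperHalf := by change 0 < z.im; linarith
    have hbz : ∀ m, ‖h m z‖ ≤ B := fun m => (hb m z hzU).trans (div_le_self hB hz0)
    refine norm_sub_le_of_approx η (hbz m) (hbz n) (heq m z (huY.trans hz))
      (heq n z (huY.trans hz)) ?_
    exact (huB.trans hz).trans ((le_abs_self _).trans (Complex.abs_im_le_norm z))
  have hcauchy : ∀ τ : ℝ, 0 < τ → τ < 1 / 2 →
      UniformCauchySeqOn h atTop {z | 2 * τ < z.im} := by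
    intro τ hτ hτ1
    rw [Metric.uniformCauchySeqOn_iff]
    intro ε hε
    have hlu : τ < u := by linarith
    set a : ℝ := max 1 (2 * (B / τ)) with ha
    have ha1 : 1 ≤ a := le_max_left _ _
    have ha0 : 0 < a := by linarith
    set t₀ : ℝ := τ / (u - τ) with ht₀
    have ht₀0 : 0 < t₀ := div_pos hτ (by linarith)
    obtain ⟨b, hb0, hb1, hbε⟩ : ∃ b : ℝ, 0 < b ∧ b ≤ 1 ∧ a * b ^ t₀ < ε ∧ b < ε := by
      have hlim : Tendsto (fun b : ℝ => a * b ^ t₀) (𝓝[>] 0) (𝓝 0) := by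
        have := ((Real.continuousAt_rpow_const 0 t₀ (Or.inr ht₀0.le)).tendsto.const_mul a)
        rw [Real.zero_rpow ht₀0.ne', mul_zero] at this
        exact this.mono_left nhdsWithin_le_nhds
      have h1 := hlim.eventually (gt_mem_nhds hε)
      have h2 : ∀ᶠ b : ℝ in 𝓝[>] 0, b ∈ Set.Ioo 0 (min 1 ε) :=
        Ioo_mem_nhdsGT (lt_min one_pos hε)
      obtain ⟨b, hb, hb'⟩ := (h1.and h2).exists
      exact ⟨b, hb'.1, (hb'.2.trans_le (min_le_left _ _)).le, hb,
        hb'.2.trans_le (min_le_right _ _)⟩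
    obtain ⟨n₀, hn₀⟩ := eventually_atTop.1 (he.eventually (gt_mem_nhds (half_pos hb0)))
    refine ⟨n₀, fun m hm n hn z hz => ?_⟩
    have hz' : 2 * τ < z.im := hz
    rw [dist_eq_norm]
    have hsmall : e m + e n ≤ b := by linarith [hn₀ m hm, hn₀ n hn]
    rcases le_total u z.im with huz | hzu
    · exact ((hup m n z huz).trans hsmall).trans_lt hbε.2
    have hbd : ∀ w : ℂ, τ ≤ w.im → ∀ m, ‖h m w‖ ≤ B / τ := fun w hw m =>
      (hb m w (hτ.trans_le hw)).trans (div_le_div_of_nonneg_left hB hτ hw)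
    have hsub : {w : ℂ | τ ≤ w.im} ⊆ upperHalf := fun w hw => hτ.trans_le hw
    have h3 := norm_le_rpow_mul_rpow_of_im (f := fun w => h m w - h n w) (a := a) (b := b) hlu
      (((hd m).sub (hd n)).mono hsub)
      (fun w hw _ => by
        refine (norm_sub_le _ _).trans ((add_le_add (hbd w hw m) (hbd w hw n)).trans ?_)
        rw [← two_mul]; exact le_max_right _ _)
      (fun w hw => (hup m n w hw.ge).trans hsmall) (z := z) (by linarith) hzu
    refine h3.trans_lt (lt_of_le_of_lt ?_ hbε.1)
    have hul : 0 < u - τ := by linarith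
    have ht : t₀ ≤ (z.im - τ) / (u - τ) := by
      rw [ht₀]; exact div_le_div_of_nonneg_right (by linarith) hul.le
    refine mul_le_mul ?_ (Real.rpow_le_rpow_of_exponent_ge hb0 hb1 ht) (by positivity) ha0.le
    refine (Real.rpow_le_rpow_of_exponent_le ha1 (y := 1 - (z.im - τ) / (u - τ)) (z := 1) ?_).trans
      (by rw [Real.rpow_one])
    linarith
  have hlim : ∀ z ∈ upperHalf, ∃ g, Tendsto (fun m => h m z) atTop (𝓝 g) := by
    intro z hz
    have hz0 : 0 < z.im := hz
    have h1 : 0 < min (z.im / 4) (1 / 4) := by positivity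
    have h2 := hcauchy (min (z.im / 4) (1 / 4)) h1 ((min_le_right _ _).trans_lt (by norm_num))
    refine cauchySeq_tendsto_of_complete (h2.cauchySeq ?_)
    change 2 * min (z.im / 4) (1 / 4) < z.im
    linarith [min_le_left (z.im / 4) (1 / 4)]
  choose! G hG using hlim
  have hloc : TendstoLocallyUniformlyOn h G atTop upperHalf := by
    have hun : upperHalf = ⋃ k : ℕ, {z : ℂ | 2 * (1 / (k + 3 : ℝ)) < z.im} := by
      ext z
      simp only [Set.mem_iUnion, Set.mem_ofPred_eq]
      constructor
      · intro hz
        obtain ⟨k, hk⟩ := exists_nat_one_div_lt (half_pos (show 0 < z.im from hz))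
        refine ⟨k, ?_⟩
        have : 1 / (k + 3 : ℝ) ≤ 1 / (k + 1 : ℝ) :=
          one_div_le_one_div_of_le (by positivity) (by linarith)
        linarith
      · rintro ⟨k, hk⟩
        exact lt_trans (by positivity) hk
    rw [hun]
    refine tendstoLocallyUniformlyOn_iUnion (fun k => ?_) fun k => ?_
    · exact isOpen_lt continuous_const Complex.continuous_im
    · refine (UniformCauchySeqOn.tendstoUniformlyOn_of_tendsto (hcauchy _ (by positivity) ?_)
        fun z hz => hG z ?_).tendstoLocallyUniformlyOn
      · rw [div_lt_div_iff₀ (by positivity) (by norm_num)]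
        have : (0 : ℝ) ≤ k := Nat.cast_nonneg k
        linarith
      · exact lt_trans (by positivity) (show 2 * (1 / (k + 3 : ℝ)) < z.im from hz)
  have hGd : DifferentiableOn ℂ G upperHalf :=
    hloc.differentiableOn (Eventually.of_forall hd) isOpen_upperHalf
  refine ⟨G, hGd, hG, ?_⟩
  -- The equation holds high up, and everywhere by the identity theorem.
  have hFd : DifferentiableOn ℂ (fun z => z • G z - 1 - η (G z) * G z) upperHalf := by
    refine ((differentiableOn_id.smul hGd).sub (differentiableOn_const _)).sub ?_
    exact (η.differentiable.comp_differentiableOn hGd).mul hGd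
  have hz₀ : ((u + 1 : ℝ) : ℂ) * Complex.I ∈ upperHalf := by
    change 0 < (((u + 1 : ℝ) : ℂ) * Complex.I).im
    simp only [Complex.mul_im, Complex.ofReal_re, Complex.I_im, mul_one, Complex.ofReal_im,
      Complex.I_re, mul_zero, add_zero]
    linarith
  have hev : (fun z => z • G z - 1 - η (G z) * G z) =ᶠ[𝓝 (((u + 1 : ℝ) : ℂ) * Complex.I)] 0 := by
    have hopen : IsOpen {z : ℂ | u < z.im} := isOpen_lt continuous_const Complex.continuous_im
    have hmem : ((u + 1 : ℝ) : ℂ) * Complex.I ∈ {z : ℂ | u < z.im} := by simp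
    filter_upwards [hopen.mem_nhds hmem] with z hz
    have hzu : u < z.im := hz
    have hzU : z ∈ upperHalf := by change 0 < z.im; linarith
    have h1 : Tendsto (fun m => ‖z • h m z - 1 - η (h m z) * h m z‖) atTop
        (𝓝 ‖z • G z - 1 - η (G z) * G z‖) := by
      have h2 := hG z hzU
      exact (((h2.const_smul z).sub_const 1).sub
        (((η.continuous.tendsto _).comp h2).mul h2)).norm
    have h3 : ‖z • G z - 1 - η (G z) * G z‖ ≤ 0 :=
      le_of_tendsto_of_tendsto' h1 he fun m => heq m z (huY.trans hzu.le)
    exact norm_le_zero_iff.1 h3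
  have h0 := (hFd.analyticOnNhd isOpen_upperHalf).eqOn_zero_of_preconnected_of_eventuallyEq_zero
    isPreconnected_upperHalf hz₀ hev
  intro z hz
  have := h0 hz
  simp only [Pi.zero_apply] at this
  rw [sub_sub, sub_eq_zero] at this
  exact this

/-- A solution which is `O(1 / Im z)` satisfies `z G(z) → 1` at infinity, even along the real axis.
For large `|z|` the equation forces `‖G(z)‖` to avoid the value `2 c / |z|`, where `c > ‖1‖`;
moving up along the vertical ray from `z`, continuity shows that `‖G(z)‖` lies below that value. -/
theorem tendsto_smul_of_equation {G : ℂ → 𝔸} {B : ℝ} (hGc : ContinuousOn G upperHalf)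
    (hB : ∀ z ∈ upperHalf, ‖G z‖ ≤ B / z.im)
    (hG : ∀ z ∈ upperHalf, z • G z = 1 + η (G z) * G z) :
    Tendsto (fun z => z • G z) (Bornology.cobounded ℂ ⊓ 𝓟 upperHalf) (𝓝 1) := by
  set c : ℝ := ‖(1 : 𝔸)‖ + 1 with hc
  have hc0 : 0 < c := by positivity
  have hbound : ∀ z ∈ upperHalf, 1 ≤ ‖z‖ → 4 * ‖η‖ * c < ‖z‖ → ‖G z‖ ≤ 2 * c / ‖z‖ := by
    intro z hz hz1 hzc
    by_contra! hcon
    have hz0 : 0 < z.im := hz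
    have hn0 : 0 < ‖z‖ := by linarith
    have hray : ∀ t : ℝ, 0 ≤ t → z + t * Complex.I ∈ upperHalf := fun t ht => by
      change 0 < (z + t * Complex.I).im
      simp; linarith
    have hcont : ContinuousOn (fun t : ℝ => ‖G (z + t * Complex.I)‖) (Set.Ici 0) :=
      (hGc.comp (by fun_prop) fun t ht => hray t ht).norm
    -- Far up on the ray, `G` is small.
    obtain ⟨T, hT0, hT⟩ : ∃ T : ℝ, 0 ≤ T ∧ ‖G (z + T * Complex.I)‖ < 2 * c / ‖z‖ := by
      have hlim : Tendsto (fun t : ℝ => B / (z.im + t)) atTop (𝓝 0) :=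
        tendsto_const_nhds.div_atTop (tendsto_atTop_add_const_left _ _ tendsto_id)
      obtain ⟨T, hT, hT0⟩ := ((hlim.eventually (gt_mem_nhds
        (show (0 : ℝ) < 2 * c / ‖z‖ by positivity))).and (eventually_ge_atTop 0)).exists
      refine ⟨T, hT0, lt_of_le_of_lt ?_ hT⟩
      simpa using hB _ (hray T hT0)
    obtain ⟨t, ht, hteq⟩ := intermediate_value_Icc' hT0
      (hcont.mono fun t ht => ht.1) ⟨hT.le, by simpa using hcon.le⟩
    -- The value `2 c / |z|` contradicts the equation.
    simp only at hteq
    set w := z + t * Complex.I with hw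
    have hwz : ‖z‖ ≤ ‖w‖ := by
      rw [Complex.norm_def, Complex.norm_def]
      refine Real.sqrt_le_sqrt ?_
      rw [Complex.normSq_apply, Complex.normSq_apply]
      have h1 : w.re = z.re := by simp [hw]
      have h2 : w.im = z.im + t := by simp [hw]
      rw [h1, h2]
      nlinarith [ht.1]
    have heq : ‖w‖ * ‖G w‖ ≤ ‖(1 : 𝔸)‖ + ‖η‖ * ‖G w‖ * ‖G w‖ := by
      rw [← norm_smul, hG w (hray t ht.1)]
      exact (norm_add_le _ _).trans (add_le_add le_rfl ((norm_mul_le _ _).trans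
        (mul_le_mul_of_nonneg_right (η.le_opNorm _) (norm_nonneg _))))
    have h1 : 2 * c ≤ ‖w‖ * ‖G w‖ := by
      calc 2 * c = ‖z‖ * ‖G w‖ := by rw [hteq]; field_simp
        _ ≤ _ := mul_le_mul_of_nonneg_right hwz (norm_nonneg _)
    have h2 : ‖η‖ * ‖G w‖ * ‖G w‖ ≤ c := by
      rw [hteq]
      have : ‖η‖ * (2 * c / ‖z‖) * (2 * c / ‖z‖) = (4 * ‖η‖ * c / ‖z‖) * (c / ‖z‖) := by ring
      rw [this]
      have h3 : 4 * ‖η‖ * c / ‖z‖ ≤ 1 := (div_le_one hn0).2 hzc.le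
      have h4 : c / ‖z‖ ≤ c := div_le_self hc0.le hz1
      exact (mul_le_mul h3 h4 (by positivity) zero_le_one).trans (by rw [one_mul])
    linarith
  rw [tendsto_iff_norm_sub_tendsto_zero]
  have hlim : Tendsto (fun z : ℂ => ‖η‖ * (2 * c / ‖z‖) * (2 * c / ‖z‖))
      (Bornology.cobounded ℂ ⊓ 𝓟 upperHalf) (𝓝 0) := by
    have h1 : Tendsto (fun z : ℂ => 2 * c / ‖z‖) (Bornology.cobounded ℂ ⊓ 𝓟 upperHalf) (𝓝 0) :=
      (tendsto_const_nhds.div_atTop tendsto_norm_cobounded_atTop).mono_left inf_le_left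
    simpa using (h1.const_mul ‖η‖).mul h1
  refine squeeze_zero' (Eventually.of_forall fun z => norm_nonneg _) ?_ hlim
  have hlarge : ∀ᶠ z in Bornology.cobounded ℂ ⊓ 𝓟 upperHalf,
      max 1 (4 * ‖η‖ * c + 1) ≤ ‖z‖ :=
    (tendsto_norm_cobounded_atTop.mono_left inf_le_left).eventually (eventually_ge_atTop _)
  have hU : ∀ᶠ z in Bornology.cobounded ℂ ⊓ 𝓟 upperHalf, z ∈ upperHalf :=
    mem_inf_of_right (mem_principal_self _)
  filter_upwards [hlarge, hU] with z hz hzU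
  have hb := hbound z hzU ((le_max_left _ _).trans hz) (by
    have := (le_max_right _ _).trans hz; linarith)
  rw [hG z hzU, add_sub_cancel_left]
  refine (norm_mul_le _ _).trans (mul_le_mul ((η.le_opNorm _).trans ?_) hb (norm_nonneg _)
    (by positivity))
  exact mul_le_mul_of_nonneg_left hb (norm_nonneg _)

/-- Uniqueness of the analytic solution with `z G(z) → 1`: for large `|z|` two solutions agree
because the equation is contractive, and the identity theorem does the rest. -/
theorem eqOn_of_equation {G G' : ℂ → 𝔸} (hGd : AnalyticOnNhd ℂ G upperHalf)
    (hGd' : AnalyticOnNhd ℂ G' upperHalf)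
    (hG : ∀ z ∈ upperHalf, z • G z = 1 + η (G z) * G z)
    (hG' : ∀ z ∈ upperHalf, z • G' z = 1 + η (G' z) * G' z)
    (hl : Tendsto (fun z => z • G z) (Bornology.cobounded ℂ ⊓ 𝓟 upperHalf) (𝓝 1))
    (hl' : Tendsto (fun z => z • G' z) (Bornology.cobounded ℂ ⊓ 𝓟 upperHalf) (𝓝 1)) :
    Set.EqOn G G' upperHalf := by
  set c : ℝ := ‖(1 : 𝔸)‖ + 1 with hc
  have hbd : ∀ {F : ℂ → 𝔸},
      Tendsto (fun z => z • F z) (Bornology.cobounded ℂ ⊓ 𝓟 upperHalf) (𝓝 1) →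
      ∀ᶠ z in Bornology.cobounded ℂ ⊓ 𝓟 upperHalf, ‖z‖ * ‖F z‖ ≤ c := fun hF => by
    have h1 := hF.norm.eventually (gt_mem_nhds (lt_add_one ‖(1 : 𝔸)‖))
    filter_upwards [h1] with z hz
    rw [← norm_smul]; exact hz.le
  have hlarge : ∀ᶠ z in Bornology.cobounded ℂ ⊓ 𝓟 upperHalf, 1 + 2 * ‖η‖ * c ≤ ‖z‖ :=
    (tendsto_norm_cobounded_atTop.mono_left inf_le_left).eventually (eventually_ge_atTop _)
  have hU : ∀ᶠ z in Bornology.cobounded ℂ ⊓ 𝓟 upperHalf, z ∈ upperHalf :=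
    mem_inf_of_right (mem_principal_self _)
  have hagree : ∀ᶠ z in Bornology.cobounded ℂ ⊓ 𝓟 upperHalf, G z = G' z := by
    filter_upwards [hbd hl, hbd hl', hlarge, hU] with z h1 h2 h3 hz
    have hc0 : 0 ≤ c := by positivity
    have hz1 : 1 ≤ ‖z‖ := by
      have : 0 ≤ 2 * ‖η‖ * c := by positivity
      linarith
    have b1 : ∀ x : ℝ, 0 ≤ x → ‖z‖ * x ≤ c → x ≤ c := fun x hx h =>
      (le_mul_of_one_le_left hx hz1).trans h
    have key := norm_sub_le_of_approx η (ε := 0) (ε' := 0) (b1 _ (norm_nonneg _) h1)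
      (b1 _ (norm_nonneg _) h2) (by rw [hG z hz, add_sub_cancel_left, sub_self, norm_zero])
      (by rw [hG' z hz, add_sub_cancel_left, sub_self, norm_zero]) h3
    rw [add_zero] at key
    exact sub_eq_zero.1 (norm_le_zero_iff.1 key)
  obtain ⟨r, hr⟩ : ∃ r : ℝ, ∀ z ∈ upperHalf, r < ‖z‖ → G z = G' z := by
    rw [eventually_inf_principal] at hagree
    have h1 := (Filter.hasBasis_cobounded_norm (E := ℂ)).eventually_iff.1 hagree
    obtain ⟨r, -, hr⟩ := h1
    exact ⟨r, fun z hz hrz => hr (show r ≤ ‖z‖ from hrz.le) hz⟩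
  set z₀ : ℂ := ((|r| + 1 : ℝ) : ℂ) * Complex.I with hz₀
  have hz₀n : r < ‖z₀‖ := by
    rw [hz₀, norm_mul, Complex.norm_I, mul_one, Complex.norm_real, Real.norm_of_nonneg
      (by positivity)]
    linarith [le_abs_self r]
  have hz₀U : z₀ ∈ upperHalf := by
    change 0 < z₀.im
    simp [hz₀]
    positivity
  refine hGd.eqOn_of_preconnected_of_eventuallyEq hGd' isPreconnected_upperHalf hz₀U ?_
  filter_upwards [isOpen_upperHalf.mem_nhds hz₀U,
    (isOpen_lt continuous_const continuous_norm).mem_nhds hz₀n] with z h1 h2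
  exact hr z h1 h2

end Equation

/-! ### The continuity theorem for Cauchy transforms -/

section CauchyContinuity

open scoped ComplexConjugate

theorem sub_ofReal_ne_zero {z : ℂ} (hz : z.im ≠ 0) (t : ℝ) : z - (t : ℂ) ≠ 0 := fun h => by
  have := congrArg Complex.im h
  simp at this
  exact hz this

theorem norm_inv_sub_ofReal_le {z : ℂ} (hz : z.im ≠ 0) (t : ℝ) :
    ‖(z - (t : ℂ))⁻¹‖ ≤ |z.im|⁻¹ := by
  rw [norm_inv]
  refine inv_anti₀ (abs_pos.2 hz) ?_
  simpa using Complex.abs_im_le_norm (z - (t : ℂ))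

theorem continuous_inv_sub_ofReal {z : ℂ} (hz : z.im ≠ 0) :
    Continuous fun t : ℝ => (z - (t : ℂ))⁻¹ :=
  (by fun_prop : Continuous fun t : ℝ => z - (t : ℂ)).inv₀ (sub_ofReal_ne_zero hz)

/-- The function `t ↦ 1 / (z - t)` on the real line, for `z` not real. -/
def cauchyKernel (z : ℂ) (hz : z.im ≠ 0) : ℝ →ᵇ ℂ :=
  BoundedContinuousFunction.ofNormedAddCommGroup (fun t : ℝ => (z - (t : ℂ))⁻¹)
    (continuous_inv_sub_ofReal hz) |z.im|⁻¹ (norm_inv_sub_ofReal_le hz)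

theorem cauchyKernel_apply (z : ℂ) (hz : z.im ≠ 0) (t : ℝ) :
    cauchyKernel z hz t = (z - (t : ℂ))⁻¹ := rfl

theorem integral_cauchyKernel (z : ℂ) (hz : z.im ≠ 0) (μ : Measure ℝ) :
    ∫ t, cauchyKernel z hz t ∂μ = cauchyTransform μ z := rfl

theorem norm_cauchyKernel_le (z : ℂ) (hz : z.im ≠ 0) : ‖cauchyKernel z hz‖ ≤ |z.im|⁻¹ :=
  BoundedContinuousFunction.norm_ofNormedAddCommGroup_le _ (by positivity) _

theorem star_cauchyKernel (z : ℂ) (hz : z.im ≠ 0) :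
    star (cauchyKernel z hz) = cauchyKernel (conj z) (by simpa using hz) := by
  ext t
  simp [cauchyKernel_apply]

theorem cauchyTransform_conj (μ : Measure ℝ) (z : ℂ) :
    cauchyTransform μ (conj z) = conj (cauchyTransform μ z) := by
  rw [cauchyTransform, cauchyTransform, ← integral_conj]
  simp

/-- The resolvent identity for multiplication by `t`. -/
theorem cauchyKernel_sub {z w : ℂ} (hz : z.im ≠ 0) (hw : w.im ≠ 0) :
    cauchyKernel z hz - cauchyKernel w hw = (w - z) • (cauchyKernel z hz * cauchyKernel w hw) := by
  ext t
  have h1 := sub_ofReal_ne_zero hz t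
  have h2 := sub_ofReal_ne_zero hw t
  simp only [BoundedContinuousFunction.sub_apply, BoundedContinuousFunction.smul_apply,
    BoundedContinuousFunction.mul_apply, cauchyKernel_apply, smul_eq_mul]
  field_simp
  ring

/-- The constant `1` and the functions `t ↦ 1 / (z - t)` for `z` not real. -/
def cauchyFunctions : Set (ℝ →ᵇ ℂ) := insert 1 {f | ∃ z hz, f = cauchyKernel z hz}

/-- The closed linear span of the functions `1` and `t ↦ 1 / (z - t)`. -/
def cauchySpan : Submodule ℂ (ℝ →ᵇ ℂ) := (Submodule.span ℂ cauchyFunctions).topologicalClosure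

theorem isClosed_cauchySpan : IsClosed (cauchySpan : Set (ℝ →ᵇ ℂ)) :=
  Submodule.isClosed_topologicalClosure _

theorem cauchyFunctions_subset : cauchyFunctions ⊆ cauchySpan :=
  Submodule.subset_span.trans (Submodule.le_topologicalClosure _)

theorem cauchyKernel_mem (z : ℂ) (hz : z.im ≠ 0) : cauchyKernel z hz ∈ cauchySpan :=
  cauchyFunctions_subset (Or.inr ⟨z, hz, rfl⟩)

theorem cauchySpan_le {S : Submodule ℂ (ℝ →ᵇ ℂ)} (hS : IsClosed (S : Set (ℝ →ᵇ ℂ)))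
    (h1 : 1 ∈ S) (h : ∀ z hz, cauchyKernel z hz ∈ S) : cauchySpan ≤ S := by
  refine Submodule.topologicalClosure_minimal _ (Submodule.span_le.2 ?_) hS
  rintro f (rfl | ⟨z, hz, rfl⟩)
  exacts [h1, h z hz]

/-- Partial fractions for `z ≠ w`, and a limit `w → z` in the remaining case. -/
theorem cauchyKernel_mul_mem {z w : ℂ} (hz : z.im ≠ 0) (hw : w.im ≠ 0) :
    cauchyKernel z hz * cauchyKernel w hw ∈ cauchySpan := by
  have hne : ∀ {z w : ℂ} (hz : z.im ≠ 0) (hw : w.im ≠ 0), z ≠ w →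
      cauchyKernel z hz * cauchyKernel w hw ∈ cauchySpan := by
    intro z w hz hw hzw
    have h := cauchySpan.smul_mem (w - z)⁻¹
      (cauchySpan.sub_mem (cauchyKernel_mem z hz) (cauchyKernel_mem w hw))
    rwa [cauchyKernel_sub, smul_smul, inv_mul_cancel₀ (sub_ne_zero.2 hzw.symm), one_smul] at h
  by_cases hzw : z = w
  swap
  · exact hne hz hw hzw
  subst hzw
  have him : ∀ s : ℝ, (z + (s : ℂ)).im ≠ 0 := fun s => by simpa using hz
  have hlim : Tendsto (fun s : ℝ => cauchyKernel z hz * cauchyKernel (z + (s : ℂ)) (him s))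
      (𝓝[≠] 0) (𝓝 (cauchyKernel z hz * cauchyKernel z hz)) := by
    refine Tendsto.mono_left ?_ nhdsWithin_le_nhds
    refine tendsto_const_nhds.mul ?_
    rw [tendsto_iff_norm_sub_tendsto_zero]
    refine squeeze_zero (g := fun s : ℝ => |s| * (|z.im|⁻¹ * |z.im|⁻¹)) (fun s => norm_nonneg _)
      (fun s => ?_) ?_
    · rw [cauchyKernel_sub, norm_smul]
      refine mul_le_mul (by simp) ((norm_mul_le _ _).trans ?_) (norm_nonneg _) (abs_nonneg _)
      refine mul_le_mul ?_ (norm_cauchyKernel_le _ _) (norm_nonneg _) (by positivity)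
      simpa using norm_cauchyKernel_le _ (him s)
    · have : Tendsto (fun s : ℝ => |s| * (|z.im|⁻¹ * |z.im|⁻¹)) (𝓝 0)
          (𝓝 (|0| * (|z.im|⁻¹ * |z.im|⁻¹))) := by
        apply Continuous.tendsto; fun_prop
      simpa using this
  refine isClosed_cauchySpan.mem_of_tendsto hlim ?_
  filter_upwards [self_mem_nhdsWithin] with s hs
  refine hne hz _ fun h => hs ?_
  simpa using h

theorem cauchySpan_mul_mem {f g : ℝ →ᵇ ℂ} (hf : f ∈ cauchySpan) (hg : g ∈ cauchySpan) :
    f * g ∈ cauchySpan := by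
  have key : ∀ f : ℝ →ᵇ ℂ, f * 1 ∈ cauchySpan → (∀ z hz, f * cauchyKernel z hz ∈ cauchySpan) →
      ∀ g ∈ cauchySpan, f * g ∈ cauchySpan := by
    intro f h1 h2
    exact cauchySpan_le (S := cauchySpan.comap (LinearMap.mulLeft ℂ f))
      (isClosed_cauchySpan.preimage (continuous_const.mul continuous_id)) h1 h2
  refine key f (by simpa using hf) (fun z hz => ?_) g hg
  rw [mul_comm]
  refine key _ (by simpa using cauchyKernel_mem z hz) (fun w hw => ?_) f hf
  exact cauchyKernel_mul_mem hz hw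

theorem cauchySpan_star_mem {f : ℝ →ᵇ ℂ} (hf : f ∈ cauchySpan) : star f ∈ cauchySpan := by
  let S : Submodule ℂ (ℝ →ᵇ ℂ) :=
    { carrier := {f | star f ∈ cauchySpan}
      zero_mem' := by simp
      add_mem' := fun {f g} hf hg => by
        simpa using cauchySpan.add_mem hf hg
      smul_mem' := fun c f hf => by
        simpa using cauchySpan.smul_mem (conj c) hf }
  refine cauchySpan_le (S := S) (isClosed_cauchySpan.preimage continuous_star) ?_ ?_ hf
  · change star (1 : ℝ →ᵇ ℂ) ∈ cauchySpan
    rw [star_one]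
    exact cauchyFunctions_subset (Or.inl rfl)
  · intro z hz
    change star (cauchyKernel z hz) ∈ cauchySpan
    rw [star_cauchyKernel]
    exact cauchyKernel_mem _ _

/-- The closed span of the functions `1` and `t ↦ 1 / (z - t)` as a star algebra. -/
def cauchyAlgebra : StarSubalgebra ℂ (ℝ →ᵇ ℂ) where
  carrier := cauchySpan
  mul_mem' := cauchySpan_mul_mem
  add_mem' := cauchySpan.add_mem
  algebraMap_mem' c := by
    rw [Algebra.algebraMap_eq_smul_one]
    exact cauchySpan.smul_mem c (cauchyFunctions_subset (Or.inl rfl))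
  star_mem' := cauchySpan_star_mem

theorem separatesPoints_cauchyAlgebra :
    (cauchyAlgebra.map (BoundedContinuousFunction.toContinuousMapStarₐ ℂ)).SeparatesPoints := by
  intro s t hst
  have hI : Complex.I.im ≠ 0 := by simp
  refine ⟨_, ⟨_, ⟨cauchyKernel Complex.I hI, cauchyKernel_mem _ _, rfl⟩, rfl⟩, ?_⟩
  change (Complex.I - (s : ℂ))⁻¹ ≠ (Complex.I - (t : ℂ))⁻¹
  intro h
  exact hst (by simpa using inv_injective h)

/-- The test functions for which `∫ f dμ_i` converges to `∫ f dν` form a closed subspace. -/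
theorem tendsto_integral_of_mem_cauchySpan {ι : Type*} {l : Filter ι} {μ : ι → ProbabilityMeasure ℝ}
    {ν : ProbabilityMeasure ℝ}
    (h : ∀ z ∈ upperHalf,
      Tendsto (fun i => cauchyTransform (μ i : Measure ℝ) z) l (𝓝 (cauchyTransform ν z)))
    {f : ℝ →ᵇ ℂ} (hf : f ∈ cauchySpan) :
    Tendsto (fun i => ∫ t, f t ∂(μ i : Measure ℝ)) l (𝓝 (∫ t, f t ∂(ν : Measure ℝ))) := by
  let S : Submodule ℂ (ℝ →ᵇ ℂ) :=
    { carrier := {f | Tendsto (fun i => ∫ t, f t ∂(μ i : Measure ℝ)) l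
        (𝓝 (∫ t, f t ∂(ν : Measure ℝ)))}
      zero_mem' := by simpa using tendsto_const_nhds
      add_mem' := fun {f g} hf hg => by
        have := Tendsto.add hf hg
        simp only [Set.mem_ofPred_eq, BoundedContinuousFunction.add_apply]
        rw [integral_add (f.integrable _) (g.integrable _)]
        refine this.congr fun i => ?_
        rw [integral_add (f.integrable _) (g.integrable _)]
      smul_mem' := fun c f hf => by
        have := Tendsto.const_smul hf c
        simpa only [Set.mem_ofPred_eq, BoundedContinuousFunction.smul_apply, integral_smul]
          using this }
  refine cauchySpan_le (S := S) ?_ ?_ ?_ hf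
  · refine isClosed_of_closure_subset fun f hf => ?_
    change Tendsto _ _ _
    rw [Metric.tendsto_nhds]
    intro ε hε
    obtain ⟨g, hg, hfg⟩ := Metric.mem_closure_iff.1 hf (ε / 3) (by positivity)
    have hclose : ∀ ρ : ProbabilityMeasure ℝ,
        dist (∫ t, f t ∂(ρ : Measure ℝ)) (∫ t, g t ∂(ρ : Measure ℝ)) < ε / 3 := by
      intro ρ
      rw [dist_eq_norm, ← integral_sub (f.integrable _) (g.integrable _)]
      rw [dist_eq_norm] at hfg
      exact ((f - g).norm_integral_le_norm (ρ : Measure ℝ)).trans_lt hfg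
    filter_upwards [Metric.tendsto_nhds.1 (show Tendsto _ _ _ from hg) (ε / 3) (by positivity)]
      with i hi
    calc _ ≤ _ := dist_triangle4 _ (∫ t, g t ∂(μ i : Measure ℝ)) (∫ t, g t ∂(ν : Measure ℝ)) _
      _ < ε / 3 + ε / 3 + ε / 3 := by
        have := hclose ν
        rw [dist_comm] at this
        have := hclose (μ i)
        linarith
      _ = ε := by ring
  · change Tendsto _ _ _
    simpa using tendsto_const_nhds
  · intro z hz
    change Tendsto _ _ _
    simp only [integral_cauchyKernel]
    rcases hz.lt_or_gt with h0 | h0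
    · have h1 := h (conj z) (show 0 < (conj z).im by simpa using h0)
      simp only [cauchyTransform_conj] at h1
      simpa [Function.comp_def] using (Complex.continuous_conj.tendsto _).comp h1
    · exact h z h0

/-- The Cauchy transform on the imaginary axis controls the mass far out: the integrand
`Re (1 - iy / (iy - t)) = t² / (y² + t²)` is at least `1 / 2` for `|t| > y`. -/
theorem measure_norm_gt_le (μ : Measure ℝ) [IsProbabilityMeasure μ] {y : ℝ} (hy : 0 < y) :
    μ {t | y < ‖t‖} ≤ ENNReal.ofReal
      (2 * (1 - (y * Complex.I * cauchyTransform μ (y * Complex.I)).re)) := by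
  have him : (y * Complex.I).im ≠ 0 := by simpa using hy.ne'
  have hint : Integrable (fun t : ℝ => (y * Complex.I - (t : ℂ))⁻¹) μ :=
    (cauchyKernel _ him).integrable μ
  have hint' : Integrable (fun t : ℝ => (y * Complex.I * (y * Complex.I - (t : ℂ))⁻¹).re) μ :=
    (hint.const_mul _).re
  have h1 : 1 - (y * Complex.I * cauchyTransform μ (y * Complex.I)).re
      = ∫ t : ℝ, (1 - (y * Complex.I * (y * Complex.I - (t : ℂ))⁻¹).re) ∂μ := by
    rw [integral_sub (integrable_const _) hint', integral_const]
    simp only [probReal_univ, smul_eq_mul, one_mul]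
    congr 1
    rw [cauchyTransform, ← integral_const_mul]
    exact (integral_re (𝕜 := ℂ) (hint.const_mul _)).symm
  have h2 : ∀ t : ℝ, 1 - (y * Complex.I * (y * Complex.I - (t : ℂ))⁻¹).re
      = t ^ 2 / (y ^ 2 + t ^ 2) := by
    intro t
    have hpos : 0 < y ^ 2 + t ^ 2 := by positivity
    have : Complex.normSq (y * Complex.I - (t : ℂ)) = y ^ 2 + t ^ 2 := by
      simp [Complex.normSq_apply]; ring
    rw [Complex.mul_re, Complex.inv_re, Complex.inv_im, this]
    simp
    field_simp
    ring
  have h3 : μ {t | y < ‖t‖} = ∫⁻ t, Set.indicator {t : ℝ | y < ‖t‖} 1 t ∂μ := by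
    rw [lintegral_indicator_one (measurableSet_lt measurable_const measurable_norm)]
  have hint2 : Integrable (fun t : ℝ =>
      2 * (1 - (y * Complex.I * (y * Complex.I - (t : ℂ))⁻¹).re)) μ :=
    ((integrable_const _).sub hint').const_mul 2
  rw [h3, h1, ← integral_const_mul, ofReal_integral_eq_lintegral_ofReal hint2
    (ae_of_all _ fun t => by simp only [h2]; positivity)]
  refine lintegral_mono fun t => ?_
  simp only [h2]
  by_cases ht : y < ‖t‖
  swap
  · rw [Set.indicator_of_notMem (by simpa using ht)]
    exact zero_le
  rw [Set.indicator_of_mem (by simpa using ht)]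
  have ht' : y ^ 2 < t ^ 2 := by
    rw [← sq_abs t]
    exact pow_lt_pow_left₀ ht hy.le two_ne_zero
  simp only [Pi.one_apply]
  rw [← ENNReal.ofReal_one]
  refine ENNReal.ofReal_le_ofReal ?_
  rw [← mul_div_assoc, le_div_iff₀ (by positivity)]
  linarith

/-- **Stieltjes continuity theorem**. If the Cauchy transforms of probability measures converge
pointwise on `ℂ⁺` to a function `g` with `iy g(iy) → 1`, then the measures converge weakly to a
probability measure with Cauchy transform `g`. The condition at infinity gives tightness. -/
theorem exists_tendsto_of_tendsto_cauchyTransform (μ : ℕ → ProbabilityMeasure ℝ) {g : ℂ → ℂ}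
    (h : ∀ z ∈ upperHalf, Tendsto (fun m => cauchyTransform (μ m : Measure ℝ) z) atTop (𝓝 (g z)))
    (hg : Tendsto (fun y : ℝ => y * Complex.I * g (y * Complex.I)) atTop (𝓝 1)) :
    ∃ ν : ProbabilityMeasure ℝ, Tendsto μ atTop (𝓝 ν) ∧
      ∀ z ∈ upperHalf, cauchyTransform (ν : Measure ℝ) z = g z := by
  have htight : IsTightMeasureSet (Set.range fun m => (μ m : Measure ℝ)) := by
    refine isTightMeasureSet_range_of_tendsto_limsup_measure_norm_gt ?_
    have hlim : Tendsto (fun y : ℝ => ENNReal.ofReal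
        (2 * (1 - (y * Complex.I * g (y * Complex.I)).re))) atTop (𝓝 0) := by
      have h1 := ((Complex.continuous_re.tendsto _).comp hg).const_sub 1
      have h2 := ENNReal.tendsto_ofReal (h1.const_mul 2)
      simpa using h2
    refine tendsto_of_tendsto_of_tendsto_of_le_of_le' tendsto_const_nhds hlim
      (Eventually.of_forall fun _ => zero_le) ?_
    filter_upwards [eventually_gt_atTop 0] with y hy
    have h1 := h (y * Complex.I) (show 0 < (y * Complex.I).im by simpa using hy)
    have h2 := ENNReal.tendsto_ofReal
      ((((Complex.continuous_re.tendsto _).comp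
        (h1.const_mul (y * Complex.I))).const_sub 1).const_mul 2)
    rw [← h2.limsup_eq]
    exact limsup_le_limsup (Eventually.of_forall fun m => measure_norm_gt_le _ hy)
  have hcompact : IsCompact (closure (Set.range μ)) := by
    refine isCompact_closure_of_isTightMeasureSet ?_
    convert htight using 1
    ext ρ
    simp
  have hrange : map μ atTop ≤ 𝓟 (closure (Set.range μ)) :=
    tendsto_principal.2 (Eventually.of_forall fun m => subset_closure (Set.mem_range_self m))
  obtain ⟨ν, -, hν⟩ := hcompact.exists_mapClusterPt hrange
  obtain ⟨U, hU, hUν⟩ := mapClusterPt_iff_ultrafilter.1 hν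
  have hνg : ∀ z ∈ upperHalf, cauchyTransform (ν : Measure ℝ) z = g z := by
    intro z hz
    have h1 := (ProbabilityMeasure.tendsto_iff_forall_integral_rclike_tendsto ℂ).1 hUν
      (cauchyKernel z (ne_of_gt hz))
    exact tendsto_nhds_unique h1 ((h z hz).mono_left hU)
  refine ⟨ν, ?_, hνg⟩
  refine ProbabilityMeasure.tendsto_of_tight_of_separatesPoints ℂ htight
    separatesPoints_cauchyAlgebra fun f hf => ?_
  refine tendsto_integral_of_mem_cauchySpan (fun z hz => ?_) hf
  rw [hνg z hz]
  exact h z hz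

end CauchyContinuity

/-! ### The expected empirical eigenvalue distribution -/

section MeanDistribution

open scoped Matrix.Norms.L2Operator

variable {ι : Type*} [Fintype ι] [DecidableEq ι]

theorem integral_empiricalEigenvalueDistribution {E : Type*} [NormedAddCommGroup E]
    [NormedSpace ℝ E] [CompleteSpace E] {X : Matrix ι ι ℂ} (hX : X.IsHermitian) (f : ℝ → E) :
    ∫ t, f t ∂(empiricalEigenvalueDistribution hX)
      = (Fintype.card ι : ℝ)⁻¹ • ∑ x, f (hX.eigenvalues x) := by
  rw [empiricalEigenvalueDistribution, integral_smul_measure, integral_finsetSum_measure]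
  · simp [integral_dirac]
  · exact fun i _ => integrable_dirac (by simp)

instance [Nonempty ι] {X : Matrix ι ι ℂ} (hX : X.IsHermitian) :
    IsProbabilityMeasure (empiricalEigenvalueDistribution hX) := by
  refine ⟨?_⟩
  rw [empiricalEigenvalueDistribution]
  simp [ENNReal.inv_mul_cancel]

theorem trace_cfc {X : Matrix ι ι ℂ} (hX : X.IsHermitian) (f : ℝ → ℝ) :
    (cfc f X).trace = ∑ x, (f (hX.eigenvalues x) : ℂ) := by
  rw [hX.cfc_eq, Matrix.IsHermitian.cfc, Unitary.conjStarAlgAut_apply, Matrix.trace_mul_cycle]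
  simp [Matrix.trace]

theorem trace_matrixResolvent {X : Matrix ι ι ℂ} (hX : X.IsHermitian) {z : ℂ} (hz : z.im ≠ 0) :
    (matrixResolvent z X).trace = ∑ x, (z - (hX.eigenvalues x : ℂ))⁻¹ := by
  set φ := Unitary.conjStarAlgAut ℂ (Matrix ι ι ℂ) hX.eigenvectorUnitary
  have hR : matrixResolvent z X
      = φ (Matrix.diagonal fun x => (z - (hX.eigenvalues x : ℂ))⁻¹) := by
    refine Matrix.inv_eq_right_inv ?_
    have h1 : z • (1 : Matrix ι ι ℂ) - X
        = φ (Matrix.diagonal fun x => z - (hX.eigenvalues x : ℂ)) := by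
      conv_lhs => rw [hX.spectral_theorem, ← map_one φ, ← map_smul, ← map_sub]
      congr 1
      rw [← Matrix.diagonal_one, ← Matrix.diagonal_smul, Matrix.diagonal_sub]
      simp
    rw [h1, ← map_mul, Matrix.diagonal_mul_diagonal]
    have h2 : (fun x => (z - (hX.eigenvalues x : ℂ)) * (z - (hX.eigenvalues x : ℂ))⁻¹)
        = fun _ => 1 := funext fun x => mul_inv_cancel₀ (sub_ofReal_ne_zero hz _)
    rw [h2, Matrix.diagonal_one, map_one]
  rw [hR, Unitary.conjStarAlgAut_apply, Matrix.trace_mul_cycle]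
  simp [Matrix.trace]

theorem cauchyTransform_empiricalEigenvalueDistribution {X : Matrix ι ι ℂ} (hX : X.IsHermitian)
    {z : ℂ} (hz : z.im ≠ 0) : cauchyTransform (empiricalEigenvalueDistribution hX) z
      = (Fintype.card ι : ℂ)⁻¹ * (matrixResolvent z X).trace := by
  rw [cauchyTransform, integral_empiricalEigenvalueDistribution, trace_matrixResolvent hX hz,
    Complex.real_smul]
  simp

/-- Linear statistics of the eigenvalues depend continuously on the Hermitian matrix, by the
continuity of the functional calculus. -/
theorem continuous_integral_empiricalEigenvalueDistribution {V : Type*} [TopologicalSpace V]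
    {X : V → Matrix ι ι ℂ} (hX : ∀ v, (X v).IsHermitian) (hXc : Continuous X) {f : ℝ → ℝ}
    (hf : Continuous f) :
    Continuous fun v => ∫ t, f t ∂(empiricalEigenvalueDistribution (hX v)) := by
  have h1 : Continuous fun v => cfc f (X v) :=
    hXc.cfc_of_mem_nhdsSet (s := Set.univ) f (fun v => by simp) (fun v => hX v)
      hf.continuousOn
  have h2 : Continuous fun v => ((cfc f (X v)).trace).re :=
    Complex.continuous_re.comp h1.matrix_trace
  have h3 : (fun v => ∫ t, f t ∂(empiricalEigenvalueDistribution (hX v)))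
      = fun v => (Fintype.card ι : ℝ)⁻¹ * ((cfc f (X v)).trace).re := by
    funext v
    rw [integral_empiricalEigenvalueDistribution, trace_cfc (hX v)]
    simp
  rw [h3]
  exact continuous_const.mul h2

theorem measurable_empiricalEigenvalueDistribution [Nonempty ι] {V : Type*} [TopologicalSpace V]
    [MeasurableSpace V] [OpensMeasurableSpace V]
    {X : V → Matrix ι ι ℂ} (hX : ∀ v, (X v).IsHermitian) (hXc : Continuous X) :
    Measurable fun v => empiricalEigenvalueDistribution (hX v) := by
  refine Measurable.measure_of_isPiSystem_of_isProbabilityMeasure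
    ((BorelSpace.measurable_eq (α := ℝ)).trans borel_eq_generateFrom_isClosed)
    isPiSystem_isClosed fun F hF => ?_
  have hF' : IsClosed F := hF
  refine measurable_of_tendsto_metrizable (f := fun k v => ∫⁻ t, hF'.apprSeq k t
    ∂(empiricalEigenvalueDistribution (hX v))) (fun k => ?_)
    (tendsto_pi_nhds.2 fun v => HasOuterApproxClosed.tendsto_lintegral_apprSeq hF' _)
  have h : (fun v => ∫⁻ t, hF'.apprSeq k t ∂(empiricalEigenvalueDistribution (hX v)))
      = fun v => ENNReal.ofReal
        (∫ t, (hF'.apprSeq k t : ℝ) ∂(empiricalEigenvalueDistribution (hX v))) := by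
    funext v
    exact lintegral_coe_eq_integral _ (BoundedContinuousFunction.integrable_of_nnreal _ _)
  rw [h]
  exact (continuous_integral_empiricalEigenvalueDistribution hX hXc
    (NNReal.continuous_coe.comp (hF'.apprSeq k).continuous)).measurable.ennreal_ofReal

/-- The mean of the empirical eigenvalue distributions of a random Hermitian matrix is a
probability measure `ρ`, with `∫ f dρ = E[∫ f dμ_X]` for bounded continuous `f`. -/
theorem exists_mean_empiricalEigenvalueDistribution [Nonempty ι] {Ω : Type*} [MeasurableSpace Ω]
    {P : Measure Ω} [IsProbabilityMeasure P] {X : Ω → Matrix ι ι ℂ}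
    (hX : ∀ ω, (X ω).IsHermitian) (hXm : AEMeasurable (fun ω (e : ι × ι) => X ω e.1 e.2) P) :
    ∃ ρ : ProbabilityMeasure ℝ, ∀ {𝕜 : Type} [RCLike 𝕜] (f : ℝ →ᵇ 𝕜),
      ∫ t, f t ∂(ρ : Measure ℝ)
        = ∫ ω, ∫ t, f t ∂(empiricalEigenvalueDistribution (hX ω)) ∂P := by
  let κ : Kernel (ι × ι → ℂ) ℝ :=
    ⟨fun y => empiricalEigenvalueDistribution (isHermitian_hermitianPart y),
      measurable_empiricalEigenvalueDistribution _ continuous_hermitianPart⟩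
  have hκ : IsMarkovKernel κ := ⟨fun y =>
    inferInstanceAs (IsProbabilityMeasure (empiricalEigenvalueDistribution _))⟩
  let Q := P.map fun ω (e : ι × ι) => X ω e.1 e.2
  have hQ : IsProbabilityMeasure Q := Measure.isProbabilityMeasure_map hXm
  refine ⟨⟨(Q ⊗ₘ κ).snd, inferInstance⟩, fun {𝕜} _ f => ?_⟩
  change ∫ t, f t ∂((Q ⊗ₘ κ).snd) = _
  have hint : Integrable (fun p : (ι × ι → ℂ) × ℝ => f p.2) (Q ⊗ₘ κ) :=
    (f.integrable (Q ⊗ₘ κ).snd).comp_measurable measurable_snd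
  rw [Measure.snd, integral_map measurable_snd.aemeasurable
    f.continuous.aestronglyMeasurable, Measure.integral_compProd hint]
  rw [integral_map hXm f.continuous.stronglyMeasurable.integral_kernel.aestronglyMeasurable]
  refine integral_congr_ae (ae_of_all _ fun ω => ?_)
  change ∫ t, f t ∂(empiricalEigenvalueDistribution _) = _
  congr 2
  exact hermitianPart_eq (hX ω)

end MeanDistribution

/-! ### The limiting eigenvalue distribution -/

section Limit

open scoped Matrix.Norms.L2Operator

variable {d : ℕ}

theorem tendsto_discrepancy {α : Fin d → ℝ} {N : ℕ → Fin d → ℕ}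
    (hn : Tendsto (fun m => ∑ i, N m i) atTop atTop)
    (hN : ∀ i, Tendsto (fun m => (N m i : ℝ) / ((∑ i', N m i' : ℕ) : ℝ)) atTop (𝓝 (α i))) :
    Tendsto (fun m => discrepancy α (N m)) atTop (𝓝 0) := by
  have h1 : Tendsto (fun m => 1 / ((∑ i, N m i : ℕ) : ℝ)) atTop (𝓝 0) :=
    tendsto_one_div_atTop_nhds_zero_nat.comp hn
  have h2 : Tendsto (fun m => ∑ i, |(N m i : ℝ) / ((∑ i', N m i' : ℕ) : ℝ) - α i|) atTop (𝓝 0) := by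
    have := tendsto_finsetSum Finset.univ fun i (_ : i ∈ Finset.univ) =>
      ((hN i).sub_const (α i)).abs
    simpa using this
  simpa [discrepancy] using h1.add h2

theorem continuous_trWeighted (α : Fin d → ℝ) : Continuous (trWeighted α) := by
  unfold trWeighted
  fun_prop

theorem trWeighted_smul (α : Fin d → ℝ) (z : ℂ) (D : Matrix (Fin d) (Fin d) ℂ) :
    trWeighted α (z • D) = z * trWeighted α D := by
  simp only [trWeighted, Matrix.smul_apply, smul_eq_mul, Finset.mul_sum]
  exact Finset.sum_congr rfl fun i _ => by ring

theorem trWeighted_one {α : Fin d → ℝ} (hα_sum : ∑ i, α i = 1) : trWeighted α 1 = 1 := by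
  simp only [trWeighted, Matrix.one_apply_eq, mul_one]
  exact_mod_cast hα_sum

/-- Analyticity of a matrix-valued function and of its entries is the same thing. -/
theorem analyticOnNhd_matrix_iff {G : ℂ → Matrix (Fin d) (Fin d) ℂ} :
    AnalyticOnNhd ℂ G upperHalf ↔ ∀ i j, AnalyticOnNhd ℂ (fun z => G z i j) upperHalf := by
  constructor
  · intro h i j
    exact ((LinearMap.toContinuousLinearMap (Matrix.entryLinearMap ℂ ℂ i j) :
      Matrix (Fin d) (Fin d) ℂ →L[ℂ] ℂ).comp_analyticOnNhd h)
  · intro h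
    refine DifferentiableOn.analyticOnNhd ?_ isOpen_upperHalf
    have e : G = fun z => ∑ i, ∑ j, G z i j • Matrix.single i j (1 : ℂ) := by
      funext z
      conv_lhs => rw [Matrix.matrix_eq_sum_single (G z)]
      simp [Matrix.smul_single]
    rw [e]
    exact DifferentiableOn.fun_sum fun i _ => DifferentiableOn.fun_sum fun j _ =>
      (h i j).differentiableOn.smul_const _

theorem tendsto_ofReal_mul_I :
    Tendsto (fun y : ℝ => (y : ℂ) * Complex.I) atTop (Bornology.cobounded ℂ ⊓ 𝓟 upperHalf) := by
  refine tendsto_inf.2 ⟨?_, tendsto_principal.2 ?_⟩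
  · rw [← tendsto_norm_atTop_iff_cobounded]
    simpa using tendsto_abs_atTop_atTop
  · filter_upwards [eventually_gt_atTop 0] with y hy
    simpa [upperHalf] using hy

/-- The expected Green functions converge to a solution of the equation. -/
theorem exists_isSolution_tendsto_expectedGreen {α : Fin d → ℝ} (hα : ∀ i, 0 < α i)
    {σ : Fin d → Fin d → Fin d → Fin d → ℂ}
    (hσ : ∀ i j k l, σ i j k l ≠ 0 → α i = α l ∧ α j = α k) {N : ℕ → Fin d → ℕ}
    (hn : Tendsto (fun m => ∑ i, N m i) atTop atTop)
    (hN : ∀ i, Tendsto (fun m => (N m i : ℝ) / ((∑ i', N m i' : ℕ) : ℝ)) atTop (𝓝 (α i)))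
    {Ω : ℕ → Type*} [∀ m, MeasurableSpace (Ω m)] (P : ∀ m, Measure (Ω m))
    (A : ∀ m, (i j : Fin d) → Ω m → Matrix (Fin (N m i)) (Fin (N m j)) ℂ)
    (hA : ∀ m, IsGaussianBlockModel σ (P m) (A m)) :
    ∃ G, IsSolution α σ G ∧
      ∀ z ∈ upperHalf, Tendsto (fun m => expectedGreen α (P m) (A m) z) atTop (𝓝 (G z)) := by
  obtain ⟨Y, hY, C, hC0, hC⟩ := exists_norm_equation_expectedGreen_le hα hσ
  obtain ⟨C₁, hC₁0, hC₁⟩ := exists_norm_le_sum_norm_entry d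
  have him : ∀ z ∈ upperHalf, z.im ≠ 0 := fun z hz => ne_of_gt hz
  have hb : ∀ m z, z ∈ upperHalf →
      ‖expectedGreen α (P m) (A m) z‖ ≤ (C₁ * (d ^ 2 * ∑ i, (α i)⁻¹)) / z.im := by
    intro m z hz
    refine (norm_le_of_entry_le hC₁0 hC₁
      ((hA m).norm_expectedGreen_apply_le hα (him z hz))).trans (le_of_eq ?_)
    rw [abs_of_pos hz]
    ring
  have he : Tendsto (fun m => C * discrepancy α (N m)) atTop (𝓝 0) := by
    simpa using (tendsto_discrepancy hn hN).const_mul C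
  obtain ⟨G, hGd, hGl, hGe⟩ := exists_tendsto_of_approx (etaCLM α σ)
    (fun m => (hA m).differentiableOn_expectedGreen α) hb he
    (fun m z hz => hC z hz (N m) (P m) (A m) (hA m))
  have hGb : ∀ z ∈ upperHalf, ‖G z‖ ≤ (C₁ * (d ^ 2 * ∑ i, (α i)⁻¹)) / z.im := fun z hz =>
    le_of_tendsto (hGl z hz).norm (Eventually.of_forall fun m => hb m z hz)
  refine ⟨G, ⟨fun z hz i j hij => ?_, ?_, ?_, hGe⟩, hGl⟩
  · have h1 : Tendsto (fun m => expectedGreen α (P m) (A m) z i j) atTop (𝓝 (G z i j)) :=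
      ((continuous_id.matrix_elem i j).tendsto (G z)).comp (hGl z hz)
    refine tendsto_nhds_unique h1 (tendsto_const_nhds.congr fun m => ?_)
    exact ((hA m).expectedGreen_mem α (him z hz) i j hij).symm
  · exact analyticOnNhd_matrix_iff.1 (hGd.analyticOnNhd isOpen_upperHalf)
  · exact tendsto_smul_of_equation (etaCLM α σ) hGd.continuousOn hGb hGe

theorem IsSolution.eqOn {α : Fin d → ℝ} {σ : Fin d → Fin d → Fin d → Fin d → ℂ}
    {G G' : ℂ → Matrix (Fin d) (Fin d) ℂ} (hG : IsSolution α σ G) (hG' : IsSolution α σ G') :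
    Set.EqOn G G' upperHalf :=
  eqOn_of_equation (etaCLM α σ) (analyticOnNhd_matrix_iff.2 hG.analytic)
    (analyticOnNhd_matrix_iff.2 hG'.analytic) hG.equation hG'.equation hG.tendsto hG'.tendsto

/-- Convergence of the weighted traces of the expected Green functions, which are the Cauchy
transforms of the expected empirical eigenvalue distributions, gives weak convergence of these. -/
theorem exists_isLimitingEigenvalueDistribution {α : Fin d → ℝ} (hα : ∀ i, 0 < α i)
    (hα_sum : ∑ i, α i = 1) {σ : Fin d → Fin d → Fin d → Fin d → ℂ} {N : ℕ → Fin d → ℕ}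
    (hn : Tendsto (fun m => ∑ i, N m i) atTop atTop)
    {Ω : ℕ → Type*} [∀ m, MeasurableSpace (Ω m)] (P : ∀ m, Measure (Ω m))
    [∀ m, IsProbabilityMeasure (P m)]
    (A : ∀ m, (i j : Fin d) → Ω m → Matrix (Fin (N m i)) (Fin (N m j)) ℂ)
    (hA : ∀ m, IsGaussianBlockModel σ (P m) (A m)) {G : ℂ → Matrix (Fin d) (Fin d) ℂ}
    (hG : IsSolution α σ G)
    (hGl : ∀ z ∈ upperHalf,
      Tendsto (fun m => expectedGreen α (P m) (A m) z) atTop (𝓝 (G z))) :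
    ∃ μ : Measure ℝ, IsProbabilityMeasure μ ∧
      IsLimitingEigenvalueDistribution P (fun m ω => (hA m).isHermitian ω) μ ∧
      ∀ z ∈ upperHalf, cauchyTransform μ z = trWeighted α (G z) := by
  -- The empirical distribution of an empty matrix is not a probability measure; these are skipped.
  obtain ⟨m₀, hm₀⟩ := eventually_atTop.1 (hn.eventually_ge_atTop 1)
  have hne : ∀ m, Nonempty (BlockIndex (N (m + m₀))) := fun m => by
    rw [← Fintype.card_pos_iff, card_blockIndex]
    exact hm₀ (m + m₀) (Nat.le_add_left _ _)
  choose ρ hρ using fun m => exists_mean_empiricalEigenvalueDistribution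
    (P := P (m + m₀)) (hA (m + m₀)).isHermitian (hA (m + m₀)).gaussian.aemeasurable
  have htr : ∀ m, ∀ z ∈ upperHalf, cauchyTransform (ρ m : Measure ℝ) z
      = trWeighted α (expectedGreen α (P (m + m₀)) (A (m + m₀)) z) := by
    intro m z hz
    have hz0 : z.im ≠ 0 := ne_of_gt hz
    rw [(hA (m + m₀)).trWeighted_expectedGreen hα hz0, ← integral_cauchyKernel z hz0, hρ]
    refine integral_congr_ae (ae_of_all _ fun ω => ?_)
    simp only [integral_cauchyKernel]
    rw [cauchyTransform_empiricalEigenvalueDistribution _ hz0, card_blockIndex]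
    rfl
  obtain ⟨ν, hν, hνG⟩ := exists_tendsto_of_tendsto_cauchyTransform ρ
    (g := fun z => trWeighted α (G z))
    (fun z hz => by
      simp only [htr _ z hz]
      exact ((continuous_trWeighted α).tendsto _).comp
        ((hGl z hz).comp (tendsto_add_atTop_nat m₀)))
    (by
      have h1 := ((continuous_trWeighted α).tendsto _).comp
        (hG.tendsto.comp tendsto_ofReal_mul_I)
      rw [trWeighted_one hα_sum] at h1
      simpa only [Function.comp_def, trWeighted_smul] using h1)
  refine ⟨ν, inferInstance, fun f => ?_, hνG⟩
  rw [← tendsto_add_atTop_iff_nat m₀]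
  have h1 := ProbabilityMeasure.tendsto_iff_forall_integral_tendsto.1 hν f
  simpa only [hρ] using h1

end Limit

end RectBlock

end

theorem theorem2 {d : ℕ} (α : Fin d → ℝ) (hα : ∀ i, 0 < α i) (hα_sum : ∑ i, α i = 1)
    (σ : Fin d → Fin d → Fin d → Fin d → ℂ)
    (hσ : ∀ i j k l, σ i j k l ≠ 0 → α i = α l ∧ α j = α k)
    (N : ℕ → Fin d → ℕ)
    (hn : Tendsto (fun m => ∑ i, N m i) atTop atTop)
    (hN : ∀ i, Tendsto (fun m => (N m i : ℝ) / ((∑ i', N m i' : ℕ) : ℝ)) atTop (𝓝 (α i)))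
    {Ω : ℕ → Type*} [∀ m, MeasurableSpace (Ω m)] (P : ∀ m, Measure (Ω m))
    [∀ m, IsProbabilityMeasure (P m)]
    (A : ∀ m, (i j : Fin d) → Ω m → Matrix (Fin (N m i)) (Fin (N m j)) ℂ)
    (hA : ∀ m, IsGaussianBlockModel σ (P m) (A m)) :
    ∃ 𝒢 : ℂ → Matrix (Fin d) (Fin d) ℂ,
      IsSolution α σ 𝒢 ∧
      (∀ 𝒢' : ℂ → Matrix (Fin d) (Fin d) ℂ, IsSolution α σ 𝒢' → Set.EqOn 𝒢' 𝒢 upperHalf) ∧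
      ∃ μ : Measure ℝ, IsProbabilityMeasure μ ∧
        IsLimitingEigenvalueDistribution P (fun m ω => (hA m).isHermitian ω) μ ∧
        ∀ z ∈ upperHalf, cauchyTransform μ z = trWeighted α (𝒢 z) := by
  obtain ⟨G, hG, hGl⟩ := exists_isSolution_tendsto_expectedGreen hα hσ hn hN P A hA
  exact ⟨G, hG, fun G' hG' => hG'.eqOn hG,
    exists_isLimitingEigenvalueDistribution hα hα_sum hn P A hA hG hGl⟩
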